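/- Let $\mathcal{G}$ be the category of finitely generated free groups in which a morphism $G\to H$ is a pair $(u,K)$ consisting of an injective homomorphism $u:G\hookrightarrow H$ and a subgroup $K\le H$ with $H=K*u(G)$ (composition: $(v,L)\circ(u,K)=(v\circ u,\,L*v(K))$). There is a functor $\mathrm{Aut}:\mathcal{G}\to\mathbf{Gr}$ sending $(u,K)$ to the homomorphism $\mathrm{Aut}(G)\to\mathrm{Aut}(H)$, $\varphi\mapsto \mathrm{id}_K * u\varphi u^{-1}$. Let $IA\subset \mathrm{Aut}$ be the subfunctor $IA(G)=\ker(\mathrm{Aut}(G)\to\mathrm{Aut}(G_{ab}))$, and let $\gamma_n$ denote the lower central series ($\gamma_1(G)=G$, $\gamma_{n+1}(G)=[\gamma_n(G),G]$ for $n\ge 1$; by convention $\gamma_0(G)=G$). Let $\mathbf{S}(\mathbf{ab})$ be the category of free abelian groups of finite rank, where a morphism $V\to W$ is a pair $(r,s)$ of homomorphisms $s:V\to W$, $r:W\to V$ with $r\circ s=\mathrm{id}_V$; direct sum makes it a symmetric monoidal category whose unit $0$ is an initial object. Abelianization $G\mapsto G_{ab}$ defines a functor $\mathcal{G}\to\mathbf{S}(\mathbf{ab})$,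 a morphism $(u,K)$ being sent to $u_{ab}$ with the retraction $H_{ab}\to G_{ab}$ that is zero on the image of $K$. For a functor $F:\mathbf{S}(\mathbf{ab})\to\mathbf{Ab}$ and an object $x$, let $\delta_x(F)$ be the cokernel of the natural transformation $F\to F(x\oplus -)$ induced by $0\to x$. Let $\mathcal{P}ol_{-1}$ be the class of zero functors and, for $n\ge 0$, let $\mathcal{P}ol_{n}$ be the class of functors $F$ with $\delta_x(F)\in\mathcal{P}ol_{n-1}$ for all $x$. The functor $F$ is strongly polynomial if it is in $\mathcal{P}ol_n$ for some $n\in\mathbb{N}$, and its strong degree is the least such $n$ in $\mathbb{N}\cup\{\infty\}$. **Proposition.** For every $n\in\mathbb{N}$, the functor $\gamma_n(IA)/\gamma_{n+1}(IA):\mathcal{G}\to\mathbf{Ab}$ factors, up to isomorphism, through the abelianization functor $\mathcal{G}\to\mathbf{S}(\mathbf{ab})$; this factorization is unique up to a unique compatible isomorphism; and the resulting functor $\gamma_n(IA)/\gamma_{n+1}(IA):\mathbf{S}(\mathbf{ab})\to\mathbf{Ab}$ is strongly polynomial of strong degree at most $3n$. -/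

import Mathlib

open CategoryTheory CategoryTheory.Limits MonoidalCategory

namespace StrongPol

/-! # Strongly polynomial functors on a monoidal category with initial unit -/

section General

universe v u v' u'

variable {M : Type u} [Category.{v} M] [MonoidalCategory M] {A : Type u'} [Category.{v'} A]

/-- The translation functor `τ_x`: precomposition with the endofunctor `x ⊕ -` of `M` (the monoidal
structure `⊕` of `M` is written `⊗` in Mathlib's notation). -/
def translate (x : M) (F : M ⥤ A) : M ⥤ A := tensorLeft x ⋙ F

/-- The morphism `i_x(F) : F = τ_0(F) ⟶ τ_x(F)` induced by the unique morphism `0 ⟶ x`. -/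
def toTranslate (h : IsInitial (𝟙_ M)) (x : M) (F : M ⥤ A) : F ⟶ translate x F where
  app y := F.map ((λ_ y).inv ≫ h.to x ▷ y)
  naturality y z f := by
    simp only [translate, Functor.comp_map, ← Functor.map_comp]
    congr 1
    change f ≫ (λ_ z).inv ≫ h.to x ▷ z = ((λ_ y).inv ≫ h.to x ▷ y) ≫ x ◁ f
    rw [Category.assoc, ← whisker_exchange, leftUnitor_inv_naturality_assoc]

variable [Abelian A]

/-- The difference functor `δ_x`: the cokernel of `i_x(F)` in the category of functors. -/
noncomputable def diff (h : IsInitial (𝟙_ M)) (x : M) (F : M ⥤ A) : M ⥤ A :=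
  cokernel (toTranslate h x F)

/-- `IsPolLT h k F` says that `F` belongs to `Pol_{k-1}`: for `k = 0` this is the class of zero
functors, and `F` is in `Pol_k` iff `δ_x(F)` is in `Pol_{k-1}` for every object `x`. -/
def IsPolLT (h : IsInitial (𝟙_ M)) : ℕ → (M ⥤ A) → Prop
  | 0, F => IsZero F
  | k + 1, F => ∀ x : M, IsPolLT h k (diff h x F)

/-- Membership in `Pol_n`, for `n` a natural number. -/
def IsPol (h : IsInitial (𝟙_ M)) (n : ℕ) (F : M ⥤ A) : Prop := IsPolLT h (n + 1) F

/-- `F` is strongly polynomial if it belongs to `Pol_n` for some `n`. -/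
def IsStronglyPolynomial (h : IsInitial (𝟙_ M)) (F : M ⥤ A) : Prop := ∃ n : ℕ, IsPol h n F

/-- The strong degree of `F`: the least natural number `n` such that `F` is in `Pol_n`, and `∞` if
there is none. -/
noncomputable def strongDegree (h : IsInitial (𝟙_ M)) (F : M ⥤ A) : ℕ∞ :=
  ⨅ (n : ℕ) (_ : IsPol h n F), (n : ℕ∞)

end General

/-! # The category `S(ab)` -/

/-- The objects of `S(ab)`: free abelian groups of finite rank. -/
structure SAb : Type 1 where
  carrier : Type
  [addCommGroup : AddCommGroup carrier]
  [free : Module.Free ℤ carrier]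
  [finite : Module.Finite ℤ carrier]

attribute [instance] SAb.addCommGroup SAb.free SAb.finite

namespace SAb

/-- A morphism `V ⟶ W` of `S(ab)`: a monomorphism `sec : V →+ W` together with a splitting
`ret : W →+ V`, so `ret ∘ sec = id`. -/
@[ext]
structure Hom (V W : SAb) where
  ret : W.carrier →+ V.carrier
  sec : V.carrier →+ W.carrier
  ret_sec : ret.comp sec = AddMonoidHom.id V.carrier

@[simp]
lemma Hom.ret_sec_apply {V W : SAb} (f : Hom V W) (x : V.carrier) : f.ret (f.sec x) = x :=
  DFunLike.congr_fun f.ret_sec x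

instance : Category SAb where
  Hom := Hom
  id V := ⟨AddMonoidHom.id _, AddMonoidHom.id _, rfl⟩
  comp f g := ⟨f.ret.comp g.ret, g.sec.comp f.sec, by ext x; simp⟩
  id_comp _ := rfl
  comp_id _ := rfl
  assoc _ _ _ := rfl

@[ext]
lemma hom_ext {V W : SAb} {f g : V ⟶ W} (h₁ : Hom.ret f = Hom.ret g)
    (h₂ : Hom.sec f = Hom.sec g) : f = g := Hom.ext h₁ h₂

@[simp] lemma id_ret (V : SAb) : Hom.ret (𝟙 V) = AddMonoidHom.id _ := rfl
@[simp] lemma id_sec (V : SAb) : Hom.sec (𝟙 V) = AddMonoidHom.id _ := rfl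
@[simp] lemma comp_ret {U V W : SAb} (f : U ⟶ V) (g : V ⟶ W) :
    Hom.ret (f ≫ g) = (Hom.ret f).comp (Hom.ret g) := rfl
@[simp] lemma comp_sec {U V W : SAb} (f : U ⟶ V) (g : V ⟶ W) :
    Hom.sec (f ≫ g) = (Hom.sec g).comp (Hom.sec f) := rfl

/-- An isomorphism of groups, as an isomorphism of `S(ab)`. -/
def isoOfAddEquiv {V W : SAb} (e : V.carrier ≃+ W.carrier) : V ≅ W where
  hom := ⟨e.symm.toAddMonoidHom, e.toAddMonoidHom, by ext x; simp⟩
  inv := ⟨e.toAddMonoidHom, e.symm.toAddMonoidHom, by ext x; simp⟩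
  hom_inv_id := by ext x <;> simp
  inv_hom_id := by ext x <;> simp

/-- The direct sum of two morphisms. -/
def sumHom {V W V' W' : SAb} (f : V ⟶ W) (g : V' ⟶ W') :
    (⟨V.carrier × V'.carrier⟩ : SAb) ⟶ ⟨W.carrier × W'.carrier⟩ :=
  ⟨(Hom.ret f).prodMap (Hom.ret g), (Hom.sec f).prodMap (Hom.sec g), by
    ext x <;> simp⟩

/-- The direct sum of free abelian groups as a monoidal structure on `S(ab)`. -/
instance : MonoidalCategoryStruct SAb where
  tensorObj V W := ⟨V.carrier × W.carrier⟩
  tensorUnit := ⟨PUnit⟩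
  tensorHom f g := sumHom f g
  whiskerLeft V _ _ g := sumHom (𝟙 V) g
  whiskerRight f W := sumHom f (𝟙 W)
  associator U V W := isoOfAddEquiv (V := ⟨(U.carrier × V.carrier) × W.carrier⟩)
    (W := ⟨U.carrier × V.carrier × W.carrier⟩) AddEquiv.prodAssoc
  leftUnitor V := isoOfAddEquiv (V := ⟨PUnit × V.carrier⟩) (W := V) AddEquiv.uniqueProd
  rightUnitor V := isoOfAddEquiv (V := ⟨V.carrier × PUnit⟩) (W := V) AddEquiv.prodUnique

instance : MonoidalCategory SAb where
  tensorHom_def _ _ := rfl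
  id_tensorHom_id _ _ := rfl
  tensorHom_comp_tensorHom _ _ _ _ := rfl
  whiskerLeft_id _ _ := rfl
  id_whiskerRight _ _ := rfl
  associator_naturality _ _ _ := rfl
  leftUnitor_naturality _ := rfl
  rightUnitor_naturality _ := rfl
  pentagon _ _ _ _ := rfl
  triangle _ _ := rfl

instance : SymmetricCategory SAb where
  braiding V W := isoOfAddEquiv (V := ⟨V.carrier × W.carrier⟩) (W := ⟨W.carrier × V.carrier⟩)
    AddEquiv.prodComm
  braiding_naturality_right _ _ _ _ := rfl
  braiding_naturality_left _ _ := rfl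
  hexagon_forward _ _ _ := rfl
  hexagon_reverse _ _ _ := rfl
  symmetry _ _ := rfl

/-- The unit `0` of `S(ab)` is an initial object. -/
def isInitialUnit : IsInitial (𝟙_ SAb) :=
  IsInitial.ofUniqueHom
    (fun V => (⟨(0 : V.carrier →+ PUnit), (0 : PUnit →+ V.carrier), rfl⟩ : Hom ⟨PUnit⟩ V))
    (fun V m => Hom.ext (x := (m : Hom ⟨PUnit⟩ V)) rfl
      (AddMonoidHom.ext fun _ => map_zero (Hom.sec (m : Hom ⟨PUnit⟩ V))))

end SAb

/-! # The category `𝒢` of free groups of finite type -/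

/-- The objects of `𝒢`: finitely generated free groups. -/
structure FGrp : Type 1 where
  carrier : Type
  [group : Group carrier]
  [free : IsFreeGroup carrier]
  [fg : Group.FG carrier]

attribute [instance] FGrp.group FGrp.free FGrp.fg

namespace FGrp

open Monoid (Coprod)

/-- A morphism `G ⟶ H` of `𝒢`: a homomorphism `u : G →* H` and a subgroup `K` of `H` such that the
map `K ∗ G →* H` given by the inclusion of `K` and by `u` is an isomorphism. Equivalently, `u` is
injective and `H` is the (internal) free product of `K` and `u(G)`. -/
@[ext]
structure Hom (G H : FGrp) where
  u : G.carrier →* H.carrier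
  K : Subgroup H.carrier
  bij : Function.Bijective (Coprod.lift K.subtype u)

variable {G H P : FGrp}

/-- The identification `K ∗ G ≃* H`. -/
noncomputable def Hom.equiv (f : Hom G H) : Coprod f.K G.carrier ≃* H.carrier :=
  MulEquiv.ofBijective _ f.bij

@[simp] lemma Hom.equiv_inl (f : Hom G H) (k : f.K) : f.equiv (Coprod.inl k) = k := rfl
@[simp] lemma Hom.equiv_inr (f : Hom G H) (g : G.carrier) : f.equiv (Coprod.inr g) = f.u g := rfl
@[simp] lemma Hom.equiv_symm_coe (f : Hom G H) (k : f.K) :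
    f.equiv.symm (k : H.carrier) = Coprod.inl k := by
  rw [← f.equiv_inl, MulEquiv.symm_apply_apply]
@[simp] lemma Hom.equiv_symm_u (f : Hom G H) (g : G.carrier) :
    f.equiv.symm (f.u g) = Coprod.inr g := by
  rw [← f.equiv_inr, MulEquiv.symm_apply_apply]

/-- Homomorphisms out of `H` agree if they agree on `K` and on `u(G)`. -/
lemma Hom.monoidHom_ext (f : Hom G H) {Q : Type*} [Monoid Q] {a b : H.carrier →* Q}
    (hK : ∀ k ∈ f.K, a k = b k) (hu : ∀ g, a (f.u g) = b (f.u g)) : a = b := by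
  have h : a.comp f.equiv.toMonoidHom = b.comp f.equiv.toMonoidHom :=
    Coprod.hom_ext (MonoidHom.ext fun k => hK k k.2) (MonoidHom.ext fun g => hu g)
  ext x
  obtain ⟨y, rfl⟩ := f.equiv.surjective x
  exact DFunLike.congr_fun h y

/-- The identity `(id, 1)`. -/
def Hom.id (G : FGrp) : Hom G G where
  u := MonoidHom.id _
  K := ⊥
  bij := by
    constructor
    · have h : (Coprod.inr (M := (⊥ : Subgroup G.carrier))).comp
          (Coprod.lift (⊥ : Subgroup G.carrier).subtype (MonoidHom.id G.carrier)) =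
          MonoidHom.id _ := by
        refine Coprod.hom_ext (MonoidHom.ext fun k => ?_) rfl
        obtain rfl : k = 1 := Subsingleton.elim _ _
        simp
      exact Function.LeftInverse.injective (g := Coprod.inr) fun x => DFunLike.congr_fun h x
    · exact fun g => ⟨Coprod.inr g, rfl⟩

/-- The composite of `(u, K)` and `(v, L)` is `(v ∘ u, L ∗ v(K))`. -/
def Hom.comp (f : Hom G H) (g : Hom H P) : Hom G P where
  u := g.u.comp f.u
  K := g.K ⊔ f.K.map g.u
  bij := by
    -- `φ : (L ∗ K) ∗ G ≃* P`
    let φ : Coprod (Coprod g.K f.K) G.carrier ≃* P.carrier :=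
      (MulEquiv.coprodAssoc g.K f.K G.carrier).trans
        ((MulEquiv.coprodCongr (MulEquiv.refl g.K) f.equiv).trans g.equiv)
    let j : Coprod g.K f.K →* P.carrier := φ.toMonoidHom.comp Coprod.inl
    have hj : Function.Injective j := φ.injective.comp Coprod.inl_injective
    have hr : j.range = g.K ⊔ f.K.map g.u := by
      have : j = Coprod.lift g.K.subtype (g.u.comp f.K.subtype) :=
        Coprod.hom_ext rfl rfl
      rw [this, Coprod.range_lift, Subgroup.range_subtype, MonoidHom.range_comp,
        Subgroup.range_subtype]
    let e : Coprod g.K f.K ≃* (g.K ⊔ f.K.map g.u : Subgroup P.carrier) :=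
      (MonoidHom.ofInjective hj).trans (MulEquiv.subgroupCongr hr)
    let ψ := (MulEquiv.coprodCongr e.symm (MulEquiv.refl G.carrier)).trans φ
    have hψ : Coprod.lift (g.K ⊔ f.K.map g.u : Subgroup P.carrier).subtype (g.u.comp f.u) =
        ψ.toMonoidHom := by
      refine Coprod.hom_ext (MonoidHom.ext fun k => ?_) (MonoidHom.ext fun x => rfl)
      obtain ⟨y, rfl⟩ := e.surjective k
      change _ = φ (Coprod.inl (e.symm (e y)))
      rw [e.symm_apply_apply]
      rfl
    rw [hψ]
    exact ψ.bijective

instance : Category FGrp where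
  Hom := Hom
  id := Hom.id
  comp f g := Hom.comp f g
  id_comp f := by
    refine Hom.ext rfl ?_
    simp [Hom.comp, Hom.id]
  comp_id f := by
    refine Hom.ext rfl ?_
    simp [Hom.comp, Hom.id]
  assoc f g h := by
    refine Hom.ext rfl ?_
    simp [Hom.comp, Subgroup.map_sup, Subgroup.map_map, sup_assoc]

@[simp] lemma id_u (G : FGrp) : Hom.u (𝟙 G) = MonoidHom.id _ := rfl
@[simp] lemma id_K (G : FGrp) : Hom.K (𝟙 G) = ⊥ := rfl
@[simp] lemma comp_u (f : G ⟶ H) (g : H ⟶ P) : Hom.u (f ≫ g) = (Hom.u g).comp (Hom.u f) := rfl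
@[simp] lemma comp_K (f : G ⟶ H) (g : H ⟶ P) :
    Hom.K (f ≫ g) = Hom.K g ⊔ (Hom.K f).map (Hom.u g) := rfl

/-! ## The abelianization functor `𝒢 ⥤ S(ab)` -/

/-- The retraction `H = K ∗ u(G) →* G` of `u` that kills `K`. -/
noncomputable def Hom.retract (f : Hom G H) : H.carrier →* G.carrier :=
  Coprod.snd.comp f.equiv.symm.toMonoidHom

@[simp] lemma Hom.retract_u (f : Hom G H) (g : G.carrier) : f.retract (f.u g) = g := by
  simp [Hom.retract]

lemma Hom.retract_of_mem (f : Hom G H) {k : H.carrier} (hk : k ∈ f.K) : f.retract k = 1 := by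
  have := f.equiv_symm_coe ⟨k, hk⟩
  simp only [Hom.retract, MonoidHom.comp_apply, MulEquiv.coe_toMonoidHom] at this ⊢
  rw [this, Coprod.snd_apply_inl]

lemma retract_id (G : FGrp) : Hom.retract (𝟙 G) = MonoidHom.id _ := by
  ext x
  exact Hom.retract_u (𝟙 G) x

lemma retract_comp (f : G ⟶ H) (g : H ⟶ P) :
    Hom.retract (f ≫ g) = (Hom.retract f).comp (Hom.retract g) := by
  refine Hom.monoidHom_ext g (fun k hk => ?_) (fun x => ?_)
  · rw [Hom.retract_of_mem _ (show k ∈ Hom.K (f ≫ g) from Subgroup.mem_sup_left hk),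
      MonoidHom.comp_apply, Hom.retract_of_mem g hk, map_one]
  · rw [MonoidHom.comp_apply, Hom.retract_u g]
    revert x
    refine DFunLike.congr_fun (f := (Hom.retract (f ≫ g)).comp (Hom.u g)) ?_
    refine Hom.monoidHom_ext f (fun k hk => ?_) (fun x => ?_)
    · rw [Hom.retract_of_mem f hk]
      exact Hom.retract_of_mem _ (show Hom.u g k ∈ Hom.K (f ≫ g) from
        Subgroup.mem_sup_right (Subgroup.mem_map_of_mem _ hk))
    · rw [Hom.retract_u f]
      exact Hom.retract_u (f ≫ g) x

instance (G : FGrp) : Module.Free ℤ (Additive (Abelianization G.carrier)) := by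
  let e : FreeAbelianGroup (IsFreeGroup.Generators G.carrier) ≃+
      Additive (Abelianization G.carrier) :=
    MulEquiv.toAdditive (IsFreeGroup.toFreeGroup G.carrier).symm.abelianizationCongr
  exact Module.Free.of_equiv e.toIntLinearEquiv

instance (G : FGrp) : Module.Finite ℤ (Additive (Abelianization G.carrier)) := by
  have : Group.FG (Abelianization G.carrier) :=
    Group.fg_of_surjective (f := Abelianization.of) (QuotientGroup.mk'_surjective _)
  exact Module.Finite.iff_addGroup_fg.mpr (GroupFG.iff_add_fg.mp this)

/-- The abelianization functor `𝒢 ⥤ S(ab)`: it sends `G` to `G_ab` and `(u, K)` to the morphism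
`u_ab` together with its splitting `H_ab = K_ab ⊕ G_ab →+ G_ab`. -/
noncomputable def ab : FGrp ⥤ SAb where
  obj G := ⟨Additive (Abelianization G.carrier)⟩
  map {G H} f := (⟨(Abelianization.map (Hom.retract f)).toAdditive,
    (Abelianization.map (Hom.u f)).toAdditive, by
      have h : (Abelianization.map (Hom.retract f)).comp (Abelianization.map (Hom.u f)) =
          MonoidHom.id _ := by
        ext x
        simp
      exact AddMonoidHom.ext fun x => DFunLike.congr_fun h x.toMul⟩ : SAb.Hom _ _)
  map_id G := by
    refine SAb.Hom.ext ?_ ?_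
    · simp only [retract_id, Abelianization.map_id]
      rfl
    · simp only [id_u, Abelianization.map_id]
      rfl
  map_comp f g := by
    refine SAb.Hom.ext ?_ ?_
    · simp only [retract_comp, ← Abelianization.map_comp]
      rfl
    · simp only [comp_u, ← Abelianization.map_comp]
      rfl

/-! ## The functors `Aut` and `IA` -/

/-- For `f = (u, K) : G ⟶ H`, the group morphism `Aut G →* Aut H` that sends `φ` to the
automorphism of `H = K ∗ u(G)` equal to the identity on `K` and to `u φ u⁻¹` on `u(G)`. -/
noncomputable def Hom.autMap (f : Hom G H) : MulAut G.carrier →* MulAut H.carrier where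
  toFun φ := f.equiv.symm.trans ((MulEquiv.coprodCongr (MulEquiv.refl f.K) φ).trans f.equiv)
  map_one' := by
    refine MulEquiv.toMonoidHom_injective (f.monoidHom_ext (fun k hk => ?_) (fun g => ?_))
    · have := f.equiv_symm_coe ⟨k, hk⟩
      simp only at this
      simp [this]
    · simp
  map_mul' φ ψ := by
    refine MulEquiv.toMonoidHom_injective (f.monoidHom_ext (fun k hk => ?_) (fun g => ?_))
    · have := f.equiv_symm_coe ⟨k, hk⟩
      simp only at this
      simp [this]
    · simp

lemma Hom.autMap_u (f : Hom G H) (φ : MulAut G.carrier) (g : G.carrier) :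
    f.autMap φ (f.u g) = f.u (φ g) := by
  simp [Hom.autMap]

lemma Hom.autMap_of_mem (f : Hom G H) (φ : MulAut G.carrier) {k : H.carrier} (hk : k ∈ f.K) :
    f.autMap φ k = k := by
  have := f.equiv_symm_coe ⟨k, hk⟩
  simp only at this
  simp [Hom.autMap, this]

lemma autMap_id (G : FGrp) : Hom.autMap (𝟙 G) = MonoidHom.id _ := by
  ext φ x
  exact Hom.autMap_u (𝟙 G) φ x

lemma autMap_comp (f : G ⟶ H) (g : H ⟶ P) :
    Hom.autMap (f ≫ g) = (Hom.autMap g).comp (Hom.autMap f) := by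
  refine MonoidHom.ext fun φ => MulEquiv.toMonoidHom_injective
    (Hom.monoidHom_ext g (fun k hk => ?_) (fun x => ?_))
  · exact (Hom.autMap_of_mem (f ≫ g) φ (Subgroup.mem_sup_left hk)).trans
      (Hom.autMap_of_mem g _ hk).symm
  · refine Eq.trans ?_ (Hom.autMap_u g (Hom.autMap f φ) x).symm
    revert x
    refine DFunLike.congr_fun
      (f := (MulEquiv.toMonoidHom (Hom.autMap (f ≫ g) φ)).comp (Hom.u g))
      (g := (Hom.u g).comp (MulEquiv.toMonoidHom (Hom.autMap f φ)))
      (Hom.monoidHom_ext f (fun k hk => ?_) (fun x => ?_))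
    · exact (Hom.autMap_of_mem (f ≫ g) φ
        (Subgroup.mem_sup_right (Subgroup.mem_map_of_mem _ hk))).trans
        (congrArg (Hom.u g) (Hom.autMap_of_mem f φ hk).symm)
    · exact (Hom.autMap_u (f ≫ g) φ x).trans (congrArg (Hom.u g) (Hom.autMap_u f φ x).symm)

/-- The functor `Aut : 𝒢 ⥤ Gr`. -/
noncomputable def autFunctor : FGrp ⥤ GrpCat.{0} where
  obj G := GrpCat.of (MulAut G.carrier)
  map f := GrpCat.ofHom (Hom.autMap f)
  map_id G := by rw [autMap_id]; rfl
  map_comp f g := by rw [autMap_comp]; rfl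

/-- The canonical morphism `Aut G →* Aut (G_ab)`. -/
def autAb (G : Type*) [Group G] : MulAut G →* MulAut (Abelianization G) where
  toFun φ := MulEquiv.abelianizationCongr φ
  map_one' := abelianizationCongr_refl
  map_mul' φ ψ := (abelianizationCongr_trans ψ φ).symm

/-- The group `IA(G)` of automorphisms of `G` that induce the identity on `G_ab`. -/
def IA (G : Type*) [Group G] : Subgroup (MulAut G) := (autAb G).ker

lemma mem_IA_iff {G : Type*} [Group G] {φ : MulAut G} :
    φ ∈ IA G ↔ ∀ x, Abelianization.of (φ x) = Abelianization.of x := by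
  rw [IA, MonoidHom.mem_ker]
  constructor
  · intro h x
    exact DFunLike.congr_fun h (Abelianization.of x)
  · intro h
    refine MulEquiv.toMonoidHom_injective (Abelianization.hom_ext _ _ (MonoidHom.ext h))

lemma Hom.autMap_mem_IA (f : Hom G H) {φ : MulAut G.carrier} (hφ : φ ∈ IA G.carrier) :
    f.autMap φ ∈ IA H.carrier := by
  rw [mem_IA_iff] at hφ ⊢
  refine DFunLike.congr_fun
    (f := Abelianization.of.comp (MulEquiv.toMonoidHom (f.autMap φ)))
    (g := Abelianization.of) (f.monoidHom_ext (fun k hk => ?_) (fun x => ?_))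
  · exact congrArg Abelianization.of (f.autMap_of_mem φ hk)
  · refine (congrArg Abelianization.of (f.autMap_u φ x)).trans ?_
    rw [← Abelianization.map_of f.u, ← Abelianization.map_of f.u, hφ]

/-- The subfunctor `IA : 𝒢 ⥤ Gr` of `Aut`. -/
noncomputable def iaFunctor : FGrp ⥤ GrpCat.{0} where
  obj G := GrpCat.of (IA G.carrier)
  map f := GrpCat.ofHom
    (((Hom.autMap f).comp (IA _).subtype).codRestrict (IA _) fun φ => Hom.autMap_mem_IA f φ.2)
  map_id G := by
    refine GrpCat.hom_ext (MonoidHom.ext fun φ => Subtype.ext ?_)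
    exact DFunLike.congr_fun (autMap_id G) φ.1
  map_comp f g := by
    refine GrpCat.hom_ext (MonoidHom.ext fun φ => Subtype.ext ?_)
    exact DFunLike.congr_fun (autMap_comp f g) φ.1

end FGrp

/-! # The functors `γ_n / γ_{n+1} : Gr ⥤ Ab` -/

section LowerCentral

/-- The lower central series with the indexing `γ_1(G) = G`, `γ_{n+1}(G) = [γ_n(G), G]` for `n ≥ 1`
(and the convention `γ_0(G) = G`). -/
def gamma (n : ℕ) (G : Type*) [Group G] : Subgroup G := (⊤ : Subgroup G).lowerCentralSeries (n - 1)

instance (n : ℕ) (G : Type*) [Group G] : (gamma n G).Normal :=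
  inferInstanceAs ((⊤ : Subgroup G).lowerCentralSeries (n - 1)).Normal

lemma map_mem_gamma {G H : Type*} [Group G] [Group H] (f : G →* H) (n : ℕ) {x : G}
    (hx : x ∈ gamma n G) : f x ∈ gamma n H := by
  have h := Subgroup.map_lowerCentralSeries (⊤ : Subgroup G) f (n - 1)
  have hle : ∀ (m : ℕ) (S : Subgroup H), S.lowerCentralSeries m ≤
      (⊤ : Subgroup H).lowerCentralSeries m := by
    intro m S
    induction m with
    | zero => exact le_top
    | succ m ih => exact Subgroup.commutator_mono ih le_top
  exact hle _ _ (h ▸ Subgroup.mem_map_of_mem f hx)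

lemma commutator_mem_gamma {G : Type*} [Group G] (n : ℕ) {x : G} (y : G) (hx : x ∈ gamma n G) :
    x * y * x⁻¹ * y⁻¹ ∈ gamma (n + 1) G := by
  cases n with
  | zero => exact Subgroup.mem_top _
  | succ n => exact Subgroup.commutator_mem_commutator hx (Subgroup.mem_top y)

/-- The quotient group `γ_n(G) / γ_{n+1}(G)`. -/
abbrev GammaQuot (n : ℕ) (G : Type*) [Group G] : Type _ :=
  gamma n G ⧸ (gamma (n + 1) G).subgroupOf (gamma n G)

instance (n : ℕ) (G : Type*) [Group G] : CommGroup (GammaQuot n G) where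
  mul_comm a b := by
    induction a using QuotientGroup.induction_on with | _ x
    induction b using QuotientGroup.induction_on with | _ y
    rw [← QuotientGroup.mk_mul, ← QuotientGroup.mk_mul, QuotientGroup.eq,
      Subgroup.mem_subgroupOf]
    have h := commutator_mem_gamma n ((x⁻¹ : gamma n G) : G) (y⁻¹).2
    convert h using 1
    simp [mul_assoc]

/-- The morphism `γ_n(G)/γ_{n+1}(G) →* γ_n(H)/γ_{n+1}(H)` induced by `f : G →* H`. -/
def gammaQuotMap (n : ℕ) {G H : Type*} [Group G] [Group H] (f : G →* H) :
    GammaQuot n G →* GammaQuot n H :=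
  QuotientGroup.map _ _
    ((f.comp (gamma n G).subtype).codRestrict (gamma n H) fun x => map_mem_gamma f n x.2)
    fun _ hx => map_mem_gamma f (n + 1) hx

lemma gammaQuotMap_id (n : ℕ) (G : Type*) [Group G] :
    gammaQuotMap n (MonoidHom.id G) = MonoidHom.id _ :=
  QuotientGroup.monoidHom_ext _ rfl

lemma gammaQuotMap_comp (n : ℕ) {G H P : Type*} [Group G] [Group H] [Group P] (f : G →* H)
    (g : H →* P) : gammaQuotMap n (g.comp f) = (gammaQuotMap n g).comp (gammaQuotMap n f) :=
  QuotientGroup.monoidHom_ext _ rfl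

/-- The functor `γ_n / γ_{n+1} : Gr ⥤ Ab`. -/
def gammaQuotFunctor (n : ℕ) : GrpCat.{0} ⥤ Ab.{0} where
  obj G := AddCommGrpCat.of (Additive (GammaQuot n G))
  map f := AddCommGrpCat.ofHom (gammaQuotMap n f.hom).toAdditive
  map_id G := by
    rw [GrpCat.hom_id, gammaQuotMap_id]
    rfl
  map_comp f g := by
    rw [GrpCat.hom_comp, gammaQuotMap_comp]
    rfl

end LowerCentral

/-- The functor `γ_n(IA) / γ_{n+1}(IA) : 𝒢 ⥤ Ab`. -/
noncomputable def gammaIA (n : ℕ) : FGrp ⥤ Ab.{0} := FGrp.iaFunctor ⋙ gammaQuotFunctor n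

end StrongPol

/-! Descent. The functor `FGrp.ab` is essentially surjective and full: every morphism of `S(ab)` is,
up to isomorphism, a coordinate inclusion (`SAb.exists_iso_stdIncl`), and isomorphisms of
abelianizations lift because `Aut(F_r) → GL_r(ℤ)` is onto (`exists_rho_eq`). Two morphisms `G ⟶ H`
with the same abelianization differ by an element of `IA(H)` (`FGrp.exists_IA_of_ab_eq`). This
element acts on `IA(H)` by an inner automorphism, hence trivially on `γ_n/γ_{n+1}`. So the functor
factors (`exists_factorization`), and uniqueness holds because precomposition with `FGrp.ab` is
fully faithful.

Degree. Call a functor generated below `k` if its values come from coordinate inclusions of rank `<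
k`. Passing to `δ_x` lowers `k` by one: a set of coordinates of `x ⊕ ℤ^ι` either lies in `ι`, and
dies in the cokernel, or uses a coordinate of `x`, and leaves fewer in `ι` (`GeneratedBelow.diff`).
It remains to generate `γ_n(IA)/γ_{n+1}(IA)` by automorphisms supported on `3n` generators
(`lcs_IA_le_lcsSmall_sup`). By commutator calculus this reduces to `n = 1`, that is to Magnus'
theorem: modulo commutators, `IA` is generated by `a_i ↦ a_j⁻¹ a_i a_j` and `a_i ↦ a_i [a_j⁻¹,
a_k]`, which involve at most three letters.

Magnus' theorem (`IA_le_magnus`). The subgroup `magnus` is normal in the whole automorphism group,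
which is checked on Nielsen's generators (`elementary_eq_top`). Modulo `magnus`, transvections
satisfy the Steinberg relations, so `Aut(F_r)` acts through them on pairs (integral vector, coset of
`parabolic t`). Peak reduction shows that a point in the orbit of the base point is determined by
its vector; hence the stabilizer of a basis vector lies in `parabolic t`, the product of `lowerUni
t` with the automorphisms of the other generators. An element of `IA` then splits into an element of
`magnus` and an element of `IA` on one generator less, and induction on the rank concludes. -/

namespace StrongPol

/-! # Signed letters and integral vectors -/

section Letters

variable {ι : Type*}

/-- The inverse of a signed letter. -/
def negLetter (a : ι × Bool) : ι × Bool := (a.1, !a.2)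

@[simp] lemma negLetter_fst (a : ι × Bool) : (negLetter a).1 = a.1 := rfl
@[simp] lemma negLetter_snd (a : ι × Bool) : (negLetter a).2 = !a.2 := rfl
@[simp] lemma negLetter_negLetter (a : ι × Bool) : negLetter (negLetter a) = a := by
  simp [negLetter]

lemma eq_or_eq_negLetter {a b : ι × Bool} (h : a.1 = b.1) : a = b ∨ a = negLetter b := by
  obtain ⟨i, s⟩ := a
  obtain ⟨j, t⟩ := b
  obtain rfl : i = j := h
  cases s <;> cases t <;> simp [negLetter]

/-- The signed coordinate of an integral vector at a signed letter. -/
def letterVal (v : ι → ℤ) (a : ι × Bool) : ℤ := bif a.2 then v a.1 else -v a.1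

@[simp] lemma letterVal_negLetter (v : ι → ℤ) (a : ι × Bool) :
    letterVal v (negLetter a) = -letterVal v a := by
  obtain ⟨i, s⟩ := a
  cases s <;> simp [letterVal, negLetter]

lemma natAbs_letterVal (v : ι → ℤ) (a : ι × Bool) : (letterVal v a).natAbs = (v a.1).natAbs := by
  obtain ⟨i, s⟩ := a
  cases s <;> simp [letterVal]

lemma letterVal_eq_zero {v : ι → ℤ} {a : ι × Bool} : letterVal v a = 0 ↔ v a.1 = 0 := by
  rw [← Int.natAbs_eq_zero, natAbs_letterVal, Int.natAbs_eq_zero]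

lemma eq_of_letterVal_pos {v : ι → ℤ} {a b : ι × Bool} (h : a.1 = b.1) (ha : 0 < letterVal v a)
    (hb : 0 < letterVal v b) : a = b := by
  rcases eq_or_eq_negLetter h with h | rfl
  · exact h
  · rw [letterVal_negLetter] at ha
    omega

variable [Fintype ι]

/-- The `ℓ¹`-norm of an integral vector. -/
def vecNorm (v : ι → ℤ) : ℕ := ∑ i, (v i).natAbs

end Letters

/-! # Peak reduction for elementary moves on integral vectors -/

section Peak

variable {ι : Type*} [Fintype ι] {P : Type*}

/-- A set `P` over the set of integral vectors, with elementary moves `x a b` over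
`v_a ↦ v_a - v_b` and a set `W` of monomial transformations, subject to the Steinberg relations. -/
structure SteinbergAction (ι : Type*) [Fintype ι] (P : Type*) where
  vec : P → ι → ℤ
  x : ι × Bool → ι × Bool → P → P
  W : Set (P → P)
  o : P
  val_x_self : ∀ a b p, a.1 ≠ b.1 →
    letterVal (vec (x a b p)) a = letterVal (vec p) a - letterVal (vec p) b
  vec_x_of_ne : ∀ a b p i, a.1 ≠ b.1 → i ≠ a.1 → vec (x a b p) i = vec p i
  x_neg_neg : ∀ a b, x (negLetter a) (negLetter b) = x a b
  x_neg_x : ∀ a b p, a.1 ≠ b.1 → x a (negLetter b) (x a b p) = p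
  comm : ∀ a b c d p, a.1 ≠ b.1 → c.1 ≠ d.1 → a.1 ≠ d.1 → b.1 ≠ c.1 →
    x a b (x c d p) = x c d (x a b p)
  tri : ∀ a b d p, a.1 ≠ b.1 → a.1 ≠ d.1 → b.1 ≠ d.1 →
    x a d (x a b (x b d p)) = x b d (x a b p)
  rot : ∀ a b, a.1 ≠ b.1 → (fun p => x a b (x b (negLetter a) (x a b p))) ∈ W
  id_mem : id ∈ W
  comp_mem : ∀ g ∈ W, ∀ h ∈ W, g ∘ h ∈ W
  inv_mem : ∀ g ∈ W, ∃ h ∈ W, ∀ p, h (g p) = p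
  conj : ∀ g ∈ W, ∃ f : ι × Bool → ι × Bool, ∀ a b p, a.1 ≠ b.1 →
    (f a).1 ≠ (f b).1 ∧ x (f a) (f b) (g p) = g (x a b p)
  norm_w : ∀ g ∈ W, ∀ p, vecNorm (vec (g p)) = vecNorm (vec p)
  base_inj : ∀ g ∈ W, ∀ h ∈ W, vec (g o) = vec (h o) → g o = h o
  base_fix : ∀ g ∈ W, ∀ a b, a.1 ≠ b.1 → vec (g o) b.1 = 0 → x a b (g o) = g o
  base_unit : ∀ g ∈ W, ∀ i j, vec (g o) i ≠ 0 → vec (g o) j ≠ 0 → i = j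

namespace SteinbergAction

variable (A : SteinbergAction ι P)

/-- The norm of a point. -/
def norm (p : P) : ℕ := vecNorm (A.vec p)

/-- The signed coordinate of a point. -/
def val (p : P) (a : ι × Bool) : ℤ := letterVal (A.vec p) a

variable {A}

lemma val_neg (p : P) (a : ι × Bool) : A.val p (negLetter a) = -A.val p a :=
  letterVal_negLetter _ _

lemma val_x {a b : ι × Bool} (p : P) (h : a.1 ≠ b.1) :
    A.val (A.x a b p) a = A.val p a - A.val p b := A.val_x_self a b p h

lemma val_x_of_ne {a b c : ι × Bool} (p : P) (h : a.1 ≠ b.1) (hc : c.1 ≠ a.1) :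
    A.val (A.x a b p) c = A.val p c := by
  simp only [val, letterVal, A.vec_x_of_ne a b p _ h hc]

-- Only the coordinate `a` changes. The additive form avoids truncated subtraction, so that `omega`
-- can settle every later norm comparison from instances of this identity.
variable (A) in
lemma norm_x {a b : ι × Bool} (p : P) (h : a.1 ≠ b.1) :
    A.norm (A.x a b p) + (A.val p a).natAbs = A.norm p + (A.val p a - A.val p b).natAbs := by
  classical
  rw [← val_x p h]
  simp only [val, natAbs_letterVal, norm, vecNorm]
  rw [← Finset.add_sum_erase _ _ (Finset.mem_univ a.1),
    ← Finset.add_sum_erase (Finset.univ) (fun i => (A.vec p i).natAbs) (Finset.mem_univ a.1),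
    Finset.sum_congr rfl fun i hi => by
      rw [A.vec_x_of_ne a b p i h (Finset.ne_of_mem_erase hi)]]
  omega

lemma x_injective {a b : ι × Bool} (h : a.1 ≠ b.1) {p q : P} (hpq : A.x a b p = A.x a b q) :
    p = q := by
  rw [← A.x_neg_x a b p h, hpq, A.x_neg_x a b q h]

variable (A) in
/-- The points that descend to a monomial translate of the base point along norm-decreasing
moves. -/
inductive Descends : P → Prop
  | base (g : P → P) (hg : g ∈ A.W) : Descends (g A.o)
  | step (a b : ι × Bool) (p : P) (h : a.1 ≠ b.1) (hlt : A.norm (A.x a b p) < A.norm p)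
      (hd : Descends (A.x a b p)) : Descends p

/-- Monomial transformations permute the moves by conjugation and preserve the norm, so they carry a
whole descending path to a descending path. -/
lemma Descends.w {p : P} (hp : A.Descends p) {g : P → P} (hg : g ∈ A.W) : A.Descends (g p) := by
  induction hp with
  | base h hh => exact .base _ (A.comp_mem g hg h hh)
  | step a b p h hlt _ ih =>
    obtain ⟨f, hf⟩ := A.conj g hg
    obtain ⟨h1, h2⟩ := hf a b p h
    refine .step (f a) (f b) _ h1 ?_ (h2 ▸ ih)
    rw [h2]
    simpa only [norm, A.norm_w g hg] using hlt

lemma Descends.of_w {p : P} {g : P → P} (hg : g ∈ A.W) (hp : A.Descends (g p)) :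
    A.Descends p := by
  obtain ⟨h, hh, hhg⟩ := A.inv_mem g hg
  exact hhg p ▸ hp.w hh

/-- A norm-decreasing move can be written with positive coordinates. -/
lemma exists_pos_of_norm_lt {a b : ι × Bool} {p : P} (h : a.1 ≠ b.1)
    (hlt : A.norm (A.x a b p) < A.norm p) :
    ∃ a' b' : ι × Bool, a'.1 ≠ b'.1 ∧ A.x a' b' = A.x a b ∧ 0 < A.val p a' ∧ 0 < A.val p b' ∧
      A.val p b' < 2 * A.val p a' := by
  have h1 := A.norm_x p h
  by_cases ha : 0 < A.val p a
  · exact ⟨a, b, h, rfl, ha, by omega, by omega⟩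
  · refine ⟨negLetter a, negLetter b, h, A.x_neg_neg a b, ?_⟩
    rw [val_neg, val_neg]
    omega

/-- A norm-decreasing move needs nonzero coordinates at two different indices, while the vector of a
base point has at most one. -/
lemma not_norm_lt_base {g : P → P} (hg : g ∈ A.W) {a b : ι × Bool} (h : a.1 ≠ b.1) :
    ¬A.norm (A.x a b (g A.o)) < A.norm (g A.o) := by
  intro hlt
  obtain ⟨a', b', h', -, ha, hb, -⟩ := exists_pos_of_norm_lt h hlt
  exact h' (A.base_unit g hg _ _ (fun h0 => ha.ne' (letterVal_eq_zero.mpr h0))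
    (fun h0 => hb.ne' (letterVal_eq_zero.mpr h0)))

/-- Moves with zero increment are trivial. -/
lemma Descends.x_eq_self {p : P} (hp : A.Descends p) {a b : ι × Bool} (h : a.1 ≠ b.1)
    (hb : A.val p b = 0) : A.x a b p = p := by
  induction hp generalizing a b with
  | base g hg => exact A.base_fix g hg a b h (letterVal_eq_zero.mp hb)
  | step c d p hcd hlt _ ih =>
    obtain ⟨c, d, hcd, he, hc, hd, -⟩ := exists_pos_of_norm_lt hcd hlt
    rw [← he] at ih
    have hbc : b.1 ≠ c.1 := fun h0 => by
      rcases eq_or_eq_negLetter h0 with rfl | rfl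
      · omega
      · rw [val_neg] at hb; omega
    have hbd : b.1 ≠ d.1 := fun h0 => by
      rcases eq_or_eq_negLetter h0 with rfl | rfl
      · omega
      · rw [val_neg] at hb; omega
    have key : ∀ e : ι × Bool, e.1 ≠ b.1 → A.x e b (A.x c d p) = A.x c d p := fun e he =>
      ih he (by rw [val_x_of_ne p hcd hbc, hb])
    -- The move `x a b` fails to commute with `x c d` only when `a.1 = d.1`. There `tri` is used
    -- instead: the induction hypothesis makes both `x d b'` and `x c b'` fix `x c d p`, and
    -- cancelling injective moves leaves `x d b' p = p`.
    have key' : ∀ b' : ι × Bool, b'.1 = b.1 → A.x d b' p = p := fun b' hb' => by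
      have key2 : ∀ e : ι × Bool, e.1 ≠ b.1 → A.x e b' (A.x c d p) = A.x c d p := fun e he =>
        ih (hb' ▸ he) (by
          rcases eq_or_eq_negLetter hb' with rfl | rfl
          · rw [val_x_of_ne p hcd hbc, hb]
          · rw [val_neg, val_x_of_ne p hcd hbc, hb, neg_zero])
      have h3 := A.tri c d b' p hcd (hb' ▸ hbc.symm) (hb' ▸ hbd.symm)
      rw [key2 d hbd.symm] at h3
      have hcb' : c.1 ≠ b'.1 := hb' ▸ hbc.symm
      refine x_injective (A := A) hcd (x_injective (A := A) hcb' ?_)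
      rw [h3, key2 c hbc.symm]
    by_cases had : a.1 = d.1
    · rcases eq_or_eq_negLetter had with rfl | rfl
      · exact key' b rfl
      · have := key' (negLetter b) rfl
        rwa [← A.x_neg_neg, negLetter_negLetter] at this
    · refine x_injective (A := A) hcd ?_
      rw [← A.comm a b c d p h hcd had hbc, key a h]

/-- Stability of `Descends` under moves, below a given norm. -/
def StableBelow (A : SteinbergAction ι P) (m : ℕ) : Prop :=
  ∀ p (a b : ι × Bool), a.1 ≠ b.1 → A.Descends p → A.norm p < m → A.norm (A.x a b p) < m →
    A.Descends (A.x a b p)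

/-- A peak at `p` is replaced by the path through the opposite corner of a commuting square; all
points of the new path have norm below that of `p`, so `StableBelow` applies along it. -/
lemma descends_of_comm {m : ℕ} (hm : A.StableBelow m) {a b c d : ι × Bool} {p : P}
    (hp : A.norm p ≤ m) (h : a.1 ≠ b.1) (h' : c.1 ≠ d.1) (had : a.1 ≠ d.1) (hbc : b.1 ≠ c.1)
    (hD : A.Descends (A.x a b p)) (h1 : A.norm (A.x a b p) < A.norm p)
    (h2 : A.norm (A.x c d p) < A.norm p) (h3 : A.norm (A.x c d (A.x a b p)) < A.norm p) :
    A.Descends (A.x c d p) := by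
  have hE := hm _ c d h' hD (by omega) (by omega)
  rw [← A.comm a b c d p h h' had hbc] at hE h3
  have := hm _ a (negLetter b) h hE (by omega) (by rw [A.x_neg_x _ _ _ h]; omega)
  rwa [A.x_neg_x _ _ _ h] at this

/-- The two moves change different coordinates and neither affects the decrement of the other, so
their decrements add up and the opposite corner is automatically low. -/
lemma descends_of_comm_of_ne {m : ℕ} (hm : A.StableBelow m) {a b c d : ι × Bool} {p : P}
    (hp : A.norm p ≤ m) (h : a.1 ≠ b.1) (h' : c.1 ≠ d.1) (had : a.1 ≠ d.1) (hbc : b.1 ≠ c.1)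
    (hac : a.1 ≠ c.1) (hD : A.Descends (A.x a b p)) (h1 : A.norm (A.x a b p) < A.norm p)
    (h2 : A.norm (A.x c d p) < A.norm p) : A.Descends (A.x c d p) := by
  refine descends_of_comm hm hp h h' had hbc hD h1 h2 ?_
  have e1 := A.norm_x p h
  have e2 := A.norm_x p h'
  have e3 := A.norm_x (A.x a b p) h'
  rw [val_x_of_ne p h hac.symm, val_x_of_ne p h had.symm] at e3
  omega

/-- The relation `tri` gives a pentagon on `p`. The inequalities say exactly enough for its four
vertices other than `p` to lie below `p`, so one can walk around it in both directions. -/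
lemma descends_of_tri {m : ℕ} (hm : A.StableBelow m) {a b d : ι × Bool} {p : P}
    (hp : A.norm p ≤ m) (hab : a.1 ≠ b.1) (had : a.1 ≠ d.1) (hbd : b.1 ≠ d.1)
    (ha : 0 < A.val p a) (hd : 0 < A.val p d) (hdb : A.val p d ≤ A.val p b)
    (hba : A.val p b < 2 * A.val p a) :
    A.Descends (A.x b d p) ↔ A.Descends (A.x a b p) := by
  have e1 := A.norm_x p hab
  have e2 := A.norm_x p hbd
  have e3 := A.norm_x (A.x b d p) hab
  have e4 := A.norm_x (A.x a b (A.x b d p)) had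
  rw [val_x_of_ne p hbd hab, val_x p hbd] at e3
  rw [val_x _ hab, val_x_of_ne _ hbd hab, val_x_of_ne _ hab had.symm,
    val_x_of_ne _ hbd hbd.symm, val_x _ hbd] at e4
  have ht := A.tri a b d p hab had hbd
  constructor
  · intro hD
    have h1 := hm _ a b hab hD (by omega) (by omega)
    have h2 := hm _ a d had h1 (by omega) (by omega)
    rw [ht] at h2 e4
    have h3 := hm _ b (negLetter d) hbd h2 (by omega) (by rw [A.x_neg_x _ _ _ hbd]; omega)
    rwa [A.x_neg_x _ _ _ hbd] at h3
  · intro hD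
    have h1 := hm _ b d hbd hD (by omega) (by rw [← ht]; omega)
    rw [← ht] at h1
    have h2 := hm _ a (negLetter d) had h1 (by omega) (by rw [A.x_neg_x _ _ _ had]; omega)
    rw [A.x_neg_x _ _ _ had] at h2
    have h3 := hm _ a (negLetter b) hab h2 (by omega) (by rw [A.x_neg_x _ _ _ hab]; omega)
    rwa [A.x_neg_x _ _ _ hab] at h3

/-- By `rot`, a monomial transformation sends `x b a p` to `x b (negLetter a) (x a b p)`, which is
reached from `x a b p` below the norm of `p`. -/
lemma descends_of_rot {m : ℕ} (hm : A.StableBelow m) {a b : ι × Bool} {p : P}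
    (hp : A.norm p ≤ m) (hab : a.1 ≠ b.1) (ha : 0 < A.val p a) (hb : 0 < A.val p b)
    (h1 : A.val p a < 2 * A.val p b) (h2 : A.val p b < 2 * A.val p a)
    (hD : A.Descends (A.x a b p)) : A.Descends (A.x b a p) := by
  have e1 := A.norm_x p hab
  have e3 := A.norm_x (A.x a b p) (a := b) (b := negLetter a) hab.symm
  rw [val_neg, val_x_of_ne p hab hab.symm, val_x p hab] at e3
  have h3 := hm _ b (negLetter a) hab.symm hD (by omega) (by omega)
  refine Descends.of_w (A.rot b (negLetter a) hab.symm) ?_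
  simp only [A.x_neg_neg, A.x_neg_x _ _ _ hab.symm]
  exact h3

/-- Confluence: if a point descends, then so does every norm-decreasing move of it. -/
lemma Descends.of_norm_lt {m : ℕ} (hm : A.StableBelow m) {p : P} (hp : A.norm p ≤ m)
    (hD : A.Descends p) {c d : ι × Bool} (hcd : c.1 ≠ d.1)
    (hlt : A.norm (A.x c d p) < A.norm p) : A.Descends (A.x c d p) := by
  cases hD with
  | base g hg => exact absurd hlt (not_norm_lt_base hg hcd)
  | step a b _ hab hlt' hD =>
    obtain ⟨c, d, hcd, he, hc, hd, hdc⟩ := exists_pos_of_norm_lt hcd hlt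
    obtain ⟨a, b, hab, he', ha, hb, hba⟩ := exists_pos_of_norm_lt hab hlt'
    rw [← he] at hlt ⊢
    rw [← he'] at hD hlt'
    have red : ∀ {e f : ι × Bool}, e.1 ≠ f.1 → 0 < A.val p e → 0 < A.val p f →
        A.val p f < 2 * A.val p e → A.norm (A.x e f p) < A.norm p := by
      intro e f hef he hf hfe
      have := A.norm_x p hef
      omega
    -- Since all four letters have positive coordinates, distinct letters have distinct indices. The
    -- cases left are the possible coincidences between the letters of the two moves.
    have inj : ∀ {e f : ι × Bool}, 0 < A.val p e → 0 < A.val p f → e ≠ f → e.1 ≠ f.1 :=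
      fun he hf hne h0 => hne (eq_of_letterVal_pos h0 he hf)
    by_cases hac : a = c
    · subst hac
      by_cases hbd : b = d
      · subst hbd; exact hD
      have hbd := inj hb hd hbd
      -- Both moves lower the same coordinate, and their composite stays below `p` precisely under
      -- this inequality. Otherwise an auxiliary move is inserted which subtracts the smaller of the
      -- coordinates at `b` and `d` from the larger; it commutes with one of the moves and forms a
      -- pentagon with the other.
      by_cases hs : A.val p b + A.val p d < 2 * A.val p a
      · refine descends_of_comm hm hp hab hcd hcd hab.symm hD hlt' hlt ?_
        have e1 := A.norm_x p hab
        have e2 := A.norm_x (A.x a b p) hcd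
        rw [val_x p hab, val_x_of_ne p hab hcd.symm] at e2
        omega
      · by_cases hle : A.val p b ≤ A.val p d
        · have h1 : A.Descends (A.x d b p) :=
            descends_of_comm_of_ne hm hp hab hbd.symm hab hbd hcd hD hlt'
              (red hbd.symm hd hb (by omega))
          exact (descends_of_tri hm hp hcd hab hbd.symm ha hb hle hdc).mp h1
        · have h1 : A.Descends (A.x b d p) :=
            (descends_of_tri hm hp hab hcd hbd ha hd (by omega) hba).mpr hD
          exact descends_of_comm_of_ne hm hp hbd hcd hbd hcd.symm hab.symm h1
            (red hbd hb hd (by omega)) hlt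
    have hac := inj ha hc hac
    by_cases hbc : b = c
    · subst hbc
      by_cases had : a = d
      · subst had
        exact descends_of_rot hm hp hab ha hb hdc hba hD
      have had := inj ha hd had
      by_cases hle : A.val p d ≤ A.val p b
      · exact (descends_of_tri hm hp hab had hcd ha hd hle hba).mpr hD
      · have h1 : A.Descends (A.x d b p) :=
          descends_of_comm_of_ne hm hp hab hcd.symm hab hcd had hD hlt'
            (red hcd.symm hd hb (by omega))
        exact descends_of_rot hm hp hcd.symm hd hb hdc (by omega) h1
    have hbc := inj hb hc hbc
    by_cases had : a = d
    · subst had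
      by_cases hle : A.val p b ≤ A.val p a
      · exact (descends_of_tri hm hp hcd hbc.symm hab hc hb hle hdc).mp hD
      · have h1 : A.Descends (A.x b a p) :=
          descends_of_rot hm hp hab ha hb (by omega) hba hD
        exact descends_of_comm_of_ne hm hp hab.symm hcd hab.symm hac hbc h1
          (red hab.symm hb ha (by omega)) hlt
    · exact descends_of_comm_of_ne hm hp hab hcd (inj ha hd had) hbc hac hD hlt' hlt

/-- A decreasing move is handled by confluence, and an increasing move is undone by its inverse. A
move of constant norm is either trivial or replaces a coordinate by its negative. -/
lemma stableBelow (m : ℕ) : A.StableBelow m := by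
  induction m with
  | zero => intro p a b _ _ h; omega
  | succ m ih =>
    intro p a b hab hD h1 h2
    rcases lt_trichotomy (A.norm (A.x a b p)) (A.norm p) with hlt | heq | hgt
    · exact hD.of_norm_lt ih (by omega) hab hlt
    · have e1 := A.norm_x p hab
      by_cases hb : A.val p b = 0
      · rwa [hD.x_eq_self hab hb]
      -- Equal norms force `|v_a - v_b| = |v_a|`, hence `v_b = 2 v_a`. Then `x b a` does decrease
      -- the norm, and the rotation relation transfers the conclusion to `x a b p`.
      obtain ⟨a, b, hab, he, ha, hb⟩ : ∃ a' b' : ι × Bool, a'.1 ≠ b'.1 ∧ A.x a' b' = A.x a b ∧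
          0 < A.val p a' ∧ A.val p b' = 2 * A.val p a' := by
        by_cases ha : 0 < A.val p a
        · exact ⟨a, b, hab, rfl, ha, by omega⟩
        · refine ⟨negLetter a, negLetter b, hab, A.x_neg_neg a b, ?_⟩
          rw [val_neg, val_neg]
          omega
      rw [← he] at heq ⊢
      have e2 := A.norm_x p hab.symm
      have h3 := hD.of_norm_lt ih (by omega) hab.symm (by omega)
      have h4 := h3.w (A.rot b (negLetter a) hab.symm)
      simp only [A.x_neg_neg, A.x_neg_x b a p hab.symm] at h4
      refine .step b (negLetter a) _ hab.symm ?_ h4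
      have e3 := A.norm_x (A.x a b p) (a := b) (b := negLetter a) hab.symm
      rw [val_neg, val_x p hab, val_x_of_ne p hab hab.symm] at e3
      omega
    · refine .step a (negLetter b) _ hab ?_ ?_
      · rwa [A.x_neg_x _ _ _ hab]
      · rwa [A.x_neg_x _ _ _ hab]

lemma Descends.x {p : P} (hD : A.Descends p) {a b : ι × Bool} (h : a.1 ≠ b.1) :
    A.Descends (A.x a b p) :=
  stableBelow (A.norm p + A.norm (A.x a b p) + 1) p a b h hD (by omega) (by omega)

/-- A point that descends is determined by its vector. -/
lemma Descends.eq_of_vec_eq {p q : P} (hp : A.Descends p) (hq : A.Descends q)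
    (h : A.vec p = A.vec q) : p = q := by
  -- Whether a move decreases the norm depends on the vector only, so two points with the same
  -- vector can follow the same descent.
  have hnorm : ∀ {p q : P} {a b : ι × Bool}, a.1 ≠ b.1 → A.vec p = A.vec q →
      A.norm (A.x a b p) < A.norm p → A.norm (A.x a b q) < A.norm q := by
    intro p q a b hab h hlt
    have e1 := A.norm_x p hab
    have e2 := A.norm_x q hab
    simp only [norm, val, h] at *
    omega
  induction hp generalizing q with
  | base g hg =>
    cases hq with
    | base g' hg' => exact A.base_inj g hg g' hg' h
    | step a b _ hab hlt _ => exact absurd (hnorm hab h.symm hlt) (not_norm_lt_base hg hab)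
  | step a b p hab hlt _ ih =>
    refine x_injective hab (ih (hq.x hab) ?_)
    funext i
    by_cases hi : i = a.1
    · subst hi
      have e1 := A.val_x_self a b p hab
      have e2 := A.val_x_self a b q hab
      rw [h, ← e2] at e1
      revert e1
      unfold letterVal
      cases a.2 <;> simp
    · rw [A.vec_x_of_ne a b p i hab hi, A.vec_x_of_ne a b q i hab hi, h]

end SteinbergAction

end Peak

/-! # Elementary automorphisms of free groups -/

section Elementary

variable {ι : Type*}

/-- The element of the free group given by a signed letter. -/
def letter (a : ι × Bool) : FreeGroup ι := FreeGroup.mk [a]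

lemma letter_true (i : ι) : letter (i, true) = FreeGroup.of i := rfl

@[simp] lemma letter_negLetter (a : ι × Bool) : letter (negLetter a) = (letter a)⁻¹ := rfl

lemma letter_false (i : ι) : letter (i, false) = (FreeGroup.of i)⁻¹ := rfl

lemma letter_ne_one (a : ι × Bool) : letter a ≠ 1 := by
  obtain ⟨i, s⟩ := a
  cases s
  · rw [letter_false, inv_ne_one]; exact FreeGroup.of_ne_one i
  · exact FreeGroup.of_ne_one i

/-- Automorphisms of a free group agree if they agree on the generators. -/
lemma mulAut_ext {φ ψ : MulAut (FreeGroup ι)}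
    (h : ∀ i, φ (FreeGroup.of i) = ψ (FreeGroup.of i)) : φ = ψ :=
  MulEquiv.toMonoidHom_injective (FreeGroup.ext_hom _ _ h)

/-- The subgroup of the free group generated by all generators but one. -/
def coGen (i : ι) : Subgroup (FreeGroup ι) := Subgroup.closure (FreeGroup.of '' {k | k ≠ i})

lemma of_mem_coGen {i j : ι} (h : j ≠ i) : FreeGroup.of j ∈ coGen i :=
  Subgroup.subset_closure ⟨j, h, rfl⟩

lemma letter_mem_coGen {i : ι} {a : ι × Bool} (h : a.1 ≠ i) : letter a ∈ coGen i := by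
  obtain ⟨j, s⟩ := a
  cases s
  · exact inv_mem (of_mem_coGen h)
  · exact of_mem_coGen h

variable [DecidableEq ι]

/-- The endomorphism of the free group that sends `a_i` to `y⁻¹ a_i z` and fixes the other
generators. -/
def lrHom (i : ι) (y z : FreeGroup ι) : FreeGroup ι →* FreeGroup ι :=
  FreeGroup.lift fun k => if k = i then y⁻¹ * FreeGroup.of i * z else FreeGroup.of k

lemma lrHom_of_self (i : ι) (y z : FreeGroup ι) :
    lrHom i y z (FreeGroup.of i) = y⁻¹ * FreeGroup.of i * z := by simp [lrHom]

lemma lrHom_of_ne {i k : ι} (y z : FreeGroup ι) (h : k ≠ i) :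
    lrHom i y z (FreeGroup.of k) = FreeGroup.of k := by simp [lrHom, h]

lemma lrHom_of_mem {i : ι} (y z : FreeGroup ι) {w : FreeGroup ι} (hw : w ∈ coGen i) :
    lrHom i y z w = w := by
  induction hw using Subgroup.closure_induction with
  | mem x hx => obtain ⟨k, hk, rfl⟩ := hx; exact lrHom_of_ne y z hk
  | one => simp
  | mul _ _ _ _ h1 h2 => rw [map_mul, h1, h2]
  | inv _ _ h => rw [map_inv, h]

lemma lrHom_comp (i : ι) (y z y' z' : coGen i) :
    (lrHom i (y : FreeGroup ι) z).comp (lrHom i (y' : FreeGroup ι) z') =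
      lrHom i ((y * y' : coGen i) : FreeGroup ι) (z * z' : coGen i) := by
  refine FreeGroup.ext_hom _ _ fun k => ?_
  by_cases hk : k = i
  · subst hk
    simp only [MonoidHom.comp_apply, lrHom_of_self, map_mul, map_inv, lrHom_of_mem _ _ y'.2,
      lrHom_of_mem _ _ z'.2, Subgroup.coe_mul]
    group
  · simp [lrHom_of_ne _ _ hk]

lemma lrHom_one (i : ι) : lrHom i (1 : FreeGroup ι) 1 = MonoidHom.id _ := by
  refine FreeGroup.ext_hom _ _ fun k => ?_
  by_cases hk : k = i
  · subst hk
    simp [lrHom_of_self]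
  · simp [lrHom_of_ne _ _ hk]

/-- The automorphism `a_i ↦ y⁻¹ a_i z`, for `y` and `z` in the subgroup generated by the other
generators. -/
def lr (i : ι) : coGen i × coGen i →* MulAut (FreeGroup ι) where
  toFun p := MonoidHom.toMulEquiv (lrHom i p.1 p.2) (lrHom i (p.1⁻¹ : coGen i) (p.2⁻¹ : coGen i))
    (by rw [lrHom_comp]; simpa using lrHom_one i) (by rw [lrHom_comp]; simpa using lrHom_one i)
  map_one' := MulEquiv.toMonoidHom_injective (lrHom_one i)
  map_mul' p q := MulEquiv.toMonoidHom_injective (lrHom_comp i p.1 p.2 q.1 q.2).symm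

lemma lr_of_self (i : ι) (p : coGen i × coGen i) :
    lr i p (FreeGroup.of i) = (p.1 : FreeGroup ι)⁻¹ * FreeGroup.of i * p.2 := lrHom_of_self _ _ _

lemma lr_of_ne {i k : ι} (p : coGen i × coGen i) (h : k ≠ i) :
    lr i p (FreeGroup.of k) = FreeGroup.of k := lrHom_of_ne _ _ h

lemma lr_of_mem {i : ι} (p : coGen i × coGen i) {w : FreeGroup ι} (hw : w ∈ coGen i) :
    lr i p w = w := lrHom_of_mem _ _ hw

/-- The transvection `a_i ↦ a_i a_j`. -/
def tv (i j : ι) (h : j ≠ i) : MulAut (FreeGroup ι) := lr i (1, ⟨FreeGroup.of j, of_mem_coGen h⟩)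

lemma tv_of_self {i j : ι} (h : j ≠ i) :
    tv i j h (FreeGroup.of i) = FreeGroup.of i * FreeGroup.of j := by
  simp [tv, lr_of_self]

lemma tv_of_ne {i j k : ι} (h : j ≠ i) (hk : k ≠ i) :
    tv i j h (FreeGroup.of k) = FreeGroup.of k := lr_of_ne _ hk

/-- The automorphism that maps a signed letter `a` to `a b`. -/
def letterTv (a b : ι × Bool) (h : b.1 ≠ a.1) : MulAut (FreeGroup ι) :=
  lr a.1 (bif a.2 then (1, ⟨letter b, letter_mem_coGen h⟩) else (⟨letter b, letter_mem_coGen h⟩, 1))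

lemma letterTv_self {a b : ι × Bool} (h : b.1 ≠ a.1) :
    letterTv a b h (letter a) = letter a * letter b := by
  obtain ⟨i, s⟩ := a
  cases s
  · simp [letterTv, letter_false, lr_of_self]
  · simp [letterTv, letter_true, lr_of_self]

lemma letterTv_of_ne {a b : ι × Bool} (h : b.1 ≠ a.1) {k : ι} (hk : k ≠ a.1) :
    letterTv a b h (FreeGroup.of k) = FreeGroup.of k := lr_of_ne _ hk

/-- The automorphisms that permute the generators up to inversion. -/
def IsSigned (φ : MulAut (FreeGroup ι)) : Prop :=
  ∃ (σ : Equiv.Perm ι) (s : ι → Bool), ∀ i, φ (FreeGroup.of i) = letter (σ i, s i)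

end Elementary

/-! ### Signed permutations of the generators -/

section Signed

variable {ι : Type*}

lemma apply_letter {φ : MulAut (FreeGroup ι)} {σ : Equiv.Perm ι} {s : ι → Bool}
    (h : ∀ i, φ (FreeGroup.of i) = letter (σ i, s i)) (a : ι × Bool) :
    φ (letter a) = letter (σ a.1, !xor (s a.1) a.2) := by
  obtain ⟨i, t⟩ := a
  cases t
  · rw [letter_false, map_inv, h, ← letter_negLetter]
    simp [negLetter]
  · rw [letter_true, h]
    simp

lemma isSigned_one : IsSigned (1 : MulAut (FreeGroup ι)) := ⟨1, fun _ => true, fun _ => rfl⟩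

lemma IsSigned.mul {φ ψ : MulAut (FreeGroup ι)} (hφ : IsSigned φ) (hψ : IsSigned ψ) :
    IsSigned (φ * ψ) := by
  obtain ⟨σ, s, h⟩ := hφ
  obtain ⟨τ, t, h'⟩ := hψ
  refine ⟨σ * τ, fun i => !xor (s (τ i)) (t i), fun i => ?_⟩
  rw [MulAut.mul_apply, h', apply_letter h]
  rfl

lemma IsSigned.inv {φ : MulAut (FreeGroup ι)} (hφ : IsSigned φ) : IsSigned φ⁻¹ := by
  obtain ⟨σ, s, h⟩ := hφ
  refine ⟨σ⁻¹, fun i => s (σ⁻¹ i), fun i => ?_⟩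
  rw [MulAut.inv_apply, MulEquiv.symm_apply_eq, apply_letter h, ← letter_true]
  simp

/-- The automorphism given by a permutation of the generators. -/
lemma isSigned_freeGroupCongr (σ : Equiv.Perm ι) :
    IsSigned (FreeGroup.freeGroupCongr σ : MulAut (FreeGroup ι)) :=
  ⟨σ, fun _ => true, fun i => by simp [letter_true]⟩

/-- The endomorphism that inverts some of the generators. -/
def flipHom (s : ι → Bool) : FreeGroup ι →* FreeGroup ι := FreeGroup.lift fun i => letter (i, s i)

lemma flipHom_flipHom (s : ι → Bool) : (flipHom s).comp (flipHom s) = MonoidHom.id _ := by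
  refine FreeGroup.ext_hom _ _ fun i => ?_
  cases h : s i <;> simp [flipHom, h, letter_true, letter_false]

/-- The automorphism that inverts some of the generators. -/
def flip (s : ι → Bool) : MulAut (FreeGroup ι) :=
  MonoidHom.toMulEquiv (flipHom s) (flipHom s) (flipHom_flipHom s) (flipHom_flipHom s)

@[simp] lemma flip_of (s : ι → Bool) (i : ι) : flip s (FreeGroup.of i) = letter (i, s i) :=
  FreeGroup.lift_apply_of (f := fun i => letter (i, s i))

lemma isSigned_flip (s : ι → Bool) : IsSigned (flip s) := ⟨1, s, fun i => flip_of s i⟩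

/-- Every choice of a permutation and of signs gives an automorphism. -/
lemma exists_isSigned (σ : Equiv.Perm ι) (s : ι → Bool) :
    ∃ φ : MulAut (FreeGroup ι), IsSigned φ ∧ ∀ i, φ (FreeGroup.of i) = letter (σ i, s i) := by
  refine ⟨FreeGroup.freeGroupCongr σ * flip s, (isSigned_freeGroupCongr σ).mul (isSigned_flip s),
    fun i => ?_⟩
  rw [MulAut.mul_apply, flip_of]
  cases s i <;> simp [letter_true, letter_false]

end Signed

/-! # Common prefixes of reduced words -/

section CommonPrefix

variable {α : Type*} [DecidableEq α]

/-- The length of the longest common prefix of two lists. -/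
def commonPrefixLength : List α → List α → ℕ
  | a :: l, b :: m => if a = b then commonPrefixLength l m + 1 else 0
  | _, _ => 0

lemma le_commonPrefixLength_iff {l m : List α} {n : ℕ} :
    n ≤ commonPrefixLength l m ↔ n ≤ l.length ∧ n ≤ m.length ∧ l.take n = m.take n := by
  induction l generalizing m n with
  | nil =>
    simp only [commonPrefixLength, List.length_nil, nonpos_iff_eq_zero]
    exact ⟨fun h => by simp [h], fun h => h.1⟩
  | cons a l ih =>
    cases m with
    | nil =>
      simp only [commonPrefixLength, List.length_nil, nonpos_iff_eq_zero]
      exact ⟨fun h => by simp [h], fun h => h.2.1⟩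
    | cons b m =>
      cases n with
      | zero => simp
      | succ n =>
        by_cases h : a = b
        · simp [commonPrefixLength, h, ih]
        · simp [commonPrefixLength, h]

lemma exists_commonPrefix (l m : List α) : ∃ p l' m' : List α, l = p ++ l' ∧ m = p ++ m' ∧
    p.length = commonPrefixLength l m ∧ ∀ a ∈ l'.head?, ∀ b ∈ m'.head?, a ≠ b := by
  induction l generalizing m with
  | nil => exact ⟨[], [], m, rfl, rfl, by simp [commonPrefixLength], by simp⟩
  | cons a l ih =>
    cases m with
    | nil => exact ⟨[], a :: l, [], rfl, rfl, by simp [commonPrefixLength], by simp⟩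
    | cons b m =>
      by_cases h : a = b
      · subst h
        obtain ⟨p, l', m', h1, h2, h3, h4⟩ := ih m
        exact ⟨a :: p, l', m', by simp [h1], by simp [h2], by simp [commonPrefixLength, h3], h4⟩
      · exact ⟨[], a :: l, b :: m, rfl, rfl, by simp [commonPrefixLength, h], by simpa using h⟩

end CommonPrefix

/-! ### Cancellation in products of reduced words -/

section Gromov

variable {ι : Type*} [DecidableEq ι]

/-- The length of the common prefix of the reduced words of two elements of a free group. -/
def gp (x y : FreeGroup ι) : ℕ := commonPrefixLength x.toWord y.toWord

lemma le_gp_iff {x y : FreeGroup ι} {n : ℕ} :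
    n ≤ gp x y ↔ n ≤ x.norm ∧ n ≤ y.norm ∧ x.toWord.take n = y.toWord.take n :=
  le_commonPrefixLength_iff

lemma gp_comm (x y : FreeGroup ι) : gp x y = gp y x :=
  eq_of_forall_le_iff fun n => by rw [le_gp_iff, le_gp_iff]; tauto

/-- Ultrametric inequality: two words that share a prefix with a third one share the shorter of
these prefixes. -/
lemma min_gp_le (x y z : FreeGroup ι) : min (gp x y) (gp y z) ≤ gp x z := by
  have h1 := le_gp_iff.mp (min_le_left (gp x y) (gp y z))
  have h2 := le_gp_iff.mp (min_le_right (gp x y) (gp y z))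
  exact le_gp_iff.mpr ⟨h1.1, h2.2.1, h1.2.2.trans h2.2.2⟩

lemma gp_one_left (x : FreeGroup ι) : gp 1 x = 0 := by
  have := (le_gp_iff (x := 1) (y := x)).mp le_rfl
  simpa using this.1

/-- Exactly the common prefix cancels in `x⁻¹ * y`: after its removal the next letters differ, so
the junction of the remaining words is reduced. -/
lemma norm_inv_mul (x y : FreeGroup ι) :
    (x⁻¹ * y).norm + 2 * gp x y = x.norm + y.norm := by
  obtain ⟨p, l, m, hl, hm, hp, hne⟩ := exists_commonPrefix x.toWord y.toWord
  have hx : x = FreeGroup.mk (p ++ l) := by rw [← hl, FreeGroup.mk_toWord]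
  have hy : y = FreeGroup.mk (p ++ m) := by rw [← hm, FreeGroup.mk_toWord]
  have hrl : FreeGroup.IsReduced l := by
    have := FreeGroup.isReduced_toWord (x := x)
    rw [hl] at this
    exact this.infix ⟨p, [], by simp⟩
  have hrm : FreeGroup.IsReduced m := by
    have := FreeGroup.isReduced_toWord (x := y)
    rw [hm] at this
    exact this.infix ⟨p, [], by simp⟩
  have hrl' : FreeGroup.IsReduced (FreeGroup.invRev l) := by
    rw [FreeGroup.isReduced_iff_reduce_eq, FreeGroup.reduce_invRev,
      FreeGroup.isReduced_iff_reduce_eq.mp hrl]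
  have hr : FreeGroup.IsReduced (FreeGroup.invRev l ++ m) := by
    refine List.isChain_append.mpr ⟨hrl', hrm, ?_⟩
    intro a ha b hb hab
    cases l with
    | nil => simp at ha
    | cons c l =>
      have h1 : a = negLetter c := by
        simpa [FreeGroup.invRev, negLetter, eq_comm] using ha
      have h2 := hne c rfl b hb
      subst h1
      by_contra hs
      refine h2 (Prod.ext hab ?_)
      revert hs
      simp only [negLetter]
      cases c.2 <;> cases b.2 <;> simp
  have hxy : x⁻¹ * y = FreeGroup.mk (FreeGroup.invRev l ++ m) := by
    rw [hx, hy, ← FreeGroup.mul_mk, ← FreeGroup.mul_mk, ← FreeGroup.mul_mk, ← FreeGroup.inv_mk]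
    group
  have h1 : (x⁻¹ * y).norm = l.length + m.length := by
    rw [hxy, FreeGroup.norm, FreeGroup.toWord_mk, FreeGroup.isReduced_iff_reduce_eq.mp hr]
    simp
  have h2 : x.norm = p.length + l.length := by rw [FreeGroup.norm, hl, List.length_append]
  have h3 : y.norm = p.length + m.length := by rw [FreeGroup.norm, hm, List.length_append]
  have h4 : gp x y = p.length := hp.symm
  omega

lemma norm_mul (x y : FreeGroup ι) : (x * y).norm + 2 * gp x⁻¹ y = x.norm + y.norm := by
  simpa using norm_inv_mul x⁻¹ y

/-- The end of `y` that survives in `x * y` is what is not cancelled against `x`. -/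
lemma gp_mul_inv (x y : FreeGroup ι) : gp (x * y)⁻¹ y⁻¹ + gp x⁻¹ y = y.norm := by
  have h1 := norm_mul x y
  have h2 := norm_inv_mul (x * y)⁻¹ y⁻¹
  have h3 : (x * y)⁻¹⁻¹ * y⁻¹ = x := by group
  rw [h3, FreeGroup.norm_inv_eq, FreeGroup.norm_inv_eq] at h2
  omega

lemma toWord_mk_of_norm {l : List (ι × Bool)} (h : l.length ≤ (FreeGroup.mk l).norm) :
    (FreeGroup.mk l).toWord = l := by
  rw [FreeGroup.toWord_mk]
  refine (FreeGroup.reduce.red (L := l)).sublist.eq_of_length_le ?_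
  rwa [FreeGroup.norm, FreeGroup.toWord_mk] at h

/-- The word of an element is its first half followed by the inverse of the first half of its
inverse. -/
lemma toWord_eq_append {y : FreeGroup ι} {h : ℕ} (hy : y.norm = 2 * h) :
    y.toWord = y.toWord.take h ++ FreeGroup.invRev (y⁻¹.toWord.take h) := by
  conv_lhs => rw [← List.take_append_drop h y.toWord]
  congr 1
  have h2 : y.toWord.length = 2 * h := hy
  rw [FreeGroup.toWord_inv, FreeGroup.invRev, FreeGroup.invRev, List.take_reverse,
    List.length_map, h2, show 2 * h - h = h by omega]
  simp [Function.comp_def]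

lemma eq_one_of_halves_eq {y : FreeGroup ι} {h : ℕ} (hy : y.norm = 2 * h)
    (he : y.toWord.take h = y⁻¹.toWord.take h) : y = 1 := by
  rw [← FreeGroup.mk_toWord (x := y), toWord_eq_append hy, ← he, ← FreeGroup.mul_mk,
    ← FreeGroup.inv_mk, mul_inv_cancel]

/-- The square of a nontrivial element is longer than the element. -/
lemma two_mul_gp_inv_self_lt {y : FreeGroup ι} (hy : y ≠ 1) : 2 * gp y⁻¹ y < y.norm := by
  by_contra! hle
  obtain ⟨h, hh | hh⟩ := Nat.even_or_odd' y.norm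
  · obtain ⟨-, -, he⟩ := le_gp_iff.mp (show h ≤ gp y⁻¹ y by omega)
    exact hy (eq_one_of_halves_eq hh he.symm)
  -- In odd length, the middle letter would be equal to its own inverse.
  · obtain ⟨h1, h2, he⟩ := le_gp_iff.mp (show h + 1 ≤ gp y⁻¹ y by omega)
    have hlen : y.toWord.length = 2 * h + 1 := hh
    have hk : (y⁻¹.toWord)[h]? = y.toWord[h]? := by
      have := congrArg (fun l => l[h]?) he
      simpa [List.getElem?_take] using this
    rw [FreeGroup.toWord_inv, FreeGroup.invRev, List.getElem?_reverse (by simp [hlen]; omega),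
      List.getElem?_map, List.length_map, hlen, show 2 * h + 1 - 1 - h = h by omega,
      List.getElem?_eq_getElem (by omega)] at hk
    simp only [Option.map_some, Option.some.injEq] at hk
    have := congrArg Prod.snd hk
    simp at this

end Gromov

/-! # A refined length -/

section HalfRank

variable {ι : Type*} [Fintype ι]

/-- A numerical invariant of words, which distinguishes words of equal length. -/
noncomputable def wordRank (l : List (ι × Bool)) : ℕ :=
  Nat.ofDigits (Fintype.card (ι × Bool) + 2)
    (l.map fun a => (Fintype.equivFin (ι × Bool) a : ℕ))

lemma wordRank_append (l m : List (ι × Bool)) :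
    wordRank (l ++ m) = wordRank l + (Fintype.card (ι × Bool) + 2) ^ l.length * wordRank m := by
  simp [wordRank, Nat.ofDigits_append]

lemma eq_of_wordRank_eq {l m : List (ι × Bool)} (hlen : l.length = m.length)
    (h : wordRank l = wordRank m) : l = m := by
  have hlt : ∀ l : List (ι × Bool), ∀ d ∈ l.map fun a => (Fintype.equivFin (ι × Bool) a : ℕ),
      d < Fintype.card (ι × Bool) + 2 := by
    intro l d hd
    obtain ⟨a, -, rfl⟩ := List.mem_map.mp hd
    exact (Fin.is_lt _).trans (by omega)
  refine List.map_injective_iff.mpr ?_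
    (Nat.ofDigits_inj_of_len_eq (by omega) (by simpa using hlen) (hlt l) (hlt m) h)
  exact Fin.val_injective.comp (Equiv.injective _)

variable [DecidableEq ι]

/-- The sum of the ranks of the initial halves of an element and its inverse. -/
noncomputable def halfRank (x : FreeGroup ι) : ℕ :=
  wordRank (x.toWord.take ((x.norm + 1) / 2)) + wordRank (x⁻¹.toWord.take ((x.norm + 1) / 2))

lemma halfRank_inv (x : FreeGroup ι) : halfRank x⁻¹ = halfRank x := by
  simp only [halfRank, FreeGroup.norm_inv_eq, inv_inv]
  omega

/-- Write `y = p q⁻¹` in halves and `z = q t`. Then `y * z = p t` has the length of `z`, and the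
initial half of its inverse, which lies in `t⁻¹`, is unchanged. Thus comparing `halfRank` amounts to
comparing the ranks of `q` and `p`. This breaks the tie when exactly half of `y` cancels. -/
lemma wordRank_half_le {y z : FreeGroup ι} {h : ℕ} (hy : y.norm = 2 * h)
    (hz : 2 * h ≤ z.norm) (hg : h ≤ gp y⁻¹ z) (hg' : gp y⁻¹ z ≤ h)
    (hle : halfRank z ≤ halfRank (y * z)) :
    wordRank (y⁻¹.toWord.take h) ≤ wordRank (y.toWord.take h) := by
  obtain ⟨hn1, -, hQ⟩ := le_gp_iff.mp hg
  rw [FreeGroup.norm_inv_eq] at hn1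
  set p := y.toWord.take h with hp
  set q := y⁻¹.toWord.take h with hq
  set t := z.toWord.drop h with ht
  have hplen : p.length = h := by
    rw [hp, List.length_take]; exact min_eq_left hn1
  have hqlen : q.length = h := by
    rw [hq, List.length_take]
    exact min_eq_left (by rw [← FreeGroup.norm, FreeGroup.norm_inv_eq]; omega)
  have hzw : z.toWord = q ++ t := by rw [hQ, ht, List.take_append_drop]
  have htlen : t.length = z.norm - h := by rw [ht, List.length_drop, FreeGroup.norm]
  have hnorm : (y * z).norm = z.norm := by
    have := norm_mul y z
    omega
  have hyz : y * z = FreeGroup.mk (p ++ t) := by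
    have hym : y = FreeGroup.mk p * (FreeGroup.mk q)⁻¹ := by
      rw [FreeGroup.inv_mk, FreeGroup.mul_mk, hp, hq, ← toWord_eq_append hy, FreeGroup.mk_toWord]
    have hzm : z = FreeGroup.mk q * FreeGroup.mk t := by
      rw [FreeGroup.mul_mk, ← hzw, FreeGroup.mk_toWord]
    conv_lhs => rw [hym, hzm]
    rw [← FreeGroup.mul_mk]
    group
  have hyzw : (y * z).toWord = p ++ t := by
    rw [hyz]
    refine toWord_mk_of_norm ?_
    rw [← hyz, hnorm, List.length_append]
    omega
  have hk : h ≤ (z.norm + 1) / 2 := by omega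
  have hinv : ∀ r : List (ι × Bool),
      (FreeGroup.invRev (r ++ t)).take ((z.norm + 1) / 2) =
        (FreeGroup.invRev t).take ((z.norm + 1) / 2) := by
    intro r
    rw [FreeGroup.invRev_append, List.take_append_of_le_length]
    rw [FreeGroup.invRev_length]
    omega
  have htake : ∀ r : List (ι × Bool), r.length = h →
      (r ++ t).take ((z.norm + 1) / 2) = r ++ t.take ((z.norm + 1) / 2 - h) := by
    intro r hr
    rw [List.take_append, hr, List.take_of_length_le (by omega)]
  rw [halfRank, halfRank, hnorm, FreeGroup.toWord_inv, FreeGroup.toWord_inv, hzw, hyzw, hinv,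
    hinv, htake _ hplen, htake _ hqlen, wordRank_append, wordRank_append, hplen, hqlen] at hle
  omega

end HalfRank

/-! # Nielsen's theorem: generators of the automorphism group of a free group -/

section ElementarySubgroup

variable {ι : Type*} [DecidableEq ι]

/-- The subgroup generated by the elementary automorphisms. -/
def elementary (ι : Type*) [DecidableEq ι] : Subgroup (MulAut (FreeGroup ι)) :=
  Subgroup.closure ({φ | IsSigned φ} ∪ {φ | ∃ i j, ∃ h : j ≠ i, φ = tv i j h})

lemma IsSigned.mem_elementary {φ : MulAut (FreeGroup ι)} (h : IsSigned φ) : φ ∈ elementary ι :=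
  Subgroup.subset_closure (Or.inl h)

lemma letterTv_mem_elementary {a b : ι × Bool} (h : b.1 ≠ a.1) :
    letterTv a b h ∈ elementary ι := by
  have key : ∀ (i : ι) (b : ι × Bool) (h : b.1 ≠ i), letterTv (i, true) b h ∈ elementary ι := by
    rintro i ⟨j, s⟩ h
    have h1 : tv i j h ∈ elementary ι := Subgroup.subset_closure (Or.inr ⟨i, j, h, rfl⟩)
    cases s
    · convert inv_mem h1 using 1
      rw [tv, ← map_inv, letterTv]
      refine congrArg _ (Prod.ext (by simp) (Subtype.ext rfl))
    · exact h1
  obtain ⟨i, s⟩ := a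
  cases s
  · have hs := isSigned_flip (fun k : ι => !decide (k = i))
    have : letterTv (i, false) b h = flip (fun k : ι => !decide (k = i)) * letterTv (i, true) b h *
        flip (fun k : ι => !decide (k = i)) := by
      have hb : flip (fun k : ι => !decide (k = i)) (letter b) = letter b := by
        obtain ⟨j, t⟩ := b
        have : j ≠ i := h
        cases t <;> simp [letter_true, letter_false, this]
      refine mulAut_ext fun k => ?_
      rw [MulAut.mul_apply, MulAut.mul_apply, flip_of]
      by_cases hk : k = i
      · subst hk
        have e1 := letterTv_self (a := (k, true)) (b := b) h
        have e2 := letterTv_self (a := (k, false)) (b := b) h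
        rw [letter_true] at e1
        rw [letter_false, map_inv, inv_eq_iff_eq_inv] at e2
        rw [e2]
        simp [letter_false, e1, hb]
      · rw [letterTv_of_ne h hk]
        simp [hk, letter_true, letterTv_of_ne (a := (i, true)) h hk]
    rw [this]
    exact mul_mem (mul_mem hs.mem_elementary (key i b h)) hs.mem_elementary
  · exact key i b h

end ElementarySubgroup

section Nielsen

variable {ι : Type*} [DecidableEq ι] [Fintype ι]

/-- A tuple that is minimal for elementary Nielsen moves. -/
def NielsenMinimal (φ : FreeGroup ι →* FreeGroup ι) : Prop :=
  ∀ a b : ι × Bool, b.1 ≠ a.1 →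
    (φ (letter a)).norm ≤ (φ (letter a) * φ (letter b)).norm ∧
    ((φ (letter a)).norm = (φ (letter a) * φ (letter b)).norm →
      halfRank (φ (letter a)) ≤ halfRank (φ (letter a) * φ (letter b)))

variable {φ : FreeGroup ι →* FreeGroup ι}

lemma NielsenMinimal.symm (H : NielsenMinimal φ) {a b : ι × Bool} (h : b.1 ≠ a.1) :
    (φ (letter b)).norm ≤ (φ (letter a) * φ (letter b)).norm ∧
    ((φ (letter b)).norm = (φ (letter a) * φ (letter b)).norm →
      halfRank (φ (letter b)) ≤ halfRank (φ (letter a) * φ (letter b))) := by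
  have := H (negLetter b) (negLetter a) h.symm
  rw [letter_negLetter, letter_negLetter, map_inv, map_inv, ← mul_inv_rev, halfRank_inv,
    halfRank_inv, FreeGroup.norm_inv_eq, FreeGroup.norm_inv_eq] at this
  exact this

/-- For different generators this is minimality of the length; for a letter with itself it is the
growth of squares. -/
lemma NielsenMinimal.two_mul_gp_le (H : NielsenMinimal φ) (hφ : Function.Injective φ)
    {a b : ι × Bool} (h : b ≠ negLetter a) :
    2 * gp (φ (letter a))⁻¹ (φ (letter b)) ≤ (φ (letter a)).norm ∧
    2 * gp (φ (letter a))⁻¹ (φ (letter b)) ≤ (φ (letter b)).norm := by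
  by_cases hab : b.1 = a.1
  · obtain rfl := (eq_or_eq_negLetter hab).resolve_right h
    have := two_mul_gp_inv_self_lt (y := φ (letter b))
      (fun h => letter_ne_one b (hφ (by rw [h, map_one])))
    omega
  · have h1 := (H a b hab).1
    have h2 := (H.symm hab).1
    have h3 := norm_mul (φ (letter a)) (φ (letter b))
    omega

/-- The middle factor can only be swallowed if exactly half of it cancels on each side. Minimality
of `halfRank` on both sides then gives its two halves the same rank, so they coincide and the factor
is trivial, against injectivity. -/
lemma NielsenMinimal.gp_add_gp_lt (H : NielsenMinimal φ) (hφ : Function.Injective φ)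
    {a b c : ι × Bool} (hab : b ≠ negLetter a) (hbc : c ≠ negLetter b) :
    gp (φ (letter a))⁻¹ (φ (letter b)) + gp (φ (letter b))⁻¹ (φ (letter c)) <
      (φ (letter b)).norm := by
  have h1 := H.two_mul_gp_le hφ hab
  have h2 := H.two_mul_gp_le hφ hbc
  have hy : φ (letter b) ≠ 1 := fun h => letter_ne_one b (hφ (by rw [h, map_one]))
  have hsq := two_mul_gp_inv_self_lt hy
  by_contra! hle
  have hac : a.1 ≠ b.1 := fun h0 => by
    obtain rfl : a = b := (eq_or_eq_negLetter h0).resolve_right (fun h => hab (by simp [h]))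
    omega
  have hcb : c.1 ≠ b.1 := fun h0 => by
    obtain rfl : c = b := (eq_or_eq_negLetter h0).resolve_right hbc
    omega
  obtain ⟨h, hh⟩ : ∃ h, (φ (letter b)).norm = 2 * h := ⟨gp (φ (letter b))⁻¹ (φ (letter c)), by omega⟩
  have t1 := wordRank_half_le (y := φ (letter b)) (z := φ (letter c)) hh (by omega) (by omega)
    (by omega) ((H.symm hcb).2 (by have := norm_mul (φ (letter b)) (φ (letter c)); omega))
  have hg : gp (φ (letter b)) (φ (letter a))⁻¹ = h := by rw [gp_comm]; omega
  have t2 := wordRank_half_le (y := (φ (letter b))⁻¹) (z := (φ (letter a))⁻¹) (h := h)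
    (by rwa [FreeGroup.norm_inv_eq]) (by rw [FreeGroup.norm_inv_eq]; omega)
    (by rw [inv_inv, hg]) (by rw [inv_inv, hg]) (by
      rw [← mul_inv_rev, halfRank_inv, halfRank_inv]
      refine (H a b hac.symm).2 ?_
      have := norm_mul (φ (letter a)) (φ (letter b))
      omega)
  rw [inv_inv] at t2
  refine hy (eq_one_of_halves_eq hh (eq_of_wordRank_eq ?_ (le_antisymm t2 t1)))
  have e1 : (φ (letter b)).toWord.length = 2 * h := hh
  have e2 : (φ (letter b))⁻¹.toWord.length = 2 * h := by
    rw [← hh, ← FreeGroup.norm_inv_eq]; rfl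
  rw [List.length_take, List.length_take, e1, e2]

/-- In a product of a Nielsen reduced tuple, every factor contributes to the length. -/
lemma NielsenMinimal.norm_append (H : NielsenMinimal φ) (hφ : Function.Injective φ)
    (l : List (ι × Bool)) (a : ι × Bool) (hl : FreeGroup.IsReduced (l ++ [a])) :
    l.length + (φ (letter a)).norm ≤
      (φ (FreeGroup.mk l) * φ (letter a)).norm + gp (φ (FreeGroup.mk l))⁻¹ (φ (letter a)) ∧
    ∀ b ≠ negLetter a, gp (φ (FreeGroup.mk l))⁻¹ (φ (letter a)) +
      gp (φ (letter a))⁻¹ (φ (letter b)) < (φ (letter a)).norm := by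
  induction l using List.reverseRecOn generalizing a with
  | nil =>
    have h1 : φ (FreeGroup.mk []) = 1 := map_one φ
    rw [h1, inv_one, gp_one_left, one_mul]
    refine ⟨by simp, fun b hb => ?_⟩
    have := H.two_mul_gp_le hφ hb
    have h0 : (φ (letter a)).norm ≠ 0 := fun h => letter_ne_one a (hφ (by
      rw [map_one, ← FreeGroup.norm_eq_zero, h]))
    omega
  | append_singleton l c ih =>
    obtain ⟨ih1, ih2⟩ := ih c (hl.infix ⟨[], [a], by simp⟩)
    have hca : a ≠ negLetter c := by
      have h1 : FreeGroup.IsReduced [c, a] := hl.infix ⟨l, [], by simp⟩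
      have h2 := (FreeGroup.isReduced_cons_cons.mp h1).1
      rintro rfl
      simp at h2
    have hmk : φ (FreeGroup.mk (l ++ [c])) = φ (FreeGroup.mk l) * φ (letter c) := by
      rw [← FreeGroup.mul_mk, map_mul]; rfl
    have e1 := gp_mul_inv (φ (FreeGroup.mk l)) (φ (letter c))
    have e2 := ih2 a hca
    -- The product and its last factor have ends that agree beyond the part that cancels with the
    -- next factor, so by the ultrametric inequality only the last factor matters.
    have e3 : gp (φ (FreeGroup.mk l) * φ (letter c))⁻¹ (φ (letter a)) =
        gp (φ (letter c))⁻¹ (φ (letter a)) := by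
      have m1 := min_gp_le (φ (FreeGroup.mk l) * φ (letter c))⁻¹ (φ (letter c))⁻¹ (φ (letter a))
      have m2 := min_gp_le (φ (letter c))⁻¹ (φ (FreeGroup.mk l) * φ (letter c))⁻¹ (φ (letter a))
      rw [gp_comm (φ (letter c))⁻¹ (φ (FreeGroup.mk l) * φ (letter c))⁻¹] at m2
      omega
    rw [hmk, e3]
    refine ⟨?_, fun b hb => H.gp_add_gp_lt hφ hca hb⟩
    have e4 := norm_mul (φ (FreeGroup.mk l) * φ (letter c)) (φ (letter a))
    rw [e3] at e4
    rw [List.length_append, List.length_singleton]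
    omega

/-- Each letter of `w` leaves at least one uncancelled letter in `φ w`. -/
lemma NielsenMinimal.norm_le (H : NielsenMinimal φ) (hφ : Function.Injective φ)
    (w : FreeGroup ι) : w.norm ≤ (φ w).norm := by
  rcases List.eq_nil_or_concat w.toWord with h | ⟨l, a, h⟩
  · simp [FreeGroup.norm, h]
  · rw [List.concat_eq_append] at h
    have hred := FreeGroup.isReduced_toWord (x := w)
    rw [h] at hred
    obtain ⟨h1, h2⟩ := H.norm_append hφ l a hred
    have h3 := h2 a (fun h => by have := congrArg Prod.snd h; simp at this)
    have hw : φ w = φ (FreeGroup.mk l) * φ (letter a) := by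
      rw [← FreeGroup.mk_toWord (x := w), h, ← FreeGroup.mul_mk, map_mul]; rfl
    rw [hw, FreeGroup.norm, h, List.length_append, List.length_singleton]
    omega

/-- An automorphism that maps generators to signed letters permutes the generators up to
inversion. -/
lemma isSigned_of_forall {φ : MulAut (FreeGroup ι)}
    (h : ∀ i, ∃ a, φ (FreeGroup.of i) = letter a) : IsSigned φ := by
  choose a ha using h
  have hinj : Function.Injective fun i => (a i).1 := by
    intro i j hij
    rcases eq_or_eq_negLetter hij with h | h
    · refine FreeGroup.of_injective (φ.injective ?_)
      rw [ha, ha, h]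
    · have h1 : φ (FreeGroup.of i) = φ (FreeGroup.of j)⁻¹ := by
        rw [map_inv, ha, ha, h, letter_negLetter]
      have h2 := congrArg FreeGroup.toWord (φ.injective h1)
      simp [FreeGroup.toWord_inv, FreeGroup.invRev] at h2
  exact ⟨Equiv.ofBijective _ (Finite.injective_iff_bijective.mp hinj), fun i => (a i).2, ha⟩

/-- **Nielsen's theorem**: the automorphism group of a free group of finite rank is generated by
the elementary automorphisms. -/
theorem elementary_eq_top : elementary ι = ⊤ := by
  refine Subgroup.eq_top_iff' _ |>.mpr fun φ => ?_
  -- Total length first, total `halfRank` second: a minimum over the coset of `elementary ι` is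
  -- Nielsen minimal, because a Nielsen move changes a single term of each sum.
  let μ : MulAut (FreeGroup ι) → ℕ ×ₗ ℕ := fun ψ =>
    toLex (∑ i, (ψ (FreeGroup.of i)).norm, ∑ i, halfRank (ψ (FreeGroup.of i)))
  obtain ⟨_, ⟨α, hα, rfl⟩, hmin⟩ := (wellFounded_lt (α := ℕ ×ₗ ℕ)).has_min
    ((fun α => μ (φ * α)) '' (elementary ι : Set (MulAut (FreeGroup ι)))) ⟨_, 1, one_mem _, rfl⟩
  have hmin' : NielsenMinimal (φ * α : MulAut (FreeGroup ι)).toMonoidHom := by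
    intro a b h
    have h1 := hmin _ ⟨α * letterTv a b h, mul_mem hα (letterTv_mem_elementary h), rfl⟩
    change ¬μ (φ * (α * letterTv a b h)) < μ (φ * α) at h1
    rw [← mul_assoc] at h1
    generalize φ * α = ψ at h1
    change (ψ (letter a)).norm ≤ (ψ (letter a) * ψ (letter b)).norm ∧
      ((ψ (letter a)).norm = (ψ (letter a) * ψ (letter b)).norm →
        halfRank (ψ (letter a)) ≤ halfRank (ψ (letter a) * ψ (letter b)))
    have hof : ∀ θ : MulAut (FreeGroup ι), (θ (FreeGroup.of a.1)).norm = (θ (letter a)).norm ∧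
        halfRank (θ (FreeGroup.of a.1)) = halfRank (θ (letter a)) := by
      intro θ
      obtain ⟨i, s⟩ := a
      cases s
      · rw [letter_false, map_inv, FreeGroup.norm_inv_eq, halfRank_inv]
        exact ⟨rfl, rfl⟩
      · exact ⟨rfl, rfl⟩
    have hs : ∀ (f : FreeGroup ι → ℕ), ∑ i, f ((ψ * letterTv a b h) (FreeGroup.of i)) +
        f (ψ (FreeGroup.of a.1)) = ∑ i, f (ψ (FreeGroup.of i)) +
          f ((ψ * letterTv a b h) (FreeGroup.of a.1)) := by
      intro f
      rw [← Finset.add_sum_erase _ _ (Finset.mem_univ a.1),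
        ← Finset.add_sum_erase Finset.univ (fun i => f (ψ (FreeGroup.of i))) (Finset.mem_univ a.1),
        Finset.sum_congr rfl fun i hi => by
          rw [MulAut.mul_apply, letterTv_of_ne h (Finset.ne_of_mem_erase hi)]]
      omega
    have e1 := hs FreeGroup.norm
    have e2 := hs halfRank
    rw [(hof _).1, (hof _).1, MulAut.mul_apply, letterTv_self, map_mul] at e1
    rw [(hof _).2, (hof _).2, MulAut.mul_apply, letterTv_self, map_mul] at e2
    simp only [μ, Prod.Lex.toLex_lt_toLex, not_or, not_and, not_lt] at h1
    omega
  -- The minimal automorphism does not shorten words; so the preimage of a generator has length one,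
  -- and the inverse automorphism is signed.
  have hsigned : IsSigned (φ * α)⁻¹ := by
    refine isSigned_of_forall fun i => ?_
    have h1 := hmin'.norm_le (φ * α).injective ((φ * α)⁻¹ (FreeGroup.of i))
    have h2 : (φ * α : MulAut (FreeGroup ι)).toMonoidHom ((φ * α)⁻¹ (FreeGroup.of i)) =
        FreeGroup.of i := MulAut.apply_inv_self _ _ _
    rw [h2, FreeGroup.norm_of] at h1
    have h3 : ((φ * α)⁻¹ (FreeGroup.of i)).norm ≠ 0 := by
      rw [Ne, FreeGroup.norm_eq_zero, EmbeddingLike.map_eq_one_iff]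
      exact FreeGroup.of_ne_one i
    obtain ⟨a, ha⟩ := List.length_eq_one_iff.mp (show ((φ * α)⁻¹ (FreeGroup.of i)).norm = 1 by omega)
    exact ⟨a, by rw [letter, ← ha, FreeGroup.mk_toWord]⟩
  have h1 := mul_mem hsigned.inv.mem_elementary (inv_mem hα)
  simpa using h1

end Nielsen

/-! # The action of automorphisms of a free group on its abelianization -/

section ExponentVector

variable {ι : Type*} [DecidableEq ι]

/-- The exponent sums of an element of a free group, as a multiplicative map. -/
def evHom : FreeGroup ι →* Multiplicative (ι → ℤ) :=
  FreeGroup.lift fun i => Multiplicative.ofAdd (Pi.single i 1)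

/-- The vector of exponent sums of an element of a free group. -/
def ev (w : FreeGroup ι) : ι → ℤ := (evHom w).toAdd

@[simp] lemma ev_one : ev (1 : FreeGroup ι) = 0 := by simp [ev]
@[simp] lemma ev_mul (x y : FreeGroup ι) : ev (x * y) = ev x + ev y := by simp [ev]
@[simp] lemma ev_inv (x : FreeGroup ι) : ev x⁻¹ = -ev x := by simp [ev]
@[simp] lemma ev_of (i : ι) : ev (FreeGroup.of i) = Pi.single i 1 := by simp [ev, evHom]

lemma ev_letter (a : ι × Bool) :
    ev (letter a) = Pi.single a.1 (bif a.2 then 1 else -1) := by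
  obtain ⟨i, s⟩ := a
  cases s
  · simp [letter_false, Pi.single_neg]
  · simp [letter_true]

lemma ev_eq_of_abelianization_of_eq {x y : FreeGroup ι}
    (h : Abelianization.of x = Abelianization.of y) : ev x = ev y := by
  have := congrArg (Abelianization.lift (evHom (ι := ι))) h
  rw [Abelianization.lift_apply_of, Abelianization.lift_apply_of] at this
  exact congrArg Multiplicative.toAdd this

lemma ev_eq_iff {x y : FreeGroup ι} : ev x = ev y ↔ Abelianization.of x = Abelianization.of y := by
  refine ⟨fun h => ?_, ev_eq_of_abelianization_of_eq⟩
  -- Passing to finitely supported functions allows the use of the freeness of `FreeAbelianGroup ι`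
  -- without finiteness of `ι`.
  let f : FreeGroup ι →* Multiplicative (ι →₀ ℤ) :=
    FreeGroup.lift fun i => Multiplicative.ofAdd (Finsupp.single i 1)
  have hf : ∀ w, (⇑(f w).toAdd : ι → ℤ) = ev w := by
    intro w
    induction w using FreeGroup.induction_on with
    | C1 => simp
    | of i => simp [f, Finsupp.single_eq_pi_single]
    | inv_of i h => rw [map_inv, toAdd_inv, Finsupp.coe_neg, h, ev_inv]
    | mul x y hx hy => rw [map_mul, toAdd_mul, Finsupp.coe_add, hx, hy, ev_mul]
  have hf' : ∀ w, f w = Multiplicative.ofAdd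
      (FreeAbelianGroup.toFinsupp (Additive.ofMul (Abelianization.of w) : FreeAbelianGroup ι)) := by
    intro w
    have : f = (AddMonoidHom.toMultiplicativeRight
        (FreeAbelianGroup.toFinsupp (X := ι))).comp Abelianization.of := by
      refine FreeGroup.ext_hom _ _ fun i => ?_
      have : FreeAbelianGroup.toFinsupp (FreeAbelianGroup.of i) = Finsupp.single i (1 : ℤ) := by
        simp
      simp only [f, FreeGroup.lift_apply_of, ← this]
      rfl
    rw [this]
    rfl
  have h1 : f x = f y := Multiplicative.toAdd.injective (DFunLike.coe_injective (by rw [hf, hf, h]))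
  rw [hf', hf'] at h1
  exact Additive.ofMul.injective
    ((FreeAbelianGroup.equivFinsupp ι).injective (Multiplicative.ofAdd.injective h1))

lemma mem_IA_freeGroup {φ : MulAut (FreeGroup ι)} :
    φ ∈ FGrp.IA (FreeGroup ι) ↔ ∀ i, ev (φ (FreeGroup.of i)) = ev (FreeGroup.of i) := by
  rw [FGrp.mem_IA_iff]
  constructor
  · exact fun h i => ev_eq_iff.mpr (h _)
  · intro h
    have : (Abelianization.of.comp φ.toMonoidHom) = Abelianization.of :=
      FreeGroup.ext_hom _ _ fun i => ev_eq_iff.mp (h i)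
    exact DFunLike.congr_fun this

variable [Fintype ι]

lemma ev_surjective : Function.Surjective (ev : FreeGroup ι → ι → ℤ) := by
  intro v
  let E : Additive (FreeGroup ι) →+ (ι → ℤ) := MonoidHom.toAdditiveLeft evHom
  have h : v ∈ E.range := by
    rw [pi_eq_sum_univ v]
    have hi : ∀ i : ι, (fun j => if i = j then (1 : ℤ) else 0) ∈ E.range := fun i => by
      refine ⟨Additive.ofMul (FreeGroup.of i), (ev_of i).trans ?_⟩
      ext j
      simp [Pi.single_apply, eq_comm]
    exact sum_mem fun i _ => zsmul_mem (hi i) _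
  obtain ⟨w, hw⟩ := h
  exact ⟨w.toMul, hw⟩

/-- The linear action on exponent vectors of an automorphism of a free group. -/
def rhoFun (φ : MulAut (FreeGroup ι)) : (ι → ℤ) →ₗ[ℤ] (ι → ℤ) :=
  Fintype.linearCombination ℤ fun j => ev (φ (FreeGroup.of j))

lemma rhoFun_ev (φ : MulAut (FreeGroup ι)) (w : FreeGroup ι) : rhoFun φ (ev w) = ev (φ w) := by
  induction w using FreeGroup.induction_on with
  | C1 => simp
  | of i => simp [rhoFun]
  | inv_of i h => rw [ev_inv, map_neg, h, map_inv, ev_inv]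
  | mul x y hx hy => rw [ev_mul, map_add, hx, hy, map_mul, ev_mul]

/-- The linear action on exponent vectors of the automorphism group of a free group. -/
def rho : MulAut (FreeGroup ι) →* Module.End ℤ (ι → ℤ) where
  toFun := rhoFun
  map_one' := by
    refine LinearMap.ext fun v => ?_
    obtain ⟨w, rfl⟩ := ev_surjective v
    simp [rhoFun_ev]
  map_mul' φ ψ := by
    refine LinearMap.ext fun v => ?_
    obtain ⟨w, rfl⟩ := ev_surjective v
    simp [rhoFun_ev]

lemma rho_ev (φ : MulAut (FreeGroup ι)) (w : FreeGroup ι) : rho φ (ev w) = ev (φ w) :=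
  rhoFun_ev φ w

lemma rho_single (φ : MulAut (FreeGroup ι)) (i : ι) :
    rho φ (Pi.single i 1) = ev (φ (FreeGroup.of i)) := by rw [← ev_of, rho_ev]

lemma end_ext {f g : Module.End ℤ (ι → ℤ)} (h : ∀ i, f (Pi.single i 1) = g (Pi.single i 1)) :
    f = g := (Pi.basisFun ℤ ι).ext fun i => by simpa using h i

lemma mem_IA_iff_rho {φ : MulAut (FreeGroup ι)} : φ ∈ FGrp.IA (FreeGroup ι) ↔ rho φ = 1 := by
  rw [mem_IA_freeGroup]
  constructor
  · exact fun h => end_ext fun i => by rw [rho_single, h, ev_of]; rfl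
  · intro h i
    rw [← rho_single, h, ev_of]; rfl

lemma rho_lr {i : ι} (p : coGen i × coGen i) (v : ι → ℤ) :
    rho (lr i p) v = v + v i • (ev (p.2 : FreeGroup ι) - ev (p.1 : FreeGroup ι)) := by
  let g : Module.End ℤ (ι → ℤ) := LinearMap.id +
    (LinearMap.proj i).smulRight (ev (p.2 : FreeGroup ι) - ev (p.1 : FreeGroup ι))
  have : rho (lr i p) = g := by
    refine end_ext fun k => ?_
    rw [rho_single]
    by_cases hk : k = i
    · subst hk
      rw [lr_of_self]
      simp [g]
      abel
    · rw [lr_of_ne _ hk]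
      simp [g, Ne.symm hk]
  rw [this]
  rfl

lemma rho_tv {i j : ι} (h : j ≠ i) (v : ι → ℤ) :
    rho (tv i j h) v = v + v i • Pi.single j 1 := by
  rw [tv, rho_lr]
  simp

lemma rho_tv_inv {i j : ι} (h : j ≠ i) (v : ι → ℤ) :
    rho (tv i j h)⁻¹ v = v - v i • Pi.single j 1 := by
  rw [tv, ← map_inv, rho_lr]
  simp [sub_eq_add_neg]

lemma rho_signed {φ : MulAut (FreeGroup ι)} {σ : Equiv.Perm ι} {s : ι → Bool}
    (h : ∀ i, φ (FreeGroup.of i) = letter (σ i, s i)) (v : ι → ℤ) (i : ι) :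
    rho φ v (σ i) = bif s i then v i else -v i := by
  have : (LinearMap.proj (σ i)).comp (rho φ) =
      (bif s i then (LinearMap.proj i : (ι → ℤ) →ₗ[ℤ] ℤ) else -LinearMap.proj i) := by
    refine (Pi.basisFun ℤ ι).ext fun k => ?_
    rw [Pi.basisFun_apply, LinearMap.comp_apply, rho_single, h, ev_letter]
    by_cases hk : k = i
    · subst hk
      cases s k <;> simp
    · cases s i <;> simp [Ne.symm hk]
  have h2 := LinearMap.congr_fun this v
  rw [LinearMap.comp_apply, LinearMap.proj_apply] at h2
  rw [h2]
  cases s i <;> rfl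

/-- The linear maps that fix the basis vectors indexed by `S`, and have an inverse with this
property, come from automorphisms of the free group. -/
lemma exists_rho_eq_of_fix (n : ℕ) (S : Finset ι) (hn : Sᶜ.card = n)
    (f g : Module.End ℤ (ι → ℤ)) (hfg : f * g = 1) (hgf : g * f = 1)
    (hf : ∀ s ∈ S, f (Pi.single s 1) = Pi.single s 1) : ∃ φ, rho φ = f := by
  induction n generalizing S f g with
  | zero =>
    rw [Finset.card_eq_zero, Finset.compl_eq_empty_iff] at hn
    exact ⟨1, by rw [map_one]; exact end_ext fun i => (hf i (hn ▸ Finset.mem_univ i)).symm⟩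
  | succ n ih =>
    obtain ⟨t, ht⟩ : Sᶜ.Nonempty := by rw [← Finset.card_pos, hn]; omega
    have htS : t ∉ S := Finset.mem_compl.mp ht
    induction hN : vecNorm (f (Pi.single t 1)) using Nat.strong_induction_on generalizing f g with
    | _ N ihN =>
    subst hN
    -- reduction to `rho h * f`
    have key : ∀ h : MulAut (FreeGroup ι), (∃ φ, rho φ = rho h * f) → ∃ φ, rho φ = f := by
      rintro h ⟨φ, hφ⟩
      exact ⟨h⁻¹ * φ, by rw [map_mul, hφ, ← mul_assoc, ← map_mul, inv_mul_cancel, map_one, one_mul]⟩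
    have hinv1 : ∀ h : MulAut (FreeGroup ι), rho h * f * (g * rho h⁻¹) = 1 := fun h => by
      rw [mul_assoc, ← mul_assoc f, hfg, one_mul, ← map_mul, mul_inv_cancel, map_one]
    have hinv2 : ∀ h : MulAut (FreeGroup ι), g * rho h⁻¹ * (rho h * f) = 1 := fun h => by
      rw [mul_assoc, ← mul_assoc (rho h⁻¹), ← map_mul, inv_mul_cancel, map_one, one_mul, hgf]
    set v := f (Pi.single t 1) with hv
    -- Euclid's algorithm on the entries of `f e_t`. The condition `j ∉ S` ensures that subtracting
    -- the `j`-th entry leaves the vectors already fixed untouched.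
    by_cases hred : ∃ i j, i ≠ j ∧ j ∉ S ∧ v i ≠ 0 ∧ v j ≠ 0 ∧ (v j).natAbs ≤ (v i).natAbs
    · obtain ⟨i, j, hij, hj, hi0, hj0, hle⟩ := hred
      have hnorm : ∀ (h : MulAut (FreeGroup ι)) (c : ℤ), rho h v = v + c • Pi.single i 1 →
          (v i + c).natAbs < (v i).natAbs → vecNorm (rho h v) < vecNorm v := by
        intro h c hc hlt
        rw [hc]
        refine Finset.sum_lt_sum (fun k _ => ?_) ⟨i, Finset.mem_univ i, ?_⟩
        · by_cases hk : k = i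
          · subst hk; simpa using hlt.le
          · simp [hk]
        · simpa using hlt
      have hfix : ∀ k ∈ S, (Pi.single k 1 : ι → ℤ) j = 0 := fun k hk => by
        rw [Pi.single_eq_of_ne]; rintro rfl; exact hj hk
      by_cases hs : (v i + v j).natAbs < (v i).natAbs
      · refine key (tv j i hij) (ihN _ ?_ _ _ (hinv1 _) (hinv2 _) (fun s hs => ?_) rfl)
        · exact hnorm _ (v j) (rho_tv hij v) hs
        · rw [Module.End.mul_apply, hf s hs, rho_tv, hfix s hs, zero_smul, add_zero]
      · refine key (tv j i hij)⁻¹ (ihN _ ?_ _ _ (hinv1 _) (hinv2 _) (fun s hs => ?_) rfl)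
        · refine hnorm _ (-v j) ?_ (by omega)
          rw [rho_tv_inv, neg_smul, sub_eq_add_neg]
        · rw [Module.End.mul_apply, hf s hs, rho_tv_inv, hfix s hs, zero_smul, sub_zero]
    · push Not at hred
      -- unimodularity
      have hg : ∀ s ∈ S, g (Pi.single s 1) = Pi.single s 1 := fun s hs => by
        conv_lhs => rw [← hf s hs]
        exact LinearMap.congr_fun hgf _
      -- The `t`-coordinate of `g (f e_t) = e_t`. Indices in `S` contribute nothing, because `g`
      -- fixes those basis vectors. So some entry outside `S` is nonzero, it is the only one as no
      -- reduction is left, and it is a unit; a unit would also reduce any nonzero entry inside `S`.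
      have huni : ∑ i, v i * g (Pi.single i 1) t = 1 := by
        have h1 : g v = Pi.single t 1 := LinearMap.congr_fun hgf _
        have h2 : g v = ∑ i, v i • g (Pi.single i 1) := by
          conv_lhs => rw [← (Pi.basisFun ℤ ι).sum_repr v, map_sum]
          simp only [map_smul, Pi.basisFun_repr, Pi.basisFun_apply]
        have := congrFun (h2.symm.trans h1) t
        simpa using this
      obtain ⟨m, hmS, hm0⟩ : ∃ m, m ∉ S ∧ v m ≠ 0 := by
        by_contra! hall
        rw [Finset.sum_eq_zero fun i _ => ?_] at huni
        · omega
        · by_cases hi : i ∈ S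
          · rw [hg i hi, Pi.single_eq_of_ne, mul_zero]
            rintro rfl; exact htS hi
          · rw [hall i hi, zero_mul]
      have hother : ∀ i, i ∉ S → i ≠ m → v i = 0 := by
        intro i hi him
        by_contra h0
        have h1 := hred i m him hmS h0 hm0
        have h2 := hred m i him.symm hi hm0 h0
        omega
      have hvm : v m = 1 ∨ v m = -1 := by
        rw [Finset.sum_eq_single m (fun i _ him => ?_) (fun h => absurd (Finset.mem_univ m) h)]
          at huni
        · exact Int.isUnit_iff.mp (IsUnit.of_mul_eq_one _ huni)
        · by_cases hi : i ∈ S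
          · rw [hg i hi, Pi.single_eq_of_ne, mul_zero]
            rintro rfl; exact htS hi
          · rw [hother i hi him, zero_mul]
      have hv0 : ∀ i, i ≠ m → v i = 0 := by
        intro i him
        by_contra h0
        have := hred i m him hmS h0 hm0
        omega
      -- A signed transposition brings the remaining entry `±1` at `m` to the value `1` at `t`;
      -- neither `m` nor `t` is in `S`.
      obtain ⟨φ, hφ, hφi⟩ := exists_isSigned (Equiv.swap m t) (fun i => decide (i ≠ m ∨ v m = 1))
      have hfix : ∀ s ∈ insert t S, (rho φ * f) (Pi.single s 1) = Pi.single s 1 := by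
        intro s hs
        rcases Finset.mem_insert.mp hs with rfl | hs
        · rw [Module.End.mul_apply, ← hv]
          funext k
          obtain ⟨i, rfl⟩ := (Equiv.swap m s).surjective k
          rw [rho_signed hφi]
          by_cases hi : i = m
          · subst hi
            rcases hvm with h | h <;> simp [h]
          · rw [hv0 i hi, Pi.single_eq_of_ne]
            · simp
            · rw [Ne, ← Equiv.eq_symm_apply]
              simpa using hi
        · rw [Module.End.mul_apply, hf s hs, rho_single, hφi, ev_letter]
          have h1 : s ≠ m := fun h => hmS (h ▸ hs)
          have h2 : s ≠ t := fun h => htS (h ▸ hs)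
          simp [Equiv.swap_apply_of_ne_of_ne h1 h2, h1]
      refine key φ (ih (insert t S) ?_ _ _ (hinv1 φ) (hinv2 φ) hfix)
      rw [Finset.card_compl, Finset.card_insert_of_notMem htS]
      rw [Finset.card_compl] at hn
      omega

/-- Every automorphism of the abelianization of a free group of finite rank lifts. -/
theorem exists_rho_eq (f : (ι → ℤ) ≃ₗ[ℤ] (ι → ℤ)) :
    ∃ φ : MulAut (FreeGroup ι), ∀ v, rho φ v = f v := by
  obtain ⟨φ, hφ⟩ := exists_rho_eq_of_fix _ ∅ rfl f.toLinearMap f.symm.toLinearMap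
    (LinearMap.ext fun v => f.apply_symm_apply v) (LinearMap.ext fun v => f.symm_apply_apply v)
    (by simp)
  exact ⟨φ, fun v => by rw [hφ]; rfl⟩

end ExponentVector

open scoped commutatorElement

/-! # The subgroup generated by Magnus' automorphisms is normal -/

/-- A subgroup that is normalized by `⟨S⟩` and contains the commutators of elements of `S` contains
the commutator subgroup of `⟨S⟩`. -/
lemma commutator_closure_le {G : Type*} [Group G] {S : Set G} {X : Subgroup G}
    (hX : ∀ h ∈ Subgroup.closure S, ∀ x ∈ X, h * x * h⁻¹ ∈ X)
    (hS : ∀ s ∈ S, ∀ t ∈ S, ⁅s, t⁆ ∈ X) : ⁅Subgroup.closure S, Subgroup.closure S⁆ ≤ X := by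
  have step : ∀ v ∈ Subgroup.closure S, (∀ s ∈ S, ⁅s, v⁆ ∈ X) →
      ∀ u ∈ Subgroup.closure S, ⁅u, v⁆ ∈ X := by
    intro v hv hs u hu
    induction hu using Subgroup.closure_induction with
    | mem x hx => exact hs x hx
    | one => rw [commutatorElement_one_left]; exact one_mem _
    | mul x y hx hy h1 h2 =>
      have : ⁅x * y, v⁆ = x * ⁅y, v⁆ * x⁻¹ * ⁅x, v⁆ := by simp only [commutatorElement_def]; group
      rw [this]
      exact mul_mem (hX x hx _ h2) h1
    | inv x hx h =>
      have : ⁅x⁻¹, v⁆ = x⁻¹ * ⁅x, v⁆⁻¹ * x⁻¹⁻¹ := by simp only [commutatorElement_def]; group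
      rw [this]
      exact hX _ (inv_mem hx) _ (inv_mem h)
  rw [Subgroup.commutator_le]
  intro u hu v hv
  refine step v hv (fun s hs => ?_) u hu
  rw [← commutatorElement_inv]
  exact inv_mem (step s (Subgroup.subset_closure hs)
    (fun t ht => hS t ht s hs) v hv)

instance (G : Type*) [Group G] : (FGrp.IA G).Normal :=
  inferInstanceAs (FGrp.autAb G).ker.Normal

section Magnus

variable {ι : Type*}

/-- A generator as an element of the subgroup generated by the generators other than `a_i`. -/
def gen {i : ι} (j : ι) (h : j ≠ i) : coGen i := ⟨FreeGroup.of j, of_mem_coGen h⟩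

@[simp] lemma coe_gen {i j : ι} (h : j ≠ i) : (gen j h : FreeGroup ι) = FreeGroup.of j := rfl

/-- An endomorphism that maps the generators `a_k`, `k ≠ i`, to `coGen i'`. -/
lemma map_mem_coGen {i i' : ι} {f : FreeGroup ι →* FreeGroup ι}
    (h : ∀ k, k ≠ i → f (FreeGroup.of k) ∈ coGen i') {w : FreeGroup ι} (hw : w ∈ coGen i) :
    f w ∈ coGen i' := by
  have : coGen i ≤ (coGen i').comap f := by
    rw [coGen, Subgroup.closure_le]
    rintro _ ⟨k, hk, rfl⟩
    exact h k hk
  exact this hw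

lemma closure_gen (i : ι) :
    Subgroup.closure {y : coGen i | ∃ j, ∃ hj : j ≠ i, y = gen j hj} = ⊤ := by
  have : {y : coGen i | ∃ j, ∃ hj : j ≠ i, y = gen j hj} =
      (coGen i).subtype ⁻¹' (FreeGroup.of '' {k | k ≠ i}) := by
    ext y
    constructor
    · rintro ⟨j, hj, rfl⟩; exact ⟨j, hj, rfl⟩
    · rintro ⟨j, hj, h⟩; exact ⟨j, hj, Subtype.ext h.symm⟩
  rw [this]
  exact Subgroup.closure_closure_coe_preimage

variable [DecidableEq ι]

lemma tv_eq {i j : ι} (h : j ≠ i) : tv i j h = lr i (1, gen j h) := rfl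

/-- The subgroup of `IA` generated by the automorphisms that change a single generator, and by
commutators. -/
def magnus (ι : Type*) [DecidableEq ι] : Subgroup (MulAut (FreeGroup ι)) :=
  Subgroup.closure {φ | ∃ (i : ι) (p : coGen i × coGen i),
    ev (p.1 : FreeGroup ι) = ev (p.2 : FreeGroup ι) ∧ φ = lr i p} ⊔
    ⁅FGrp.IA (FreeGroup ι), FGrp.IA (FreeGroup ι)⁆

lemma lr_mem_magnus {i : ι} {p : coGen i × coGen i}
    (h : ev (p.1 : FreeGroup ι) = ev (p.2 : FreeGroup ι)) : lr i p ∈ magnus ι :=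
  Subgroup.mem_sup_left (Subgroup.subset_closure ⟨i, p, h, rfl⟩)

lemma lr_mem_IA {i : ι} {p : coGen i × coGen i}
    (h : ev (p.1 : FreeGroup ι) = ev (p.2 : FreeGroup ι)) : lr i p ∈ FGrp.IA (FreeGroup ι) := by
  rw [mem_IA_freeGroup]
  intro k
  by_cases hk : k = i
  · subst hk
    rw [lr_of_self, ev_mul, ev_mul, ev_inv, h]
    abel
  · rw [lr_of_ne _ hk]

lemma magnus_le_IA : magnus ι ≤ FGrp.IA (FreeGroup ι) := by
  refine sup_le ((Subgroup.closure_le _).mpr ?_) (Subgroup.commutator_le_left _ _)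
  rintro _ ⟨i, p, h, rfl⟩
  exact lr_mem_IA h

/-- A subgroup between `[N, N]` and `N` is normalized by `N`. -/
lemma conj_mem_of_commutator_le {G : Type*} [Group G] {D N : Subgroup G} (hD : D ≤ N)
    (h : ⁅N, N⁆ ≤ D) {φ x : G} (hφ : φ ∈ N) (hx : x ∈ D) : φ * x * φ⁻¹ ∈ D := by
  have h1 : ⁅φ, x⁆ ∈ D := h (Subgroup.commutator_mem_commutator hφ (hD hx))
  have h2 : φ * x * φ⁻¹ = ⁅φ, x⁆ * x := by rw [commutatorElement_def]; group
  rw [h2]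
  exact mul_mem h1 hx

lemma conj_mem_magnus {φ x : MulAut (FreeGroup ι)} (hφ : φ ∈ FGrp.IA (FreeGroup ι))
    (hx : x ∈ magnus ι) : φ * x * φ⁻¹ ∈ magnus ι :=
  conj_mem_of_commutator_le magnus_le_IA le_sup_right hφ hx

/-- The retraction that kills a generator. -/
lemma mem_commutator_coGen {i : ι} {c : FreeGroup ι} (hc : c ∈ coGen i) (h : ev c = 0) :
    c ∈ ⁅coGen i, coGen i⁆ := by
  let r : FreeGroup ι →* FreeGroup ι :=
    FreeGroup.lift fun k => if k = i then 1 else FreeGroup.of k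
  have hr : ∀ w ∈ coGen i, r w = w := by
    intro w hw
    induction hw using Subgroup.closure_induction with
    | mem x hx => obtain ⟨k, hk, rfl⟩ := hx; simp [r, show k ≠ i from hk]
    | one => simp
    | mul _ _ _ _ h1 h2 => rw [map_mul, h1, h2]
    | inv _ _ h => rw [map_inv, h]
  have hrange : r.range ≤ coGen i := by
    refine FreeGroup.range_lift_le (s := coGen i) ?_
    rintro _ ⟨k, rfl⟩
    by_cases hk : k = i
    · simp [hk]
    · simp only [hk, if_false]
      exact of_mem_coGen hk
  -- Vanishing exponents only give a product of commutators in the whole group; the retraction `r`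
  -- moves these commutators into `coGen i` and fixes `c`.
  have h1 : c ∈ commutator (FreeGroup ι) := by
    rw [← Abelianization.ker_of (FreeGroup ι), MonoidHom.mem_ker]
    refine Eq.trans ?_ (map_one (Abelianization.of (G := FreeGroup ι)))
    rw [← ev_eq_iff, h, ev_one]
  have h2 := Subgroup.mem_map_of_mem r h1
  rw [hr c hc, commutator_def, Subgroup.map_commutator, ← MonoidHom.range_eq_map] at h2
  exact Subgroup.commutator_mono hrange hrange h2

lemma lr_diag_mem {D : Subgroup (MulAut (FreeGroup ι))} {i : ι}
    (h1 : ∀ j (hj : j ≠ i), lr i (gen j hj, gen j hj) ∈ D) (y : coGen i) : lr i (y, y) ∈ D := by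
  have hy : y ∈ Subgroup.closure {y : coGen i | ∃ j, ∃ hj : j ≠ i, y = gen j hj} :=
    closure_gen i ▸ Subgroup.mem_top y
  induction hy using Subgroup.closure_induction with
  | mem x hx => obtain ⟨j, hj, rfl⟩ := hx; exact h1 j hj
  | one => rw [← Prod.one_eq_mk, map_one]; exact one_mem _
  | mul x y _ _ hx hy => rw [← Prod.mk_mul_mk, map_mul]; exact mul_mem hx hy
  | inv x _ hx => rw [← Prod.inv_mk, map_inv]; exact inv_mem hx

/-- To contain all `IA`-automorphisms that change a single generator, it suffices to contain
Magnus' automorphisms. -/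
lemma lr_mem_of_generators {D : Subgroup (MulAut (FreeGroup ι))} {i : ι}
    (hD : ∀ φ ∈ FGrp.IA (FreeGroup ι), ∀ x ∈ D, φ * x * φ⁻¹ ∈ D)
    (h1 : ∀ j (hj : j ≠ i), lr i (gen j hj, gen j hj) ∈ D)
    (h2 : ∀ j k (hj : j ≠ i) (hk : k ≠ i), j ≠ k →
      lr i (1, ⁅(gen j hj)⁻¹, gen k hk⁆) ∈ D ∨ lr i (1, ⁅(gen k hk)⁻¹, gen j hj⁆) ∈ D)
    (p : coGen i × coGen i) (hp : ev (p.1 : FreeGroup ι) = ev (p.2 : FreeGroup ι)) :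
    lr i p ∈ D := by
  have hdiag : ∀ y : coGen i, lr i (y, y) ∈ D := lr_diag_mem h1
  let S : Set (coGen i) := {y | ∃ j, ∃ hj : j ≠ i, y = gen j hj}
  have hS : Subgroup.closure S = ⊤ := closure_gen i
  let X : Subgroup (coGen i) := D.comap ((lr i).comp (MonoidHom.inr _ _))
  have hXmem : ∀ c, c ∈ X ↔ lr i (1, c) ∈ D := fun c => Iff.rfl
  have hX : ∀ y : coGen i, ∀ x ∈ X, y * x * y⁻¹ ∈ X := by
    intro y x hx
    rw [hXmem] at hx ⊢
    have := hD (lr i (y, y)) (lr_mem_IA rfl) _ hx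
    rw [← map_inv, ← map_mul, ← map_mul] at this
    simpa using this
  have hcomm : ⁅Subgroup.closure S, Subgroup.closure S⁆ ≤ X := by
    refine commutator_closure_le (fun y _ => hX y) ?_
    -- `⁅s, t⁆` is the conjugate by `s` of the inverse of `⁅s⁻¹, t⁆`.
    have key : ∀ s t : coGen i, lr i (1, ⁅s⁻¹, t⁆) ∈ D → ⁅s, t⁆ ∈ X := by
      intro s t h
      have h3 := hX s _ (inv_mem ((hXmem _).mpr h))
      convert h3 using 1
      simp only [commutatorElement_def]
      group
    rintro _ ⟨j, hj, rfl⟩ _ ⟨k, hk, rfl⟩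
    by_cases hjk : j = k
    · subst hjk
      rw [commutatorElement_self]
      exact one_mem _
    · rcases h2 j k hj hk hjk with h | h
      · exact key _ _ h
      · rw [← commutatorElement_inv]
        exact inv_mem (key _ _ h)
  have hc : p.1⁻¹ * p.2 ∈ X := by
    refine hcomm ?_
    have h3 : ((p.1⁻¹ * p.2 : coGen i) : FreeGroup ι) ∈ ⁅coGen i, coGen i⁆ :=
      mem_commutator_coGen (SetLike.coe_mem _) (by simp [hp])
    rw [hS]
    have h4 : (⁅(⊤ : Subgroup (coGen i)), (⊤ : Subgroup (coGen i))⁆).map (coGen i).subtype =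
        ⁅coGen i, coGen i⁆ := by
      rw [Subgroup.map_commutator, ← MonoidHom.range_eq_map, Subgroup.range_subtype]
    rw [← h4] at h3
    obtain ⟨x, hx, hxe⟩ := h3
    exact (Subtype.ext hxe : x = _) ▸ hx
  -- A diagonal part, generated by conjugations, times a right multiplication by an element of the
  -- commutator subgroup of `coGen i`.
  have : p = (p.1, p.1) * (1, p.1⁻¹ * p.2) := by ext <;> simp
  rw [this, map_mul]
  exact mul_mem (hdiag _) ((hXmem _).mp hc)

/-- Conjugation of `lr i` by an automorphism that fixes `a_i` and preserves the span of the other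
generators. -/
lemma conj_lr {i : ι} {g : MulAut (FreeGroup ι)} (hi : g (FreeGroup.of i) = FreeGroup.of i)
    (hg : ∀ k, k ≠ i → g (FreeGroup.of k) ∈ coGen i)
    (hg' : ∀ k, k ≠ i → g⁻¹ (FreeGroup.of k) ∈ coGen i) (p : coGen i × coGen i) :
    g * lr i p * g⁻¹ = lr i (⟨g p.1, map_mem_coGen (f := g.toMonoidHom) hg p.1.2⟩,
      ⟨g p.2, map_mem_coGen (f := g.toMonoidHom) hg p.2.2⟩) := by
  refine mulAut_ext fun k => ?_
  by_cases hk : k = i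
  · subst hk
    have : g⁻¹ (FreeGroup.of k) = FreeGroup.of k := by
      rw [MulAut.inv_apply, MulEquiv.symm_apply_eq, hi]
    rw [MulAut.mul_apply, MulAut.mul_apply, this, lr_of_self, lr_of_self, map_mul, map_mul, map_inv,
      hi]
  · rw [MulAut.mul_apply, MulAut.mul_apply, lr_of_mem _ (hg' k hk), MulAut.apply_inv_self,
      lr_of_ne _ hk]

lemma tv_mem_coGen {p q i : ι} (h : q ≠ p) (hq : q ≠ i) {k : ι} (hk : k ≠ i) :
    tv p q h (FreeGroup.of k) ∈ coGen i := by
  by_cases hkp : k = p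
  · subst hkp
    rw [tv_of_self]
    exact mul_mem (of_mem_coGen hk) (of_mem_coGen hq)
  · rw [tv_of_ne h hkp]
    exact of_mem_coGen hk

lemma tv_inv_of_self {i j : ι} (h : j ≠ i) :
    (tv i j h)⁻¹ (FreeGroup.of i) = FreeGroup.of i * (FreeGroup.of j)⁻¹ := by
  rw [tv_eq, ← map_inv, lr_of_self]
  simp

lemma tv_inv_of_ne {i j k : ι} (h : j ≠ i) (hk : k ≠ i) :
    (tv i j h)⁻¹ (FreeGroup.of k) = FreeGroup.of k := by
  rw [tv_eq, ← map_inv, lr_of_ne _ hk]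

lemma tv_inv_mem_coGen {p q i : ι} (h : q ≠ p) (hq : q ≠ i) {k : ι} (hk : k ≠ i) :
    (tv p q h)⁻¹ (FreeGroup.of k) ∈ coGen i := by
  by_cases hkp : k = p
  · subst hkp
    rw [tv_inv_of_self]
    exact mul_mem (of_mem_coGen hk) (inv_mem (of_mem_coGen hq))
  · rw [tv_inv_of_ne h hkp]
    exact of_mem_coGen hk

/-- Conjugation of `lr i` by a transvection that does not involve `a_i`. -/
lemma tv_conj_lr {p q i : ι} (h : q ≠ p) (hp : p ≠ i) (hq : q ≠ i) (x : coGen i × coGen i) :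
    tv p q h * lr i x * (tv p q h)⁻¹ =
      lr i (⟨tv p q h x.1, map_mem_coGen (f := (tv p q h).toMonoidHom)
        (fun _ => tv_mem_coGen h hq) x.1.2⟩, ⟨tv p q h x.2,
        map_mem_coGen (f := (tv p q h).toMonoidHom) (fun _ => tv_mem_coGen h hq) x.2.2⟩) :=
  conj_lr (tv_of_ne h hp.symm) (fun _ => tv_mem_coGen h hq) (fun _ => tv_inv_mem_coGen h hq) x

lemma tv_inv_conj_lr {p q i : ι} (h : q ≠ p) (hp : p ≠ i) (hq : q ≠ i) (x : coGen i × coGen i) :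
    ∃ x' : coGen i × coGen i, (tv p q h)⁻¹ * lr i x * (tv p q h)⁻¹⁻¹ = lr i x' ∧
      (x'.1 : FreeGroup ι) = (tv p q h)⁻¹ x.1 ∧ (x'.2 : FreeGroup ι) = (tv p q h)⁻¹ x.2 :=
  ⟨_, conj_lr (tv_inv_of_ne h hp.symm) (fun _ => tv_inv_mem_coGen h hq)
    (fun k hk => by rw [inv_inv]; exact tv_mem_coGen h hq hk) x, rfl, rfl⟩

/-- Conjugation of `ν_q(a_j)` by the transvection `a_p ↦ a_p a_q`. -/
lemma tv_conj_nu {p q j : ι} (h : q ≠ p) (hj : j ≠ q) : ∃ x : coGen p × coGen p,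
    ev (x.1 : FreeGroup ι) = ev (x.2 : FreeGroup ι) ∧
    tv p q h * lr q (gen j hj, gen j hj) * (tv p q h)⁻¹ =
      lr p x * lr q (gen j hj, gen j hj) := by
  by_cases hjp : j = p
  · subst hjp
    refine ⟨(gen q h, gen q h), rfl, ?_⟩
    rw [mul_inv_eq_iff_eq_mul]
    refine mulAut_ext fun k => ?_
    simp only [MulAut.mul_apply]
    by_cases hkj : k = j
    · subst hkj
      simp only [lr_of_ne _ hj, tv_of_self, map_mul, lr_of_self, map_inv, lr_of_ne _ h, coe_gen]
      group
    by_cases hkq : k = q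
    · subst hkq
      simp only [lr_of_self, map_mul, map_inv, coe_gen, tv_of_self, tv_of_ne h h, lr_of_ne _ h]
      group
    · simp only [lr_of_ne _ hkq, tv_of_ne h hkj, lr_of_ne _ hkj]
  · refine ⟨(1, gen q h * (gen j hjp)⁻¹ * (gen q h)⁻¹ * gen j hjp), by simp, ?_⟩
    rw [mul_inv_eq_iff_eq_mul]
    refine mulAut_ext fun k => ?_
    simp only [MulAut.mul_apply]
    by_cases hkp : k = p
    · subst hkp
      simp only [lr_of_ne _ h.symm, tv_of_self, map_mul, lr_of_self, map_inv, lr_of_ne _ h, coe_gen,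
        lr_of_ne _ hjp, Subgroup.coe_mul, Subgroup.coe_inv, Subgroup.coe_one]
      group
    by_cases hkq : k = q
    · subst hkq
      simp only [lr_of_self, map_mul, map_inv, coe_gen, tv_of_ne h hjp, tv_of_ne h h,
        lr_of_ne _ h, lr_of_ne _ hjp]
    · simp only [lr_of_ne _ hkq, tv_of_ne h hkp, lr_of_ne _ hkp]

/-- Solving `tv_conj_nu` for the inverse conjugate leaves a correction on the single generator
`a_p`, which conjugation by `tv p q h` keeps of this form. -/
lemma tv_inv_conj_nu_mem {p q j : ι} (h : q ≠ p) (hj : j ≠ q) :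
    (tv p q h)⁻¹ * lr q (gen j hj, gen j hj) * (tv p q h)⁻¹⁻¹ ∈ magnus ι := by
  obtain ⟨x, hx, he⟩ := tv_conj_nu h hj
  have : (tv p q h)⁻¹ * lr q (gen j hj, gen j hj) * (tv p q h)⁻¹⁻¹ =
      ((tv p q h)⁻¹ * lr p x * tv p q h)⁻¹ * lr q (gen j hj, gen j hj) := by
    rw [← mul_inv_eq_iff_eq_mul] at he
    rw [← he]
    group
  rw [this]
  refine mul_mem (inv_mem ?_) (lr_mem_magnus rfl)
  rw [tv_eq, ← map_inv, ← map_mul, ← map_mul]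
  exact lr_mem_magnus (by simp [hx])

/-- Conjugation of `lr i` by an automorphism that permutes the generators up to inversion. -/
lemma IsSigned.conj_lr {g : MulAut (FreeGroup ι)} (hg : IsSigned g) {i : ι}
    {p : coGen i × coGen i} (hp : ev (p.1 : FreeGroup ι) = ev (p.2 : FreeGroup ι)) :
    g * lr i p * g⁻¹ ∈ magnus ι := by
  have hIA : g * lr i p * g⁻¹ ∈ FGrp.IA (FreeGroup ι) :=
    Subgroup.Normal.conj_mem inferInstance _ (lr_mem_IA hp) g
  obtain ⟨σ, s, h⟩ := hg
  have hm : ∀ {w}, w ∈ coGen i → g w ∈ coGen (σ i) := fun hw =>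
    map_mem_coGen (f := g.toMonoidHom) (fun k hk => by
      change g _ ∈ _
      rw [h]
      exact letter_mem_coGen (fun h0 => hk (σ.injective h0))) hw
  have hinv : ∀ k, g⁻¹ (FreeGroup.of (σ k)) = letter (k, s k) := fun k => by
    rw [MulAut.inv_apply, MulEquiv.symm_apply_eq, apply_letter h, ← letter_true]
    cases s k <;> rfl
  have key : ∃ x : coGen (σ i) × coGen (σ i), g * lr i p * g⁻¹ = lr (σ i) x := by
    have hne : ∀ k, k ≠ σ i → (g * lr i p * g⁻¹) (FreeGroup.of k) = FreeGroup.of k := by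
      intro k hk
      obtain ⟨k, rfl⟩ := σ.surjective k
      rw [MulAut.mul_apply, MulAut.mul_apply, hinv,
        lr_of_mem _ (letter_mem_coGen fun h0 => hk (congrArg σ h0)), ← hinv, MulAut.apply_inv_self]
    -- If `g` inverts the generator, the left and right multipliers exchange their roles.
    cases hs : s i
    · refine ⟨(⟨g p.2, hm p.2.2⟩, ⟨g p.1, hm p.1.2⟩), mulAut_ext fun k => ?_⟩
      by_cases hk : k = σ i
      · subst hk
        have e1 : g (FreeGroup.of i) = (FreeGroup.of (σ i))⁻¹ := by rw [h, hs, letter_false]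
        rw [MulAut.mul_apply, MulAut.mul_apply, hinv, lr_of_self, hs, letter_false, map_inv,
          lr_of_self, map_inv, map_mul, map_mul, map_inv, e1]
        group
      · rw [hne k hk, lr_of_ne _ hk]
    · refine ⟨(⟨g p.1, hm p.1.2⟩, ⟨g p.2, hm p.2.2⟩), mulAut_ext fun k => ?_⟩
      by_cases hk : k = σ i
      · subst hk
        have e1 : g (FreeGroup.of i) = FreeGroup.of (σ i) := by rw [h, hs, letter_true]
        rw [MulAut.mul_apply, MulAut.mul_apply, hinv, lr_of_self, hs, letter_true,
          lr_of_self, map_mul, map_mul, map_inv, e1]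
      · rw [hne k hk, lr_of_ne _ hk]
  obtain ⟨x, hx⟩ := key
  -- The equality of exponents is read off from the membership in `IA`, which is normal, instead of
  -- being transported through `g`.
  rw [hx] at hIA ⊢
  refine lr_mem_magnus ?_
  have := mem_IA_freeGroup.mp hIA (σ i)
  rw [lr_of_self, ev_mul, ev_mul, ev_inv] at this
  refine (sub_eq_zero.mp ?_).symm
  have h2 := sub_eq_zero.mpr this
  rw [← h2]
  abel

/-- The automorphisms that conjugate `IA`-automorphisms into `magnus`. -/
lemma lr_conj_mem_of_generators {g : MulAut (FreeGroup ι)} {i : ι}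
    (h1 : ∀ j (hj : j ≠ i), g * lr i (gen j hj, gen j hj) * g⁻¹ ∈ magnus ι)
    (h2 : ∀ j k (hj : j ≠ i) (hk : k ≠ i), j ≠ k →
      g * lr i (1, ⁅(gen j hj)⁻¹, gen k hk⁆) * g⁻¹ ∈ magnus ι ∨
        g * lr i (1, ⁅(gen k hk)⁻¹, gen j hj⁆) * g⁻¹ ∈ magnus ι)
    (p : coGen i × coGen i) (hp : ev (p.1 : FreeGroup ι) = ev (p.2 : FreeGroup ι)) :
    g * lr i p * g⁻¹ ∈ magnus ι := by
  refine lr_mem_of_generators (D := (magnus ι).comap (MulAut.conj g).toMonoidHom) ?_ h1 h2 p hp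
  intro φ hφ x hx
  change g * (φ * x * φ⁻¹) * g⁻¹ ∈ magnus ι
  have := conj_mem_magnus (Subgroup.Normal.conj_mem inferInstance φ hφ g)
    (show g * x * g⁻¹ ∈ magnus ι from hx)
  convert this using 1
  group

lemma ev_map_eq {x y : FreeGroup ι} (h : ev x = ev y) (φ : MulAut (FreeGroup ι)) :
    ev (φ x) = ev (φ y) := by
  rw [ev_eq_iff] at h ⊢
  have := congrArg (Abelianization.map φ.toMonoidHom) h
  rwa [Abelianization.map_of, Abelianization.map_of] at this

/-- Conjugation by `a_p ↦ a_p a_k⁻¹` after conjugation by `a_q ↦ a_q a_k` of `ν_k`. -/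
lemma tv_inv_mul_tv_conj_nu {p q k : ι} (hpq : p ≠ q) (hkq : k ≠ q) (hkp : k ≠ p) (y : coGen k) :
    ((tv p k hkp)⁻¹ * tv q k hkq) * lr k (y, y) * ((tv p k hkp)⁻¹ * tv q k hkq)⁻¹ ∈ magnus ι := by
  refine lr_diag_mem (D := (magnus ι).comap
    (MulAut.conj ((tv p k hkp)⁻¹ * tv q k hkq)).toMonoidHom) (fun j hj => ?_) y
  obtain ⟨x, hx, he⟩ := tv_conj_nu hkq hj
  obtain ⟨x', he', h1, h2⟩ := tv_inv_conj_lr hkp hpq hkq x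
  have hx' : lr q x' ∈ magnus ι := lr_mem_magnus (by rw [h1, h2]; exact ev_map_eq hx _)
  have hn := tv_inv_conj_nu_mem hkp hj
  change (tv p k hkp)⁻¹ * tv q k hkq * lr k (gen j hj, gen j hj) *
    ((tv p k hkp)⁻¹ * tv q k hkq)⁻¹ ∈ magnus ι
  have : (tv p k hkp)⁻¹ * tv q k hkq * lr k (gen j hj, gen j hj) *
      ((tv p k hkp)⁻¹ * tv q k hkq)⁻¹ = ((tv p k hkp)⁻¹ * lr q x * (tv p k hkp)⁻¹⁻¹) *
        ((tv p k hkp)⁻¹ * lr k (gen j hj, gen j hj) * (tv p k hkp)⁻¹⁻¹) := by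
    rw [eq_mul_inv_of_mul_eq he.symm]
    group
  rw [this, he']
  exact mul_mem hx' hn

/-- This presents Magnus' second type of generator as a commutator of a conjugation and a
transvection, whose conjugates can be computed separately. -/
lemma lr_commutator_eq {q j k : ι} (hj : j ≠ q) (hk : k ≠ q) (hjk : j ≠ k) :
    lr q (1, ⁅(gen j hj)⁻¹, gen k hk⁆) = lr k (gen j hjk, gen j hjk) * tv q k hk *
      (lr k (gen j hjk, gen j hjk))⁻¹ * (tv q k hk)⁻¹ := by
  have h1 : lr k (gen j hjk, gen j hjk) * tv q k hk * (lr k (gen j hjk, gen j hjk))⁻¹ =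
      lr q (1, (gen j hj)⁻¹ * gen k hk * gen j hj) := by
    rw [mul_inv_eq_iff_eq_mul]
    refine mulAut_ext fun i => ?_
    simp only [MulAut.mul_apply]
    by_cases hiq : i = q
    · subst hiq
      simp only [tv_of_self, map_mul, lr_of_self, lr_of_ne _ hk.symm, Subgroup.coe_mul,
        Subgroup.coe_inv, Subgroup.coe_one, coe_gen]
      group
    by_cases hik : i = k
    · subst hik
      simp only [tv_of_ne hk hk, lr_of_self, map_mul, map_inv, coe_gen, lr_of_ne _ hj, lr_of_ne _ hk]
    · simp only [tv_of_ne hk hiq, lr_of_ne _ hik, lr_of_ne _ hiq]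
  rw [h1, tv_eq, ← map_inv, ← map_mul, commutatorElement_def, inv_inv]
  simp

/-- Conjugation by `g` preserves `magnus` if it does so on generators. -/
lemma conj_magnus_of_forall {g : MulAut (FreeGroup ι)}
    (h : ∀ (i : ι) (x : coGen i × coGen i), ev (x.1 : FreeGroup ι) = ev (x.2 : FreeGroup ι) →
      g * lr i x * g⁻¹ ∈ magnus ι) {m : MulAut (FreeGroup ι)} (hm : m ∈ magnus ι) :
    g * m * g⁻¹ ∈ magnus ι := by
  have : magnus ι ≤ (magnus ι).comap (MulAut.conj g).toMonoidHom := by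
    conv_lhs => rw [magnus]
    refine sup_le ((Subgroup.closure_le _).mpr ?_) fun x hx => ?_
    · rintro _ ⟨i, x, hx, rfl⟩
      exact h i x hx
    · exact Subgroup.mem_sup_right (Subgroup.Normal.conj_mem inferInstance x hx g)
  exact this hm

variable [Fintype ι]

/-- Conjugating the factorization of `lr_commutator_eq` by `tv p q h` turns the conjugation into `lr
k (y, y)`, and the transvection into an automorphism with the same linear action as `R`. The two
differ by an element of `IA`, which preserves `magnus`, so it is enough to conjugate `lr k (y, y)`
by the explicit `R`. -/
lemma tv_conj_kappa_mem {p q j k : ι} (h : q ≠ p) (hj : j ≠ q) (hk : k ≠ q) (hjk : j ≠ k)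
    (hkp : k ≠ p) : tv p q h * lr q (1, ⁅(gen j hj)⁻¹, gen k hk⁆) * (tv p q h)⁻¹ ∈ magnus ι := by
  have hC := tv_conj_lr h hkp.symm hk.symm (gen j hjk, gen j hjk)
  set y : coGen k := ⟨tv p q h (gen j hjk : FreeGroup ι), map_mem_coGen
    (f := (tv p q h).toMonoidHom) (fun _ => tv_mem_coGen h hk.symm) (gen j hjk).2⟩ with hy
  change _ = lr k (y, y) at hC
  set R := (tv p k hkp)⁻¹ * tv q k hk with hR
  have hφ : tv p q h * tv q k hk * (tv p q h)⁻¹ * R⁻¹ ∈ FGrp.IA (FreeGroup ι) := by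
    rw [mem_IA_iff_rho]
    have h1 : rho (tv p q h * tv q k hk) = rho (R * tv p q h) := by
      refine LinearMap.ext fun v => ?_
      simp only [hR, map_mul, Module.End.mul_apply, rho_tv, rho_tv_inv]
      funext i
      simp [Pi.single_apply, h.symm, hkp.symm]
      split_ifs <;> ring
    calc rho (tv p q h * tv q k hk * (tv p q h)⁻¹ * R⁻¹)
        = rho (R * tv p q h) * rho ((tv p q h)⁻¹ * R⁻¹) := by
          rw [← h1, ← map_mul]; congr 1
      _ = 1 := by
          rw [← map_mul, show R * tv p q h * ((tv p q h)⁻¹ * R⁻¹) = 1 by group, map_one]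
  have hnu := conj_mem_magnus hφ (tv_inv_mul_tv_conj_nu h.symm hk hkp y)
  have hfin : tv p q h * lr q (1, ⁅(gen j hj)⁻¹, gen k hk⁆) * (tv p q h)⁻¹ =
      lr k (y, y) * ((tv p q h * tv q k hk * (tv p q h)⁻¹ * R⁻¹) * (R * lr k (y, y) * R⁻¹) *
        (tv p q h * tv q k hk * (tv p q h)⁻¹ * R⁻¹)⁻¹)⁻¹ := by
    rw [lr_commutator_eq hj hk hjk, ← hC]
    group
  rw [hfin]
  exact mul_mem (lr_mem_magnus rfl) (inv_mem hnu)

lemma tv_conj_lr_mem {p q i : ι} (h : q ≠ p) {x : coGen i × coGen i}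
    (hx : ev (x.1 : FreeGroup ι) = ev (x.2 : FreeGroup ι)) :
    tv p q h * lr i x * (tv p q h)⁻¹ ∈ magnus ι := by
  by_cases hp : p = i
  · subst hp
    rw [tv_eq, ← map_inv, ← map_mul, ← map_mul]
    exact lr_mem_magnus (by simp [hx])
  by_cases hq : q = i
  · subst hq
    refine lr_conj_mem_of_generators (fun j hj => ?_) (fun j k hj hk hjk => ?_) x hx
    · obtain ⟨x, hx, he⟩ := tv_conj_nu h hj
      rw [he]
      exact mul_mem (lr_mem_magnus hx) (lr_mem_magnus rfl)
    -- At most one of `j ≠ k` equals `p`; the freedom to swap them lets the index that must avoid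
    -- `p` do so.
    · by_cases hkp : k = p
      · exact Or.inr (tv_conj_kappa_mem h hk hj hjk.symm (hkp ▸ hjk))
      · exact Or.inl (tv_conj_kappa_mem h hj hk hjk hkp)
  · rw [tv_conj_lr h hp hq]
    exact lr_mem_magnus (ev_map_eq hx _)

lemma conj_mem_magnus_of_mem {m : MulAut (FreeGroup ι)} (hm : m ∈ magnus ι)
    (g : MulAut (FreeGroup ι)) : g * m * g⁻¹ ∈ magnus ι := by
  have hsigned : ∀ s : MulAut (FreeGroup ι), IsSigned s → ∀ m ∈ magnus ι,
      s * m * s⁻¹ ∈ magnus ι := fun s hs m hm =>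
    conj_magnus_of_forall (fun i x hx => hs.conj_lr hx) hm
  have htv : ∀ i j (h : j ≠ i), ∀ m ∈ magnus ι, tv i j h * m * (tv i j h)⁻¹ ∈ magnus ι :=
    fun i j h m hm => conj_magnus_of_forall (fun i x hx => tv_conj_lr_mem h hx) hm
  have hg : g ∈ elementary ι := elementary_eq_top (ι := ι) ▸ Subgroup.mem_top g
  induction hg using Subgroup.closure_induction'' generalizing m with
  | mem x hx =>
    rcases hx with hx | ⟨i, j, h, rfl⟩
    · exact hsigned x hx m hm
    · exact htv i j h m hm
  | inv_mem x hx =>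
    rcases hx with hx | ⟨i, j, h, rfl⟩
    · exact hsigned _ hx.inv m hm
    -- The inverse transvection is the conjugate of the transvection by the inversion `s` of `a_j`,
    -- so it is covered by the two cases already proved.
    · set s : MulAut (FreeGroup ι) := flip fun k => !decide (k = j) with hs
      have e : (tv i j h)⁻¹ = s * tv i j h * s := by
        refine mulAut_ext fun k => ?_
        simp only [MulAut.mul_apply, hs, flip_of]
        by_cases hki : k = i
        · subst hki
          rw [tv_inv_of_self]
          simp [tv_of_self, h.symm, letter_true, letter_false]
        by_cases hkj : k = j
        · subst hkj
          simp [tv_inv_of_ne h hki, tv_of_ne h hki, letter_false]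
        · simp [tv_inv_of_ne h hki, tv_of_ne h hki, letter_true, hkj]
      have hsg : IsSigned s := isSigned_flip _
      have h3 := hsigned s hsg _ (htv i j h _ (hsigned s hsg m hm))
      convert h3 using 1
      calc (tv i j h)⁻¹ * m * (tv i j h)⁻¹⁻¹ = s * tv i j h * s * m * (s * tv i j h * s)⁻¹ := by
            rw [← e]
        _ = _ := by group
  | one => simpa using hm
  | mul x y _ _ hx hy =>
    have := hx (hy hm)
    convert this using 1
    group

instance : (magnus ι).Normal := ⟨fun _ hm g => conj_mem_magnus_of_mem hm g⟩

end Magnus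

/-! # The inclusion of the free group on a subset of the generators -/

section Inclusion

variable {ι : Type}

/-- The inclusion of the subgroup generated by some of the generators. -/
def inclFree (S : Set ι) : FreeGroup S →* FreeGroup ι := FreeGroup.map Subtype.val

lemma inclFree_of (S : Set ι) (k : S) :
    inclFree S (FreeGroup.of k) = FreeGroup.of (k : ι) := FreeGroup.map.of

lemma inclFree_letter (S : Set ι) (a : S × Bool) :
    inclFree S (letter a) = letter ((a.1 : ι), a.2) := rfl

lemma inclFree_mem_coGen {S : Set ι} {i : S} {w : FreeGroup S} (hw : w ∈ coGen i) :
    inclFree S w ∈ coGen (i : ι) := by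
  have : coGen i ≤ (coGen (i : ι)).comap (inclFree S) := by
    rw [coGen, Subgroup.closure_le]
    rintro _ ⟨k, hk, rfl⟩
    change inclFree S (FreeGroup.of k) ∈ coGen (i : ι)
    rw [inclFree_of]
    exact of_mem_coGen fun h => hk (Subtype.ext h)
  exact this hw

section

variable [DecidableEq ι]

lemma ev_inclFree_eq {S : Set ι} {x y : FreeGroup S} (h : ev x = ev y) :
    ev (inclFree S x) = ev (inclFree S y) := by
  rw [ev_eq_iff] at h ⊢
  have := congrArg (Abelianization.map (inclFree S)) h
  rwa [Abelianization.map_of, Abelianization.map_of] at this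

lemma ev_inclFree_apply {S : Set ι} (w : FreeGroup S) (k : S) : ev (inclFree S w) k = ev w k := by
  induction w using FreeGroup.induction_on with
  | C1 => simp
  | of i => simp [inclFree_of, Pi.single_apply, Subtype.ext_iff]
  | inv_of i h => simp only [map_inv, ev_inv, Pi.neg_apply, h]
  | mul x y hx hy => simp only [map_mul, ev_mul, Pi.add_apply, hx, hy]

end

variable [Finite ι]

/-- The free group on a finite type, as an object of `𝒢`. -/
def freeFGrp (ι : Type) [Finite ι] : FGrp := ⟨FreeGroup ι⟩

open Classical in
/-- The inclusion of the free group on a set of generators, as a morphism of `𝒢`. -/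
noncomputable def inclHom (S : Set ι) : FGrp.Hom (freeFGrp S) (freeFGrp ι) where
  u := (FreeGroup.map Subtype.val : FreeGroup S →* FreeGroup ι)
  K := (Subgroup.closure (FreeGroup.of '' Sᶜ) : Subgroup (FreeGroup ι))
  bij := by
    let K : Subgroup (FreeGroup ι) := Subgroup.closure (FreeGroup.of '' Sᶜ)
    let j : FreeGroup ι →* Monoid.Coprod K (FreeGroup S) := FreeGroup.lift fun k =>
      if h : k ∈ S then Monoid.Coprod.inr (FreeGroup.of ⟨k, h⟩)
      else Monoid.Coprod.inl ⟨FreeGroup.of k, Subgroup.subset_closure ⟨k, h, rfl⟩⟩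
    let L : Monoid.Coprod K (FreeGroup S) →* FreeGroup ι :=
      Monoid.Coprod.lift K.subtype (FreeGroup.map Subtype.val)
    change Function.Bijective L
    have h1 : j.comp L = MonoidHom.id _ := by
      refine Monoid.Coprod.hom_ext (MonoidHom.ext ?_) (FreeGroup.ext_hom _ _ fun k => ?_)
      · rintro ⟨k, hk⟩
        change j k = Monoid.Coprod.inl ⟨k, hk⟩
        induction hk using Subgroup.closure_induction with
        | mem x hx =>
          obtain ⟨k, hk, rfl⟩ := hx
          simp [j, show k ∉ S from hk]
        | one => rw [map_one]; exact (map_one (Monoid.Coprod.inl (M := K))).symm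
        | mul x y hx hy h1 h2 => rw [map_mul, h1, h2, ← map_mul]; rfl
        | inv x hx h => rw [map_inv, h, ← map_inv]; rfl
      · simp [L, j]
    have h2 : L.comp j = MonoidHom.id _ := by
      refine FreeGroup.ext_hom _ _ fun k => ?_
      by_cases h : k ∈ S
      · simp [L, j, h]
      · simp [L, j, h]
    exact ⟨Function.LeftInverse.injective (g := j) fun x => DFunLike.congr_fun h1 x,
      Function.RightInverse.surjective (g := j) fun x => DFunLike.congr_fun h2 x⟩

/-- Extension of automorphisms by the identity on the other generators. -/
noncomputable def extAut (S : Set ι) : MulAut (FreeGroup S) →* MulAut (FreeGroup ι) :=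
  (inclHom S).autMap

lemma extAut_inclFree (S : Set ι) (ψ : MulAut (FreeGroup S)) (w : FreeGroup S) :
    extAut S ψ (inclFree S w) = inclFree S (ψ w) := (inclHom S).autMap_u ψ w

lemma extAut_of_mem {S : Set ι} (ψ : MulAut (FreeGroup S)) (k : S) :
    extAut S ψ (FreeGroup.of (k : ι)) = inclFree S (ψ (FreeGroup.of k)) := by
  rw [← inclFree_of, extAut_inclFree]

lemma extAut_of_notMem {S : Set ι} (ψ : MulAut (FreeGroup S)) {k : ι} (h : k ∉ S) :
    extAut S ψ (FreeGroup.of k) = FreeGroup.of k :=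
  (inclHom S).autMap_of_mem ψ (Subgroup.subset_closure ⟨k, h, rfl⟩)

lemma extAut_eq_iff {S : Set ι} {ψ : MulAut (FreeGroup S)} {φ : MulAut (FreeGroup ι)} :
    extAut S ψ = φ ↔ (∀ k : S, φ (FreeGroup.of (k : ι)) = inclFree S (ψ (FreeGroup.of k))) ∧
      ∀ k, k ∉ S → φ (FreeGroup.of k) = FreeGroup.of k := by
  constructor
  · rintro rfl
    exact ⟨extAut_of_mem ψ, fun k hk => extAut_of_notMem ψ hk⟩
  · rintro ⟨h1, h2⟩
    refine mulAut_ext fun k => ?_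
    by_cases hk : k ∈ S
    · rw [h1 ⟨k, hk⟩, extAut_of_mem ψ ⟨k, hk⟩]
    · rw [h2 k hk, extAut_of_notMem ψ hk]

lemma extAut_mem_IA {S : Set ι} {ψ : MulAut (FreeGroup S)} (h : ψ ∈ FGrp.IA (FreeGroup S)) :
    extAut S ψ ∈ FGrp.IA (FreeGroup ι) := (inclHom S).autMap_mem_IA h

variable [DecidableEq ι]

lemma extAut_lr {S : Set ι} (i : S) (p : coGen i × coGen i) :
    extAut S (lr i p) = lr (i : ι) (⟨inclFree S p.1, inclFree_mem_coGen p.1.2⟩,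
      ⟨inclFree S p.2, inclFree_mem_coGen p.2.2⟩) := by
  refine extAut_eq_iff.mpr ⟨fun k => ?_, fun k hk => lr_of_ne _ fun h => hk (h ▸ i.2)⟩
  by_cases hk : k = i
  · subst hk
    rw [lr_of_self, lr_of_self, map_mul, map_mul, map_inv, inclFree_of]
  · rw [lr_of_ne _ hk, lr_of_ne _ (fun h => hk (Subtype.ext h)), inclFree_of]

lemma extAut_mem_magnus {S : Set ι} {ψ : MulAut (FreeGroup S)} (h : ψ ∈ magnus S) :
    extAut S ψ ∈ magnus ι := by
  have : magnus S ≤ (magnus ι).comap (extAut S) := by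
    conv_lhs => rw [magnus]
    refine sup_le ((Subgroup.closure_le _).mpr ?_) ?_
    · rintro _ ⟨i, p, hp, rfl⟩
      change extAut S _ ∈ magnus ι
      rw [extAut_lr]
      exact lr_mem_magnus (ev_inclFree_eq hp)
    · rw [← Subgroup.map_le_iff_le_comap, Subgroup.map_commutator]
      refine le_trans (Subgroup.commutator_mono ?_ ?_) le_sup_right <;>
      · rintro _ ⟨ψ, hψ, rfl⟩
        exact extAut_mem_IA hψ
  exact this h

lemma isSigned_extAut {S : Set ι} {ψ : MulAut (FreeGroup S)} (h : IsSigned ψ) :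
    IsSigned (extAut S ψ) := by
  obtain ⟨σ, s, h⟩ := h
  have := Fintype.ofFinite ι
  refine isSigned_of_forall (ι := ι) fun i => ?_
  by_cases hi : i ∈ S
  · exact ⟨_, (extAut_of_mem ψ ⟨i, hi⟩).trans ((congrArg _ (h _)).trans (inclFree_letter S _))⟩
  · exact ⟨(i, true), extAut_of_notMem ψ hi⟩

end Inclusion

/-! # Transvections modulo the subgroup `magnus` -/

section Transvection

variable {ι : Type*}

lemma mulAut_ext_letter {φ ψ : MulAut (FreeGroup ι)} (a : ι × Bool)
    (h : φ (letter a) = ψ (letter a))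
    (h' : ∀ k, k ≠ a.1 → φ (FreeGroup.of k) = ψ (FreeGroup.of k)) : φ = ψ := by
  refine mulAut_ext fun k => ?_
  by_cases hk : k = a.1
  · subst hk
    obtain ⟨i, s⟩ := a
    cases s
    · simpa [letter_false] using h
    · exact h
  · exact h' k hk

lemma mulAut_ext_letters {φ ψ : MulAut (FreeGroup ι)} (a b : ι × Bool)
    (ha : φ (letter a) = ψ (letter a)) (hb : φ (letter b) = ψ (letter b))
    (h' : ∀ k, k ≠ a.1 → k ≠ b.1 → φ (FreeGroup.of k) = ψ (FreeGroup.of k)) : φ = ψ := by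
  refine mulAut_ext_letter a ha fun k hk => ?_
  by_cases hkb : k = b.1
  · subst hkb
    obtain ⟨i, s⟩ := b
    cases s
    · simpa [letter_false] using hb
    · exact hb
  · exact h' k hk hkb

/-- The action of a signed permutation on signed letters. -/
def signedLetter (σ : Equiv.Perm ι) (s : ι → Bool) (a : ι × Bool) : ι × Bool :=
  (σ a.1, !xor (s a.1) a.2)

lemma signedLetter_negLetter (σ : Equiv.Perm ι) (s : ι → Bool) (a : ι × Bool) :
    signedLetter σ s (negLetter a) = negLetter (signedLetter σ s a) := by
  simp [signedLetter, negLetter]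

variable [DecidableEq ι]

lemma letterTv_letter_of_ne {a b c : ι × Bool} (h : b.1 ≠ a.1) (hc : c.1 ≠ a.1) :
    letterTv a b h (letter c) = letter c := lr_of_mem _ (letter_mem_coGen hc)

lemma signed_conj_letterTv {g : MulAut (FreeGroup ι)} {σ : Equiv.Perm ι} {s : ι → Bool}
    (hg : ∀ i, g (FreeGroup.of i) = letter (σ i, s i)) {a b : ι × Bool} (h : b.1 ≠ a.1) :
    g * letterTv a b h = letterTv (signedLetter σ s a) (signedLetter σ s b)
      (fun h0 => h (σ.injective h0)) * g := by
  refine mulAut_ext_letter a ?_ fun k hk => ?_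
  · rw [MulAut.mul_apply, MulAut.mul_apply, letterTv_self, map_mul, apply_letter hg,
      apply_letter hg]
    exact (letterTv_self (a := signedLetter σ s a) (b := signedLetter σ s b) _).symm
  · rw [MulAut.mul_apply, MulAut.mul_apply, letterTv_of_ne _ hk, hg]
    exact (letterTv_letter_of_ne _ fun h0 => hk (σ.injective h0)).symm

/-- The transvection over `v_a ↦ v_a - v_b`; it maps the letter `b` to `b a⁻¹`. -/
def mv (a b : ι × Bool) : MulAut (FreeGroup ι) :=
  if h : (negLetter a).1 ≠ b.1 then letterTv b (negLetter a) h else 1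

lemma mv_eq {a b : ι × Bool} (h : (negLetter a).1 ≠ b.1) :
    mv a b = letterTv b (negLetter a) h := dif_pos h

lemma mv_self {a b : ι × Bool} (h : a.1 ≠ b.1) : mv a b (letter b) = letter b * (letter a)⁻¹ := by
  have h' : (negLetter a).1 ≠ b.1 := h
  rw [mv_eq h', letterTv_self, letter_negLetter]

lemma mv_letter_of_ne {a b c : ι × Bool} (h : c.1 ≠ b.1) : mv a b (letter c) = letter c := by
  by_cases hab : a.1 = b.1
  · simp [mv, hab]
  · have h' : (negLetter a).1 ≠ b.1 := hab
    rw [mv_eq h', letterTv_letter_of_ne _ h]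

lemma mv_of_ne {a b : ι × Bool} {k : ι} (h : k ≠ b.1) :
    mv a b (FreeGroup.of k) = FreeGroup.of k := mv_letter_of_ne (c := (k, true)) h

lemma signed_mul_mv {g : MulAut (FreeGroup ι)} {σ : Equiv.Perm ι} {s : ι → Bool}
    (hg : ∀ i, g (FreeGroup.of i) = letter (σ i, s i)) (a b : ι × Bool) :
    g * mv a b = mv (signedLetter σ s a) (signedLetter σ s b) * g := by
  by_cases h : a.1 = b.1
  · simp [mv, h, signedLetter]
  · have h1 : (negLetter a).1 ≠ b.1 := h
    have h2 : (negLetter (signedLetter σ s a)).1 ≠ (signedLetter σ s b).1 :=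
      fun h0 => h (σ.injective h0)
    rw [mv_eq h1, mv_eq h2, signed_conj_letterTv hg]
    simp only [signedLetter_negLetter]

lemma mv_eq_tv {i j : ι} (h : j ≠ i) : mv (j, false) (i, true) = tv i j h := by
  rw [mv_eq (a := (j, false)) (b := (i, true)) h]
  rfl

lemma mv_eq_tv_inv {i j : ι} (h : j ≠ i) : mv (j, true) (i, true) = (tv i j h)⁻¹ := by
  refine mulAut_ext fun k => ?_
  by_cases hk : k = i
  · subst hk
    rw [tv_inv_of_self, ← letter_true, mv_self h]
    rfl
  · rw [tv_inv_of_ne h hk, mv_of_ne hk]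

/-- The exponent sums of the letter by which `mv a b` multiplies a generator. -/
def mvVec (a b : ι × Bool) : ι → ℤ := (bif b.2 then (-1 : ℤ) else 1) • ev (letter a)

lemma exists_mv_eq_lr {a b : ι × Bool} (h : a.1 ≠ b.1) : ∃ p : coGen b.1 × coGen b.1,
    mv a b = lr b.1 p ∧ ev (p.2 : FreeGroup ι) - ev (p.1 : FreeGroup ι) = mvVec a b := by
  refine ⟨_, mv_eq h, ?_⟩
  obtain ⟨i, s⟩ := b
  cases s <;> simp [mvVec]

lemma ev_letter_self (a : ι × Bool) : letterVal (ev (letter a)) a = 1 := by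
  rw [ev_letter]
  obtain ⟨i, s⟩ := a
  cases s <;> simp [letterVal]

lemma ev_letter_of_ne {a : ι × Bool} {i : ι} (h : i ≠ a.1) : ev (letter a) i = 0 := by
  rw [ev_letter, Pi.single_eq_of_ne h]

/-- Modulo `magnus`, the automorphism `lr i p` depends only on the net exponent vector `ev p.2 - ev
p.1`; all relations between moves of a single generator follow from this. -/
lemma lr_mul_inv_mem_magnus {i : ι} {p q : coGen i × coGen i}
    (h : ev (p.2 : FreeGroup ι) - ev (p.1 : FreeGroup ι) =
      ev (q.2 : FreeGroup ι) - ev (q.1 : FreeGroup ι)) : lr i p * (lr i q)⁻¹ ∈ magnus ι := by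
  rw [← map_inv, ← map_mul]
  refine lr_mem_magnus ?_
  simp only [Prod.fst_mul, Prod.snd_mul, Subgroup.coe_mul, ev_mul, Prod.fst_inv, Prod.snd_inv,
    Subgroup.coe_inv, ev_inv]
  rw [← sub_eq_zero] at h ⊢
  rw [← neg_zero, ← h]
  abel

lemma mv_negLetter_negLetter (a b : ι × Bool) :
    mv (negLetter a) (negLetter b) * (mv a b)⁻¹ ∈ magnus ι := by
  by_cases h : a.1 = b.1
  · simp [mv, h]
  · obtain ⟨p, hp, hv⟩ := exists_mv_eq_lr h
    obtain ⟨q, hq, hw⟩ := exists_mv_eq_lr (a := negLetter a) (b := negLetter b) h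
    rw [hp, hq]
    refine lr_mul_inv_mem_magnus ?_
    rw [hv, hw]
    obtain ⟨i, s⟩ := b
    cases s <;> simp [mvVec]

lemma mv_negLetter_mul (a b : ι × Bool) : mv a (negLetter b) * mv a b ∈ magnus ι := by
  by_cases h : a.1 = b.1
  · simp [mv, h]
  · obtain ⟨p, hp, hv⟩ := exists_mv_eq_lr h
    obtain ⟨q, hq, hw⟩ := exists_mv_eq_lr (a := a) (b := negLetter b) h
    rw [hp, ← inv_inv (lr b.1 p), ← map_inv, hq]
    refine lr_mul_inv_mem_magnus ?_
    rw [hw]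
    simp only [Prod.snd_inv, Prod.fst_inv, Subgroup.coe_inv, ev_inv]
    rw [← neg_sub', hv]
    obtain ⟨i, s⟩ := b
    cases s <;> simp [mvVec]

/-- The moves commute exactly if they change different generators. If they change the same one, they
commute only modulo `magnus`, by comparing exponents. -/
lemma mv_comm (a b c d : ι × Bool) (had : a.1 ≠ d.1) (hbc : b.1 ≠ c.1) :
    mv a b * mv c d * (mv c d * mv a b)⁻¹ ∈ magnus ι := by
  by_cases hab : a.1 = b.1
  · simp [mv, hab]
  by_cases hcd : c.1 = d.1
  · simp [mv, hcd]
  by_cases hbd : b.1 = d.1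
  · obtain ⟨p, hp, -⟩ := exists_mv_eq_lr hab
    obtain ⟨q, hq, -⟩ := exists_mv_eq_lr hcd
    obtain ⟨i, s⟩ := b
    obtain ⟨j, t⟩ := d
    obtain rfl : i = j := hbd
    rw [hp, hq, ← map_mul, ← map_mul]
    refine lr_mul_inv_mem_magnus ?_
    simp only [Prod.fst_mul, Prod.snd_mul, Subgroup.coe_mul, ev_mul]
    abel
  · have : mv a b * mv c d = mv c d * mv a b := by
      refine mulAut_ext_letters b d ?_ ?_ fun k hb hd => ?_
      · simp only [MulAut.mul_apply]
        rw [mv_letter_of_ne hbd, mv_self hab, map_mul, map_inv, mv_letter_of_ne hbd,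
          mv_letter_of_ne had]
      · simp only [MulAut.mul_apply]
        rw [mv_letter_of_ne (Ne.symm hbd), mv_self hcd, map_mul, map_inv,
          mv_letter_of_ne (Ne.symm hbd), mv_letter_of_ne hbc.symm]
      · simp only [MulAut.mul_apply]
        rw [mv_of_ne hb, mv_of_ne hd, mv_of_ne hb]
    rw [this, mul_inv_cancel]
    exact one_mem _

lemma mv_tri {a b d : ι × Bool} (hab : a.1 ≠ b.1) (had : a.1 ≠ d.1) (hbd : b.1 ≠ d.1) :
    mv a d * (mv a b * mv b d) = mv b d * mv a b := by
  refine mulAut_ext_letters b d ?_ ?_ fun k hb hd => ?_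
  · simp only [MulAut.mul_apply]
    simp only [mv_letter_of_ne hbd, mv_self hab, map_mul, map_inv, mv_letter_of_ne had]
  · simp only [MulAut.mul_apply]
    simp only [mv_letter_of_ne hbd.symm, mv_self hbd, map_mul, map_inv, mv_self hab, mv_self had,
      mv_letter_of_ne hbd, mv_letter_of_ne had]
    group
  · simp only [MulAut.mul_apply]
    simp only [mv_of_ne hb, mv_of_ne hd]

/-- The triple product is the signed permutation `a ↦ b`, `b ↦ a⁻¹` followed by the conjugation `a ↦
b a b⁻¹`, which belongs to `magnus`. The signs of `s` are chosen so that this holds for letters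
rather than generators. -/
lemma exists_mv_rot {a b : ι × Bool} (h : a.1 ≠ b.1) : ∃ s : MulAut (FreeGroup ι), IsSigned s ∧
    mv a b * (mv b (negLetter a) * mv a b) * s⁻¹ ∈ magnus ι := by
  obtain ⟨s, hs, hsi⟩ := exists_isSigned (Equiv.swap a.1 b.1) (fun k => if k = a.1 then
    !xor a.2 b.2 else if k = b.1 then xor a.2 b.2 else true)
  refine ⟨s, hs, ?_⟩
  have hsa : s (letter a) = letter b := by
    rw [apply_letter hsi]
    refine congrArg letter (Prod.ext (by simp) ?_)
    simp only [if_true]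
    cases a.2 <;> cases b.2 <;> rfl
  have hsb : s (letter b) = (letter a)⁻¹ := by
    rw [apply_letter hsi, ← letter_negLetter]
    refine congrArg letter (Prod.ext (by simp) ?_)
    simp only [if_neg h.symm, if_true, negLetter_snd]
    cases a.2 <;> cases b.2 <;> rfl
  have hsk : ∀ k, k ≠ a.1 → k ≠ b.1 → s (FreeGroup.of k) = FreeGroup.of k := by
    intro k ha hb
    rw [hsi, Equiv.swap_apply_of_ne_of_ne ha hb]
    simp [ha, hb, letter_true]
  let y : coGen a.1 := ⟨(letter b)⁻¹, inv_mem (letter_mem_coGen h.symm)⟩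
  have hself : lr a.1 (y, y) (letter a) = letter b * letter a * (letter b)⁻¹ := by
    obtain ⟨i, t⟩ := a
    cases t <;> simp [letter_true, letter_false, lr_of_self, y, mul_assoc]
  have hb : lr a.1 (y, y) (letter b) = letter b := lr_of_mem _ (letter_mem_coGen h.symm)
  have e : mv a b * (mv b (negLetter a) * mv a b) = lr a.1 (y, y) * s := by
    have h1 : mv b (negLetter a) (letter a) = letter b * letter a := by
      have := mv_self (a := b) (b := negLetter a) h.symm
      rw [letter_negLetter, map_inv, inv_eq_iff_eq_inv] at this
      rw [this]
      group
    have h2 : mv b (negLetter a) (letter b) = letter b := mv_letter_of_ne h.symm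
    refine mulAut_ext_letters a b ?_ ?_ fun k hka hkb => ?_
    · simp only [MulAut.mul_apply, hsa, hb]
      rw [mv_letter_of_ne h, h1, map_mul, mv_self h, mv_letter_of_ne h]
      group
    · simp only [MulAut.mul_apply, hsb, map_inv, hself]
      rw [mv_self h, map_mul, map_inv, h1, h2]
      simp only [map_mul, map_inv, mv_self h, mv_letter_of_ne h]
      group
    · simp only [MulAut.mul_apply]
      rw [mv_of_ne hkb, mv_of_ne (by exact hka), mv_of_ne hkb, hsk k hka hkb, lr_of_ne _ hka]
  rw [e, mul_assoc, mul_inv_cancel, mul_one]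
  exact lr_mem_magnus rfl

variable [Fintype ι]

lemma rho_mv {a b : ι × Bool} (h : a.1 ≠ b.1) (v : ι → ℤ) :
    rho (mv a b) v = v - letterVal v b • ev (letter a) := by
  obtain ⟨p, hp, hv⟩ := exists_mv_eq_lr h
  rw [hp, rho_lr, hv, mvVec, smul_smul, sub_eq_add_neg, ← neg_smul]
  congr 2
  obtain ⟨i, s⟩ := b
  cases s <;> simp [letterVal]

lemma letterVal_rho_mv {a b : ι × Bool} (h : a.1 ≠ b.1) (v : ι → ℤ) :
    letterVal (rho (mv a b) v) a = letterVal v a - letterVal v b := by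
  have : ∀ (u w : ι → ℤ) (c : ℤ), letterVal (u - c • w) a =
      letterVal u a - c * letterVal w a := by
    intro u w c
    obtain ⟨i, s⟩ := a
    cases s
    · simp [letterVal]; ring
    · simp [letterVal]
  rw [rho_mv h, this, ev_letter_self, mul_one]

lemma vecNorm_rho {g : MulAut (FreeGroup ι)} (hg : IsSigned g) (v : ι → ℤ) :
    vecNorm (rho g v) = vecNorm v := by
  obtain ⟨σ, s, h⟩ := hg
  rw [vecNorm, ← Equiv.sum_comp σ]
  refine Finset.sum_congr rfl fun i _ => ?_
  rw [rho_signed h]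
  cases s i <;> simp

end Transvection

/-! # The stabilizer of a basis vector -/

section Stabilizer

variable {ι : Type}

/-- The generators other than `t`, as a set. -/
abbrev others (t : ι) : Set ι := {k | k ≠ t}

lemma extAut_of_self [Finite ι] {t : ι} (ψ : MulAut (FreeGroup (others t))) :
    extAut (others t) ψ (FreeGroup.of t) = FreeGroup.of t :=
  extAut_of_notMem ψ fun h => h rfl

variable [DecidableEq ι]

/-- The automorphisms generated by the transvections `a_j ↦ a_j a_t`, modulo `magnus`. -/
def lowerUni (t : ι) : Subgroup (MulAut (FreeGroup ι)) :=
  magnus ι ⊔ Subgroup.closure {φ | ∃ j, ∃ h : t ≠ j, φ = tv j t h}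

lemma tv_mem_lowerUni {t j : ι} (h : t ≠ j) : tv j t h ∈ lowerUni t :=
  Subgroup.mem_sup_right (Subgroup.subset_closure ⟨j, h, rfl⟩)

lemma magnus_le_lowerUni (t : ι) : magnus ι ≤ lowerUni t := le_sup_left

/-- Modulo `magnus` only exponents count, so this is the `c`-th power of a transvection by `a_t`. -/
lemma lr_mem_lowerUni {t i : ι} (h : t ≠ i) {p : coGen i × coGen i} {c : ℤ}
    (hp : ev (p.2 : FreeGroup ι) - ev (p.1 : FreeGroup ι) = c • Pi.single t 1) :
    lr i p ∈ lowerUni t := by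
  have h1 : lr i p = lr i (p * (1, gen t h) ^ (-c)) * tv i t h ^ c := by
    rw [tv_eq, ← map_zpow, ← map_mul, mul_assoc, ← zpow_add]
    simp
  rw [h1]
  refine mul_mem (magnus_le_lowerUni t (lr_mem_magnus ?_)) (zpow_mem (tv_mem_lowerUni h) c)
  have hz : ∀ n : ℤ, ev (FreeGroup.of t ^ n) = n • Pi.single t 1 := by
    intro n
    simp [ev, evHom]
  simp only [Prod.fst_mul, Prod.snd_mul, Prod.pow_mk, one_zpow, mul_one, Subgroup.coe_mul, ev_mul,
    Subgroup.coe_zpow, coe_gen, hz]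
  rw [neg_smul, ← hp]
  abel

lemma signed_conj_mem_lowerUni {t j : ι} (h : t ≠ j) {g : MulAut (FreeGroup ι)} (hg : IsSigned g)
    (ht : g (FreeGroup.of t) = FreeGroup.of t) : g * tv j t h * g⁻¹ ∈ lowerUni t := by
  obtain ⟨σ, s, hs⟩ := hg
  have hσ : letter (signedLetter σ s (t, true)) = letter (t, true) := by
    rw [letter_true, ← ht, hs]
    simp [signedLetter]
  have hσ' : signedLetter σ s (t, true) = (t, true) := by
    have := congrArg FreeGroup.toWord hσ
    simpa [letter, FreeGroup.toWord_mk] using this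
  have hj : t ≠ σ j := fun h0 => h (σ.injective ((congrArg Prod.fst hσ').trans h0))
  have e : g * tv j t h = letterTv (signedLetter σ s (j, true)) (t, true) hj * g := by
    have := signed_conj_letterTv hs (a := (j, true)) (b := (t, true)) h
    simp only [hσ'] at this
    exact this
  rw [e, mul_inv_cancel_right]
  cases hu : (signedLetter σ s (j, true)).2
  · exact lr_mem_lowerUni hj (c := -1) (by simp [hu, letter_true])
  · exact lr_mem_lowerUni hj (c := 1) (by simp [hu, letter_true])

/-- The automorphism `a_i ↦ a_i a_k^{±1}` with `i, k ≠ t` normalizes `lowerUni t`. -/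
lemma lr_conj_mem_lowerUni {t j i : ι} (h : t ≠ j) (hi : i ≠ t) {b : ι × Bool} (hb : b.1 ≠ i)
    (hbt : b.1 ≠ t) {y : coGen i} (hy : (y : FreeGroup ι) = letter b) :
    lr i (1, y) * tv j t h * (lr i (1, y))⁻¹ ∈ lowerUni t := by
  by_cases hij : i = j
  · subst hij
    rw [tv_eq, ← map_inv, ← map_mul, ← map_mul]
    exact lr_mem_lowerUni h (c := 1) (by simp)
  by_cases hbj : b.1 = j
  · have hji : j ≠ i := Ne.symm hij
    have hti : t ≠ i := hi.symm
    obtain ⟨k, s⟩ := b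
    obtain rfl : k = j := hbj
    -- Moving the transvection `a_k ↦ a_k a_t` past `a_i ↦ a_i a_k^{±1}` costs the factor `a_i ↦ a_i
    -- z`, where `z` is a conjugate of `a_t⁻¹` or `a_t` itself according to the sign; its exponent
    -- vector is `∓` that of `a_t`.
    let z : coGen i := bif s then ⟨FreeGroup.of k * (FreeGroup.of t)⁻¹ * (FreeGroup.of k)⁻¹,
      mul_mem (mul_mem (of_mem_coGen hji) (inv_mem (of_mem_coGen hti))) (inv_mem (of_mem_coGen hji))⟩
      else ⟨FreeGroup.of t, of_mem_coGen hti⟩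
    have e : lr i (1, y) * tv k t h = lr i (1, z) * tv k t h * lr i (1, y) := by
      refine mulAut_ext fun l => ?_
      have hkz : ∀ z : coGen i, lr i (1, z) (FreeGroup.of k) = FreeGroup.of k := fun z =>
        lr_of_ne _ hji
      have htz : ∀ z : coGen i, lr i (1, z) (FreeGroup.of t) = FreeGroup.of t := fun z =>
        lr_of_ne _ hti
      simp only [MulAut.mul_apply]
      by_cases hl : l = i
      · subst hl
        rw [tv_of_ne _ hij, lr_of_self, map_mul, map_mul, map_mul, map_mul]
        simp only [Subgroup.coe_one, inv_one, map_one, tv_of_ne h hij, lr_of_self, hy, one_mul]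
        cases s
        · simp only [letter_false, map_inv, tv_of_self, map_mul, hkz, htz, z, cond_false]
          group
        · simp only [letter_true, tv_of_self, map_mul, hkz, htz, z, cond_true]
          group
      · rw [lr_of_ne _ hl]
        by_cases hlk : l = k
        · subst hlk
          simp only [tv_of_self, map_mul, hkz, htz]
        · rw [tv_of_ne _ hlk, lr_of_ne _ hl, lr_of_ne _ hl]
    rw [e, mul_inv_cancel_right]
    refine mul_mem ?_ (tv_mem_lowerUni h)
    cases s
    · exact lr_mem_lowerUni hti (c := 1) (by simp [z])
    · exact lr_mem_lowerUni hti (c := -1) (by simp [z])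
  · have hbm : ∀ k, k ≠ j → lr i (1, y) (FreeGroup.of k) ∈ coGen j := by
      intro k hk
      by_cases hki : k = i
      · subst hki
        rw [lr_of_self, hy]
        exact mul_mem (mul_mem (by simp) (of_mem_coGen hk)) (letter_mem_coGen hbj)
      · rw [lr_of_ne _ hki]
        exact of_mem_coGen hk
    have hbm' : ∀ k, k ≠ j → (lr i (1, y))⁻¹ (FreeGroup.of k) ∈ coGen j := by
      intro k hk
      rw [← map_inv]
      by_cases hki : k = i
      · subst hki
        rw [lr_of_self]
        exact mul_mem (mul_mem (by simp) (of_mem_coGen hk))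
          (by simpa [hy] using letter_mem_coGen hbj)
      · rw [lr_of_ne _ hki]
        exact of_mem_coGen hk
    rw [tv_eq, conj_lr (lr_of_ne _ (Ne.symm hij)) hbm hbm']
    refine lr_mem_lowerUni h (c := 1) ?_
    simp only [Subgroup.coe_one, map_one, coe_gen, lr_of_ne _ hi.symm]
    simp

variable [Finite ι]

lemma extAut_mv {S : Set ι} (a b : S × Bool) :
    extAut S (mv a b) = mv ((a.1 : ι), a.2) ((b.1 : ι), b.2) := by
  by_cases h : a.1 = b.1
  · simp [mv, h]
  have h' : (a.1 : ι) ≠ b.1 := fun h0 => h (Subtype.ext h0)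
  refine mulAut_ext_letter ((b.1 : ι), b.2) ?_ fun k hk => ?_
  · rw [mv_self (by exact h'), ← inclFree_letter, extAut_inclFree, mv_self h, map_mul, map_inv,
      inclFree_letter, inclFree_letter]
  · rw [mv_of_ne hk]
    by_cases hkS : k ∈ S
    · rw [extAut_of_mem _ ⟨k, hkS⟩, mv_of_ne (fun h0 => hk (congrArg Subtype.val h0)), inclFree_of]
    · rw [extAut_of_notMem _ hkS]

lemma exists_eq_extAut_of_isSigned {t : ι} {g : MulAut (FreeGroup ι)} (hg : IsSigned g)
    (ht : g (FreeGroup.of t) = FreeGroup.of t) :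
    ∃ ψ : MulAut (FreeGroup (others t)), IsSigned ψ ∧ g = extAut (others t) ψ := by
  obtain ⟨σ, s, h⟩ := hg
  have hσ : σ t = t := by
    rw [h, ← letter_true] at ht
    have := congrArg FreeGroup.toWord ht
    simp [letter, FreeGroup.toWord_mk] at this
    exact this.1
  obtain ⟨ψ, hψ, hψi⟩ := exists_isSigned (ι := others t)
    (σ.subtypePerm fun x => ⟨fun h0 h1 => h0 (h1.symm ▸ hσ), fun h0 h1 =>
      h0 (σ.injective (h1.trans hσ.symm))⟩) (fun k => s k)
  refine ⟨ψ, hψ, (extAut_eq_iff.mpr ⟨fun k => ?_, fun k hk => ?_⟩).symm⟩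
  · rw [h, hψi, inclFree_letter]
    rfl
  · obtain rfl : k = t := not_not.mp hk
    exact ht

variable (ι) in
lemma magnus_normal : (magnus ι).Normal := by
  have := Fintype.ofFinite ι
  infer_instance

lemma conj_mem_lowerUni_of_forall {t : ι} {g : MulAut (FreeGroup ι)}
    (h : ∀ j (hj : t ≠ j), g * tv j t hj * g⁻¹ ∈ lowerUni t) {x : MulAut (FreeGroup ι)}
    (hx : x ∈ lowerUni t) : g * x * g⁻¹ ∈ lowerUni t := by
  have : lowerUni t ≤ (lowerUni t).comap (MulAut.conj g).toMonoidHom := by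
    refine sup_le (fun m hm => ?_) ((Subgroup.closure_le _).mpr ?_)
    · exact magnus_le_lowerUni t ((magnus_normal ι).conj_mem m hm g)
    · rintro _ ⟨j, hj, rfl⟩
      exact h j hj
  exact this hx

/-- By Nielsen's theorem for the generators other than `a_t`, only signed permutations and
transvections have to be checked. It makes `parabolic t` a product of two subgroups. -/
lemma extAut_conj_mem_lowerUni {t : ι} (ψ : MulAut (FreeGroup (others t)))
    {x : MulAut (FreeGroup ι)} (hx : x ∈ lowerUni t) :
    extAut _ ψ * x * (extAut _ ψ)⁻¹ ∈ lowerUni t := by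
  have := Fintype.ofFinite (others t)
  have hψ : ψ ∈ elementary (others t) := elementary_eq_top (ι := others t) ▸ Subgroup.mem_top ψ
  induction hψ using Subgroup.closure_induction'' generalizing x with
  | mem g hg =>
    refine conj_mem_lowerUni_of_forall (fun j hj => ?_) hx
    rcases hg with hg | ⟨i, k, hk, rfl⟩
    · exact signed_conj_mem_lowerUni hj (isSigned_extAut hg) (extAut_of_self g)
    · rw [tv_eq, extAut_lr]
      refine lr_conj_mem_lowerUni (y := ⟨_, inclFree_mem_coGen (gen k hk).2⟩) (b := ((k : ι), true))
        hj i.2 (fun h0 => hk (Subtype.ext h0)) k.2 (inclFree_of _ k) |> fun h => ?_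
      convert h using 5 <;> simp
  | inv_mem g hg =>
    refine conj_mem_lowerUni_of_forall (fun j hj => ?_) hx
    rcases hg with hg | ⟨i, k, hk, rfl⟩
    · exact signed_conj_mem_lowerUni hj (isSigned_extAut hg.inv) (extAut_of_self _)
    · rw [tv_eq, ← map_inv, extAut_lr]
      refine lr_conj_mem_lowerUni (y := ⟨_, inclFree_mem_coGen (gen k hk)⁻¹.2⟩)
        (b := ((k : ι), false)) hj i.2 (fun h0 => hk (Subtype.ext h0)) k.2
        (congrArg Inv.inv (inclFree_of _ k)) |> fun h => ?_
      convert h using 5 <;> simp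
  | one => simpa using hx
  | mul _ _ _ _ h1 h2 =>
    have := h1 (h2 hx)
    convert this using 1
    simp only [map_mul]
    group

/-- A subgroup that contains the stabilizer of the basis vector `t` in the automorphism group. -/
noncomputable def parabolic (t : ι) : Subgroup (MulAut (FreeGroup ι)) :=
  lowerUni t ⊔ (extAut (others t)).range

lemma mem_parabolic {t : ι} {φ : MulAut (FreeGroup ι)} :
    φ ∈ parabolic t ↔ ∃ u ∈ lowerUni t, ∃ ψ, u * extAut (others t) ψ = φ := by
  have h := Subgroup.coe_mul_of_right_le_normalizer_left (lowerUni t) (extAut (others t)).range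
    (Subgroup.le_normalizer_iff.mpr (by
      rintro _ ⟨ψ, rfl⟩ x hx
      exact extAut_conj_mem_lowerUni ψ hx))
  rw [parabolic, ← SetLike.mem_coe, h, Set.mem_mul]
  simp

end Stabilizer

/-! # Magnus' generators of `IA` -/

section Action

variable {ι : Type} [DecidableEq ι]

lemma letter_injective : Function.Injective (letter : ι × Bool → FreeGroup ι) := by
  intro a b h
  have := congrArg FreeGroup.toWord h
  simpa [letter, FreeGroup.toWord_mk] using this

variable [Fintype ι]

lemma magnus_le_parabolic (t : ι) : magnus ι ≤ parabolic t :=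
  (magnus_le_lowerUni t).trans le_sup_left

/-- The action of automorphisms on pairs of a vector and a coset of the parabolic subgroup. -/
noncomputable def act (t : ι) (g : MulAut (FreeGroup ι)) (p : (ι → ℤ) × (MulAut (FreeGroup ι) ⧸ parabolic t)) :
    (ι → ℤ) × (MulAut (FreeGroup ι) ⧸ parabolic t) := (rho g p.1, g • p.2)

lemma act_one (t : ι) : act t 1 = id := by
  funext p
  exact Prod.ext (by simp [act]) (one_smul _ _)

lemma act_mul (t : ι) (g h : MulAut (FreeGroup ι)) : act t (g * h) = act t g ∘ act t h := by
  funext p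
  exact Prod.ext (by simp [act]) (mul_smul _ _ _)

/-- On vectors because `magnus ≤ IA`, on cosets because `magnus` is normal and contained in
`parabolic t`. Relations that hold modulo `magnus` thus become identities of the action. -/
lemma act_of_mem_magnus (t : ι) {m : MulAut (FreeGroup ι)} (hm : m ∈ magnus ι) :
    act t m = id := by
  funext ⟨v, c⟩
  refine Prod.ext ?_ ?_
  · simp only [act]
    rw [mem_IA_iff_rho.mp (magnus_le_IA hm)]
    rfl
  · obtain ⟨x, rfl⟩ := QuotientGroup.mk_surjective c
    refine QuotientGroup.eq.mpr (magnus_le_parabolic t ?_)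
    have := (magnus_normal ι).conj_mem' _ (inv_mem hm) x
    simpa [mul_assoc] using this

lemma act_eq_of_mem_magnus (t : ι) {g h : MulAut (FreeGroup ι)} (hm : g * h⁻¹ ∈ magnus ι) :
    act t g = act t h := by
  have := act_mul t (g * h⁻¹) h
  rwa [inv_mul_cancel_right, act_of_mem_magnus t hm] at this

/-- The base point. -/
noncomputable def basePoint (t : ι) : (ι → ℤ) × (MulAut (FreeGroup ι) ⧸ parabolic t) := 
  (Pi.single t 1, ((1 : MulAut (FreeGroup ι)) : MulAut (FreeGroup ι) ⧸ parabolic t))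

lemma act_basePoint_eq {t : ι} {g h : MulAut (FreeGroup ι)} :
    (act t g (basePoint t)).2 = (act t h (basePoint t)).2 ↔ g⁻¹ * h ∈ parabolic t := by
  have : ∀ g, (act t g (basePoint t)).2 = (g : MulAut (FreeGroup ι) ⧸ parabolic t) := fun g =>
    congrArg QuotientGroup.mk (mul_one g)
  rw [this, this, QuotientGroup.eq]

lemma mv_mem_parabolic {t : ι} {a b : ι × Bool} (h : t ≠ b.1) : mv a b ∈ parabolic t := by
  by_cases hab : a.1 = b.1
  · simp [mv, hab, one_mem]
  by_cases ha : a.1 = t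
  · obtain ⟨p, hp, hv⟩ := exists_mv_eq_lr hab
    rw [hp]
    refine Subgroup.mem_sup_left (lr_mem_lowerUni h
      (c := (bif b.2 then (-1 : ℤ) else 1) * (bif a.2 then 1 else -1)) ?_)
    rw [hv, mvVec, ev_letter, ← ha, mul_smul, ← Pi.single_smul a.1 (bif a.2 then (1 : ℤ) else -1),
      smul_eq_mul, mul_one]
  · refine Subgroup.mem_sup_right ⟨mv (⟨a.1, ha⟩, a.2) (⟨b.1, h.symm⟩, b.2), ?_⟩
    exact extAut_mv (S := others t) _ _

lemma vec_act_signed {t : ι} {g : MulAut (FreeGroup ι)} {σ : Equiv.Perm ι} {s : ι → Bool}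
    (h : ∀ i, g (FreeGroup.of i) = letter (σ i, s i)) :
    (act t g (basePoint t)).1 = Pi.single (σ t) (bif s t then 1 else -1) := by
  simp only [act, basePoint]
  rw [rho_single, h, ev_letter]

/-- The automorphism group of a free group acts on vectors and cosets by moves that satisfy the
Steinberg relations. -/
noncomputable def steinbergAction (t : ι) :
    SteinbergAction ι ((ι → ℤ) × (MulAut (FreeGroup ι) ⧸ parabolic t)) where
  vec := Prod.fst
  x a b := act t (mv a b)
  W := {f | ∃ g, IsSigned g ∧ f = act t g}
  o := basePoint t
  val_x_self a b p h := letterVal_rho_mv h _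
  vec_x_of_ne a b p i h hi := by
    simp only [act]
    rw [rho_mv h, Pi.sub_apply, Pi.smul_apply, ev_letter_of_ne hi, smul_zero, sub_zero]
  x_neg_neg a b := act_eq_of_mem_magnus t (mv_negLetter_negLetter a b)
  x_neg_x a b p _ := by
    have := act_of_mem_magnus t (mv_negLetter_mul a b)
    rw [act_mul] at this
    exact congrFun this p
  comm a b c d p _ _ had hbc := by
    have := act_eq_of_mem_magnus t (mv_comm a b c d had hbc)
    rw [act_mul, act_mul] at this
    exact congrFun this p
  tri a b d p hab had hbd := by
    have := congrArg (act t) (mv_tri hab had hbd)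
    rw [act_mul, act_mul, act_mul] at this
    exact congrFun this p
  rot a b h := by
    obtain ⟨s, hs, hm⟩ := exists_mv_rot h
    refine ⟨s, hs, ?_⟩
    rw [← act_eq_of_mem_magnus t hm, act_mul, act_mul]
    rfl
  id_mem := ⟨1, isSigned_one, (act_one t).symm⟩
  comp_mem := by
    rintro _ ⟨g, hg, rfl⟩ _ ⟨h, hh, rfl⟩
    exact ⟨g * h, hg.mul hh, (act_mul t g h).symm⟩
  inv_mem := by
    rintro _ ⟨g, hg, rfl⟩
    refine ⟨_, ⟨g⁻¹, hg.inv, rfl⟩, fun p => ?_⟩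
    have := act_mul t g⁻¹ g
    rw [inv_mul_cancel, act_one] at this
    exact (congrFun this p).symm
  conj := by
    rintro _ ⟨g, ⟨σ, s, hg⟩, rfl⟩
    refine ⟨signedLetter σ s, fun a b p h => ⟨fun h0 => h (σ.injective h0), ?_⟩⟩
    have := congrArg (act t) (signed_mul_mv hg a b)
    rw [act_mul, act_mul] at this
    exact (congrFun this p).symm
  norm_w := by
    rintro _ ⟨g, hg, rfl⟩ p
    exact vecNorm_rho hg p.1
  base_inj := by
    rintro _ ⟨g, hg, rfl⟩ _ ⟨h, hh, rfl⟩ e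
    refine Prod.ext e (act_basePoint_eq.mpr ?_)
    -- Two signed automorphisms with the same vector differ by one that fixes `a_t`, which extends a
    -- signed automorphism of the other generators.
    have hk := hg.inv.mul hh
    have e' : rho (g⁻¹ * h) (Pi.single t 1) = Pi.single t 1 := by
      have e1 : rho g (Pi.single t 1) = rho h (Pi.single t 1) := e
      rw [map_mul, Module.End.mul_apply, ← e1, ← Module.End.mul_apply, ← map_mul, inv_mul_cancel,
        map_one, Module.End.one_apply]
    have ht : (g⁻¹ * h) (FreeGroup.of t) = FreeGroup.of t := by
      obtain ⟨σ, s, hs⟩ := hk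
      rw [rho_single, hs, ev_letter] at e'
      rw [hs, ← letter_true]
      have h1 : σ t = t := by
        by_contra h0
        have := congrFun e' t
        rw [Pi.single_eq_of_ne (Ne.symm h0), Pi.single_eq_same] at this
        exact zero_ne_one this
      rw [h1] at e' ⊢
      have := congrFun e' t
      rw [Pi.single_eq_same, Pi.single_eq_same] at this
      cases h2 : s t
      · rw [h2] at this
        exact absurd this (by simp)
      · rfl
    obtain ⟨ψ, -, hψ⟩ := exists_eq_extAut_of_isSigned hk ht
    rw [hψ]
    exact Subgroup.mem_sup_right ⟨ψ, rfl⟩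
  base_fix := by
    rintro _ ⟨g, hg, rfl⟩ a b h hb
    obtain ⟨σ, s, hs⟩ := hg.inv
    -- Conjugating back to the base point turns `mv a b` into a move of a generator other than
    -- `a_t`; such moves lie in `parabolic t`.
    have hbt : t ≠ (signedLetter σ s b).1 := by
      intro h0
      obtain ⟨τ, u, hu⟩ := hg
      have h1 : τ t = b.1 := by
        have h2 := congrArg g (hs b.1)
        rw [← MulAut.mul_apply, mul_inv_cancel, MulAut.one_apply, apply_letter hu,
          ← letter_true] at h2
        exact (congrArg τ h0).trans (congrArg Prod.fst (letter_injective h2)).symm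
      rw [vec_act_signed hu, h1, Pi.single_eq_same] at hb
      revert hb
      cases u t <;> simp
    refine Prod.ext ?_ ?_
    · have e := rho_mv h (act t g (basePoint t)).1
      rw [letterVal_eq_zero.mpr hb, zero_smul, sub_zero] at e
      exact e
    · rw [← Function.comp_apply (f := act t (mv a b)), ← act_mul, act_basePoint_eq]
      have := signed_mul_mv hs a b
      rw [← mul_inv_eq_iff_eq_mul, inv_inv] at this
      have h3 : (mv a b * g)⁻¹ * g = (g⁻¹ * mv a b * g)⁻¹ := by group
      rw [h3, this]
      exact inv_mem (mv_mem_parabolic hbt)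
  base_unit := by
    rintro _ ⟨g, ⟨σ, s, hs⟩, rfl⟩ i j hi hj
    rw [vec_act_signed hs] at hi hj
    have : ∀ k, (Pi.single (σ t) (bif s t then 1 else -1) : ι → ℤ) k ≠ 0 → k = σ t := fun k hk => by
      by_contra h0
      exact hk (Pi.single_eq_of_ne h0 _)
    rw [this i hi, this j hj]

/-- Elementary automorphisms preserve `Descends`, so Nielsen's theorem spreads it from the base
point to its whole orbit. -/
lemma descends_act (t : ι) (φ : MulAut (FreeGroup ι)) :
    (steinbergAction t).Descends (act t φ (basePoint t)) := by
  have key : ∀ p, (steinbergAction t).Descends p → (steinbergAction t).Descends (act t φ p) := by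
    have hφ : φ ∈ elementary ι := elementary_eq_top (ι := ι) ▸ Subgroup.mem_top φ
    induction hφ using Subgroup.closure_induction'' with
    | mem g hg =>
      intro p hp
      rcases hg with hg | ⟨i, j, h, rfl⟩
      · exact hp.w ⟨g, hg, rfl⟩
      · rw [← mv_eq_tv]
        exact hp.x h
    | inv_mem g hg =>
      intro p hp
      rcases hg with hg | ⟨i, j, h, rfl⟩
      · exact hp.w ⟨g⁻¹, hg.inv, rfl⟩
      · rw [← mv_eq_tv_inv]
        exact hp.x h
    | one => intro p hp; rwa [act_one]
    | mul g h _ _ hg hh => intro p hp; rw [act_mul]; exact hg _ (hh _ hp)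
  refine key _ ?_
  have := SteinbergAction.Descends.base (A := steinbergAction t) _ (steinbergAction t).id_mem
  exact this

/-- The stabilizer of a basis vector is contained in the parabolic subgroup. -/
lemma mem_parabolic_of_rho {t : ι} {φ : MulAut (FreeGroup ι)}
    (h : rho φ (Pi.single t 1) = Pi.single t 1) : φ ∈ parabolic t := by
  have e := (descends_act t 1).eq_of_vec_eq (descends_act t φ) (by
    change rho 1 (Pi.single t 1) = rho φ (Pi.single t 1)
    rw [h, map_one, Module.End.one_apply])
  have := act_basePoint_eq.mp (congrArg Prod.snd e)
  simpa using this

end Action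

/-! ### Explicit representatives of `lowerUni t` modulo `magnus` -/

section LowerUni

variable {ι : Type} [DecidableEq ι]

/-- The endomorphism `a_j ↦ a_j a_t^{m_j}`, `a_t ↦ a_t`. -/
def powHom (t : ι) (m : ι → ℤ) : FreeGroup ι →* FreeGroup ι :=
  FreeGroup.lift fun k => if k = t then FreeGroup.of t else FreeGroup.of k * FreeGroup.of t ^ m k

lemma powHom_self (t : ι) (m : ι → ℤ) : powHom t m (FreeGroup.of t) = FreeGroup.of t := by
  simp [powHom]

lemma powHom_of_ne {t k : ι} (m : ι → ℤ) (h : k ≠ t) :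
    powHom t m (FreeGroup.of k) = FreeGroup.of k * FreeGroup.of t ^ m k := by
  simp [powHom, h]

lemma powHom_comp (t : ι) (m m' : ι → ℤ) :
    (powHom t m).comp (powHom t m') = powHom t (m + m') := by
  refine FreeGroup.ext_hom _ _ fun k => ?_
  by_cases hk : k = t
  · subst hk
    simp [powHom_self]
  · rw [MonoidHom.comp_apply, powHom_of_ne _ hk, powHom_of_ne _ hk, map_mul, map_zpow, powHom_self,
      powHom_of_ne _ hk, mul_assoc, ← zpow_add]
    rfl

lemma powHom_zero (t : ι) : powHom t 0 = MonoidHom.id _ := by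
  refine FreeGroup.ext_hom _ _ fun k => ?_
  by_cases hk : k = t
  · subst hk
    simp [powHom_self]
  · simp [powHom_of_ne _ hk]

/-- The automorphism `a_j ↦ a_j a_t^{m_j}`, `a_t ↦ a_t`. -/
def powAut (t : ι) : Multiplicative (ι → ℤ) →* MulAut (FreeGroup ι) where
  toFun m := MonoidHom.toMulEquiv (powHom t m.toAdd) (powHom t (-m.toAdd))
    (by rw [powHom_comp, neg_add_cancel, powHom_zero])
    (by rw [powHom_comp, add_neg_cancel, powHom_zero])
  map_one' := MulEquiv.toMonoidHom_injective (powHom_zero t)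
  map_mul' m m' := MulEquiv.toMonoidHom_injective (powHom_comp t m.toAdd m'.toAdd).symm

lemma powAut_self (t : ι) (m : Multiplicative (ι → ℤ)) :
    powAut t m (FreeGroup.of t) = FreeGroup.of t := powHom_self t _

lemma powAut_of_ne {t k : ι} (m : Multiplicative (ι → ℤ)) (h : k ≠ t) :
    powAut t m (FreeGroup.of k) = FreeGroup.of k * FreeGroup.of t ^ m.toAdd k := powHom_of_ne _ h

/-- The automorphisms `powAut t m` form a group, so the generating transvections combine into one
explicit automorphism, whose exponents can be read off. -/
lemma lowerUni_le (t : ι) : lowerUni t ≤ magnus ι ⊔ (powAut t).range := by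
  refine sup_le le_sup_left ((Subgroup.closure_le _).mpr ?_)
  rintro _ ⟨j, h, rfl⟩
  refine Subgroup.mem_sup_right ⟨Multiplicative.ofAdd (Pi.single j 1), mulAut_ext fun k => ?_⟩
  by_cases hk : k = t
  · subst hk
    rw [powAut_self, tv_of_ne _ h]
  · rw [powAut_of_ne _ hk]
    by_cases hkj : k = j
    · subst hkj
      simp [tv_of_self]
    · simp [tv_of_ne _ hkj, hkj]

end LowerUni

/-! ### Magnus' theorem by induction on the rank -/

section Main

lemma ev_inclFree_of_notMem {ι : Type} [DecidableEq ι] {S : Set ι} (w : FreeGroup S) {k : ι}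
    (hk : k ∉ S) : ev (inclFree S w) k = 0 := by
  induction w using FreeGroup.induction_on with
  | C1 => simp
  | of i =>
    rw [inclFree_of, ev_of, Pi.single_eq_of_ne]
    rintro rfl
    exact hk i.2
  | inv_of i h => simp only [map_inv, ev_inv, Pi.neg_apply, h, neg_zero]
  | mul x y hx hy => simp only [map_mul, ev_mul, Pi.add_apply, hx, hy, add_zero]

/-- An element of `IA` fixes the basis vector `t`, so it is the product of an element of `magnus`,
some `powAut t m` and an extension of some `ψ`. On vectors, `powAut t m` changes only the coordinate
`t`, while the extension maps the span of the other basis vectors to itself. Triviality of the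
product forces both to be trivial there, so `powAut t m = 1` and `ψ` is in `IA` for the other
generators. -/
lemma IA_le_magnus_of_others {ι : Type} [DecidableEq ι] [Fintype ι] (t : ι)
    (h : FGrp.IA (FreeGroup (others t)) ≤ magnus (others t)) :
    FGrp.IA (FreeGroup ι) ≤ magnus ι := by
  intro φ hφ
  have hφ1 := mem_IA_iff_rho.mp hφ
  have hpar : φ ∈ parabolic t := mem_parabolic_of_rho (by rw [hφ1]; rfl)
  obtain ⟨u, hu, ψ, rfl⟩ := mem_parabolic.mp hpar
  have := magnus_normal ι
  obtain ⟨l, hl, _, ⟨m, rfl⟩, rfl⟩ := Subgroup.mem_sup_of_normal_left.mp (lowerUni_le t hu)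
  have hr : rho (powAut t m) * rho (extAut (others t) ψ) = 1 := by
    rw [map_mul, map_mul, mem_IA_iff_rho.mp (magnus_le_IA hl), one_mul] at hφ1
    exact hφ1
  have hT : ∀ v j, j ≠ t → rho (powAut t m) v j = v j := by
    intro v j hj
    have : (LinearMap.proj j).comp (rho (powAut t m)) =
        LinearMap.proj (R := ℤ) (φ := fun _ => ℤ) j := by
      refine (Pi.basisFun ℤ ι).ext fun k => ?_
      simp only [Pi.basisFun_apply, LinearMap.comp_apply, LinearMap.proj_apply]
      rw [rho_single]
      by_cases hk : k = t
      · subst hk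
        rw [powAut_self, ev_of]
      · have hz : ∀ n : ℤ, ev (FreeGroup.of t ^ n) = n • Pi.single t 1 := by
          intro n
          simp [ev, evHom]
        rw [powAut_of_ne _ hk, ev_mul, hz, ev_of]
        simp [hj]
    exact LinearMap.congr_fun this v
  have hw : ∀ k, k ≠ t → rho (extAut (others t) ψ) (Pi.single k 1) = Pi.single k 1 := by
    intro k hk
    have h1 : rho (powAut t m) (rho (extAut (others t) ψ) (Pi.single k 1)) = Pi.single k 1 :=
      LinearMap.congr_fun hr _
    funext j
    by_cases hj : j = t
    · subst hj
      rw [rho_single, extAut_of_mem ψ ⟨k, hk⟩, Pi.single_eq_of_ne (Ne.symm hk)]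
      exact ev_inclFree_of_notMem _ fun h0 => h0 rfl
    · rw [← hT (rho (extAut (others t) ψ) (Pi.single k 1)) j hj, h1]
  have hm : ∀ k, k ≠ t → m.toAdd k = 0 := by
    intro k hk
    have h1 : rho (powAut t m) (rho (extAut (others t) ψ) (Pi.single k 1)) = Pi.single k 1 :=
      LinearMap.congr_fun hr _
    rw [hw k hk, rho_single, powAut_of_ne _ hk, ev_mul, ev_of, add_eq_left] at h1
    have := congrFun h1 t
    simpa [ev, evHom] using this
  have hm1 : powAut t m = 1 := by
    refine mulAut_ext fun k => ?_
    by_cases hk : k = t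
    · subst hk
      rw [powAut_self]; rfl
    · rw [powAut_of_ne _ hk, hm k hk, zpow_zero, mul_one]; rfl
  rw [hm1, mul_one]
  refine mul_mem hl (extAut_mem_magnus (h (mem_IA_freeGroup.mpr fun k => ?_)))
  funext j
  rw [← ev_inclFree_apply, ← extAut_of_mem, ← rho_single, hw k k.2, ev_of]
  simp [Pi.single_apply, Subtype.ext_iff]

/-- Magnus' theorem: `IA` is generated, modulo its commutator subgroup, by automorphisms that
change a single generator. -/
theorem IA_le_magnus (ι : Type) [DecidableEq ι] [Finite ι] :
    FGrp.IA (FreeGroup ι) ≤ magnus ι := by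
  obtain ⟨n, hn⟩ : ∃ n, Nat.card ι = n := ⟨_, rfl⟩
  induction n generalizing ι with
  | zero =>
    have : IsEmpty ι := (Finite.card_eq_zero_iff).mp hn
    intro φ _
    rw [show φ = 1 from mulAut_ext fun i => isEmptyElim i]
    exact one_mem _
  | succ n ih =>
    have := Fintype.ofFinite ι
    have : Nonempty ι := Nat.card_pos_iff.mp (hn ▸ n.succ_pos) |>.1
    obtain ⟨t⟩ := this
    refine IA_le_magnus_of_others t (ih _ ?_)
    rw [show others t = {t}ᶜ from rfl, Nat.card_coe_set_eq, Set.ncard_compl, hn]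
    simp

end Main

/-! # Generation of the lower central series of `IA` by few generators -/

section General

variable {G : Type*} [Group G]

lemma lowerCentralSeries_le_of_le {S T : Subgroup G} (h : S ≤ T) (m : ℕ) :
    S.lowerCentralSeries m ≤ T.lowerCentralSeries m := by
  induction m with
  | zero => exact h
  | succ m ih => exact Subgroup.commutator_mono ih h

/-- Commutators with a fixed element that lie in a subgroup normalized by `N`. -/
def commutatorMem (N Q : Subgroup G) (hQ : ∀ g ∈ N, ∀ x ∈ Q, g * x * g⁻¹ ∈ Q) (c : G) :
    Subgroup G where
  carrier := {x | x ∈ N ∧ ⁅x, c⁆ ∈ Q}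
  one_mem' := ⟨one_mem N, by rw [commutatorElement_one_left]; exact one_mem Q⟩
  mul_mem' := by
    rintro x y ⟨hx, hx'⟩ ⟨hy, hy'⟩
    refine ⟨mul_mem hx hy, ?_⟩
    have : ⁅x * y, c⁆ = x * ⁅y, c⁆ * x⁻¹ * ⁅x, c⁆ := by simp only [commutatorElement_def]; group
    rw [this]
    exact mul_mem (hQ x hx _ hy') hx'
  inv_mem' := by
    rintro x ⟨hx, hx'⟩
    refine ⟨inv_mem hx, ?_⟩
    have : ⁅x⁻¹, c⁆ = x⁻¹ * ⁅x, c⁆⁻¹ * x⁻¹⁻¹ := by simp only [commutatorElement_def]; group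
    rw [this]
    exact hQ _ (inv_mem hx) _ (inv_mem hx')

/-- The three subgroups lemma, modulo a normal subgroup. -/
lemma commutator_commutator_le_of_rotate {H₁ H₂ H₃ Q : Subgroup G} [Q.Normal]
    (h1 : ⁅⁅H₂, H₃⁆, H₁⁆ ≤ Q) (h2 : ⁅⁅H₃, H₁⁆, H₂⁆ ≤ Q) : ⁅⁅H₁, H₂⁆, H₃⁆ ≤ Q := by
  have key : ∀ A B C : Subgroup G, ⁅⁅A, B⁆, C⁆ ≤ Q ↔
      ⁅⁅A.map (QuotientGroup.mk' Q), B.map (QuotientGroup.mk' Q)⁆,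
        C.map (QuotientGroup.mk' Q)⁆ = ⊥ := by
    intro A B C
    rw [← Subgroup.map_commutator, ← Subgroup.map_commutator, Subgroup.map_eq_bot_iff,
      QuotientGroup.ker_mk']
  rw [key] at h1 h2 ⊢
  exact Subgroup.commutator_commutator_eq_bot_of_rotate h1 h2

instance lowerCentralSeries_normal (N : Subgroup G) [N.Normal] (m : ℕ) :
    (N.lowerCentralSeries m).Normal := by
  induction m with
  | zero => exact inferInstanceAs N.Normal
  | succ m ih => exact Subgroup.commutator_normal _ _

lemma lowerCentralSeries_le_self (N : Subgroup G) (m : ℕ) : N.lowerCentralSeries m ≤ N :=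
  N.lowerCentralSeries_antitone (Nat.zero_le m)

end General

/-! ### Elements of `IA` supported on few generators -/

section Support

variable {ι : Type} [Finite ι]

/-- The automorphisms in `IA` that come from the free group on a set of generators. -/
noncomputable def iaOn (S : Set ι) : Subgroup (MulAut (FreeGroup ι)) :=
  (FGrp.IA (FreeGroup S)).map (extAut S)

lemma iaOn_le_IA (S : Set ι) : iaOn S ≤ FGrp.IA (FreeGroup ι) := by
  rintro _ ⟨ψ, hψ, rfl⟩
  exact extAut_mem_IA hψ

lemma mem_IA_of_extAut {S : Set ι} {ψ : MulAut (FreeGroup S)}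
    (h : extAut S ψ ∈ FGrp.IA (FreeGroup ι)) : ψ ∈ FGrp.IA (FreeGroup S) := by
  classical
  rw [mem_IA_freeGroup] at h ⊢
  intro k
  funext j
  rw [← ev_inclFree_apply, ← ev_inclFree_apply, ← extAut_of_mem, h, inclFree_of]

lemma iaOn_mono {S U : Set ι} (h : S ⊆ U) : iaOn S ≤ iaOn U := by
  rintro _ ⟨ψ, hψ, rfl⟩
  let S' : Set U := {x | (x : ι) ∈ S}
  let e : S ≃ S' := ⟨fun k => ⟨⟨k, h k.2⟩, k.2⟩, fun k => ⟨k.1, k.2⟩, fun _ => rfl, fun _ => rfl⟩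
  let ψ' : MulAut (FreeGroup U) := extAut S' (MulAut.congr (FreeGroup.freeGroupCongr e) ψ)
  have he : extAut U ψ' = extAut S ψ := by
    refine extAut_eq_iff.mpr ⟨fun k => ?_, fun k hk => extAut_of_notMem ψ fun h0 => hk (h h0)⟩
    by_cases hk : (k : ι) ∈ S
    · have h1 : FreeGroup.of k = FreeGroup.of ((⟨k, hk⟩ : S') : U) := rfl
      have h2 : ∀ w : FreeGroup S, inclFree U (inclFree S' (FreeGroup.freeGroupCongr e w)) =
          inclFree S w := by
        intro w
        simp only [inclFree, FreeGroup.freeGroupCongr_apply, FreeGroup.map.comp]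
        rfl
      rw [h1, extAut_of_mem]
      change _ = inclFree U (inclFree S' (FreeGroup.freeGroupCongr e (ψ
        ((FreeGroup.freeGroupCongr e).symm (FreeGroup.of ⟨k, hk⟩)))))
      rw [h2, FreeGroup.freeGroupCongr_symm, FreeGroup.freeGroupCongr_apply, FreeGroup.map.of]
      exact extAut_of_mem ψ ⟨k, hk⟩
    · rw [extAut_of_notMem ψ hk, extAut_of_notMem (S := S') _ hk, inclFree_of]
  exact ⟨ψ', mem_IA_of_extAut (he ▸ extAut_mem_IA hψ), he⟩

/-- The part of the lower central series of `IA` that is generated by the automorphisms supported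
by few generators. -/
noncomputable def lcsSmall (ι : Type) [Finite ι] (m : ℕ) : Subgroup (MulAut (FreeGroup ι)) :=
  ⨆ (S : Set ι) (_ : S.ncard ≤ 3 * (m + 1)), (iaOn S).lowerCentralSeries m

lemma lcs_iaOn_le_lcsSmall {S : Set ι} {m : ℕ} (h : S.ncard ≤ 3 * (m + 1)) :
    (iaOn S).lowerCentralSeries m ≤ lcsSmall ι m :=
  le_iSup₂_of_le (f := fun (S : Set ι) (_ : S.ncard ≤ 3 * (m + 1)) =>
    (iaOn S).lowerCentralSeries m) S h le_rfl

lemma lcsSmall_le (m : ℕ) : lcsSmall ι m ≤ (FGrp.IA (FreeGroup ι)).lowerCentralSeries m :=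
  iSup₂_le fun S _ => lowerCentralSeries_le_of_le (iaOn_le_IA S) m

/-- The subgroup lies between two consecutive terms of the lower central series, so conjugation by
`IA` changes its elements by elements it contains. -/
lemma conj_mem_lcsSmall_sup (m : ℕ) : ∀ g ∈ FGrp.IA (FreeGroup ι),
    ∀ x ∈ lcsSmall ι m ⊔ (FGrp.IA (FreeGroup ι)).lowerCentralSeries (m + 1),
      g * x * g⁻¹ ∈ lcsSmall ι m ⊔ (FGrp.IA (FreeGroup ι)).lowerCentralSeries (m + 1) := by
  intro g hg x hx
  have hle : lcsSmall ι m ⊔ (FGrp.IA (FreeGroup ι)).lowerCentralSeries (m + 1) ≤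
      (FGrp.IA (FreeGroup ι)).lowerCentralSeries m := by
    refine sup_le (lcsSmall_le m) ?_
    exact Subgroup.commutator_le_left _ _
  have h1 : g * x * g⁻¹ = ⁅x, g⁆⁻¹ * x := by rw [commutatorElement_def]; group
  rw [h1]
  exact mul_mem (inv_mem (Subgroup.mem_sup_right
    (Subgroup.commutator_mem_commutator (hle hx) hg))) hx

lemma lr_mem_iaOn [DecidableEq ι] {S : Set ι} {i : ι} (hi : i ∈ S) {p : coGen i × coGen i}
    (q : coGen (⟨i, hi⟩ : S) × coGen (⟨i, hi⟩ : S))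
    (hq : ev (q.1 : FreeGroup S) = ev (q.2 : FreeGroup S))
    (h1 : inclFree S q.1 = p.1) (h2 : inclFree S q.2 = p.2) : lr i p ∈ iaOn S := by
  refine ⟨lr _ q, lr_mem_IA hq, (extAut_lr _ q).trans ?_⟩
  exact congrArg _ (Prod.ext (Subtype.ext h1) (Subtype.ext h2))

/-- Magnus' generators involve the letters `i, j` or `i, j, k`; this is the source of the constant
`3`. -/
lemma IA_le_lcsSmall_sup : FGrp.IA (FreeGroup ι) ≤
    lcsSmall ι 0 ⊔ (FGrp.IA (FreeGroup ι)).lowerCentralSeries 1 := by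
  classical
  refine (IA_le_magnus ι).trans (sup_le ((Subgroup.closure_le _).mpr ?_) le_sup_right)
  rintro _ ⟨i, p, hp, rfl⟩
  refine lr_mem_of_generators (conj_mem_lcsSmall_sup 0) (fun j hj => ?_)
    (fun j k hj hk hjk => Or.inl ?_) p hp
  · refine Subgroup.mem_sup_left (lcs_iaOn_le_lcsSmall (S := {i, j}) ?_ ?_)
    · exact (Set.ncard_insert_le _ _).trans (by simp)
    · have hj' : (⟨j, by simp⟩ : ({i, j} : Set ι)) ≠ ⟨i, by simp⟩ := fun h0 =>
        hj (congrArg Subtype.val h0)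
      exact lr_mem_iaOn (by simp) (gen _ hj', gen _ hj') rfl (inclFree_of _ _) (inclFree_of _ _)
  · refine Subgroup.mem_sup_left (lcs_iaOn_le_lcsSmall (S := {i, j, k}) ?_ ?_)
    · exact (Set.ncard_insert_le _ _).trans (Nat.succ_le_succ ((Set.ncard_insert_le _ _).trans
        (by simp)))
    · have hj' : (⟨j, by simp⟩ : ({i, j, k} : Set ι)) ≠ ⟨i, by simp⟩ := fun h0 =>
        hj (congrArg Subtype.val h0)
      have hk' : (⟨k, by simp⟩ : ({i, j, k} : Set ι)) ≠ ⟨i, by simp⟩ := fun h0 =>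
        hk (congrArg Subtype.val h0)
      refine lr_mem_iaOn _ (1, ⁅(gen _ hj')⁻¹, gen _ hk'⁆)
        (by simp [commutatorElement_def]) (map_one _) ?_
      simp only [commutatorElement_def, Subgroup.coe_mul, Subgroup.coe_inv, coe_gen, map_mul,
        map_inv, inclFree_of]

/-- The `m`-th term of the lower central series of `IA` is generated, modulo the next one, by
automorphisms supported by `3 (m + 1)` generators. -/
theorem lcs_IA_le_lcsSmall_sup (m : ℕ) : (FGrp.IA (FreeGroup ι)).lowerCentralSeries m ≤
    lcsSmall ι m ⊔ (FGrp.IA (FreeGroup ι)).lowerCentralSeries (m + 1) := by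
  induction m with
  | zero => exact IA_le_lcsSmall_sup
  | succ m ih =>
    set N := FGrp.IA (FreeGroup ι) with hN
    set Q := lcsSmall ι (m + 1) ⊔ N.lowerCentralSeries (m + 2) with hQ
    have hc := conj_mem_lcsSmall_sup (ι := ι) (m + 1)
    -- commutators of supported elements
    have h1 : ∀ S : Set ι, S.ncard ≤ 3 * (m + 1) → ∀ x ∈ (iaOn S).lowerCentralSeries m,
        ∀ T : Set ι, T.ncard ≤ 3 * (0 + 1) → ∀ y ∈ iaOn T, ⁅x, y⁆ ∈ Q := by
      intro S hS x hx T hT y hy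
      refine Subgroup.mem_sup_left (lcs_iaOn_le_lcsSmall (S := S ∪ T)
        ((Set.ncard_union_le S T).trans (by omega)) ?_)
      exact Subgroup.commutator_mem_commutator
        (lowerCentralSeries_le_of_le (iaOn_mono Set.subset_union_left) m hx)
        (iaOn_mono Set.subset_union_right hy)
    have h2 : ∀ S : Set ι, S.ncard ≤ 3 * (m + 1) → ∀ x ∈ (iaOn S).lowerCentralSeries m,
        ∀ c ∈ N, ⁅x, c⁆ ∈ Q := by
      intro S hS x hx c hcN
      have hxm := lowerCentralSeries_le_of_le (iaOn_le_IA S) m hx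
      have hle : lcsSmall ι 0 ⊔ N.lowerCentralSeries 1 ≤ commutatorMem N Q hc x := by
        refine sup_le (iSup₂_le fun T hT y hy => ⟨iaOn_le_IA T hy, ?_⟩) fun y hy =>
          ⟨lowerCentralSeries_le_self N 1 hy, ?_⟩
        · rw [← commutatorElement_inv]
          exact inv_mem (h1 S hS x hx T hT y hy)
        · refine Subgroup.mem_sup_right ?_
          -- By the three subgroups lemma, the part of `c` in `[N, N]` contributes only to a deeper
          -- term, so `c` may be taken among the supported generators.
          have : ⁅⁅N, N⁆, N.lowerCentralSeries m⁆ ≤ N.lowerCentralSeries (m + 2) :=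
            commutator_commutator_le_of_rotate
              (by rw [Subgroup.commutator_comm N]; exact le_rfl) le_rfl
          exact this (Subgroup.commutator_mem_commutator hy hxm)
      rw [← commutatorElement_inv]
      exact inv_mem (hle (IA_le_lcsSmall_sup hcN)).2
    refine Subgroup.commutator_le.mpr fun x hx c hcN => ?_
    have hle : lcsSmall ι m ⊔ N.lowerCentralSeries (m + 1) ≤ commutatorMem N Q hc c := by
      refine sup_le (iSup₂_le fun S hS y hy => ⟨?_, h2 S hS y hy c hcN⟩) fun y hy =>
        ⟨lowerCentralSeries_le_self N _ hy, Subgroup.mem_sup_right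
          (Subgroup.commutator_mem_commutator hy hcN)⟩
      exact lowerCentralSeries_le_self N m (lowerCentralSeries_le_of_le (iaOn_le_IA S) m hy)
    exact (hle (ih hx)).2

end Support

open Monoid (Coprod)

/-! # Standard objects and morphisms of `S(ab)` -/

namespace SAb

/-- The isomorphism of groups given by an isomorphism of `S(ab)`. -/
def addEquivOfIso {V W : SAb} (θ : V ≅ W) : V.carrier ≃+ W.carrier where
  toFun := Hom.sec θ.hom
  invFun := Hom.sec θ.inv
  left_inv x := DFunLike.congr_fun (congrArg Hom.sec θ.hom_inv_id) x
  right_inv x := DFunLike.congr_fun (congrArg Hom.sec θ.inv_hom_id) x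
  map_add' := map_add _

lemma hom_ext_of_surjective {V W : SAb} {f g : V ⟶ W} (h : Function.Surjective (Hom.sec f))
    (hs : Hom.sec f = Hom.sec g) : f = g := by
  refine hom_ext (AddMonoidHom.ext fun y => ?_) hs
  obtain ⟨x, rfl⟩ := h y
  rw [Hom.ret_sec_apply, hs, Hom.ret_sec_apply]

/-- A morphism factors through another one if this holds for the corresponding idempotents. -/
lemma exists_factor {U V W : SAb} (f : U ⟶ W) (g : V ⟶ W)
    (h1 : ∀ x, Hom.sec g (Hom.ret g (Hom.sec f x)) = Hom.sec f x)
    (h2 : ∀ y, Hom.ret f (Hom.sec g (Hom.ret g y)) = Hom.ret f y) : ∃ h : U ⟶ V, h ≫ g = f := by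
  refine ⟨⟨(Hom.ret f).comp (Hom.sec g), (Hom.ret g).comp (Hom.sec f), ?_⟩, ?_⟩
  · refine AddMonoidHom.ext fun x => ?_
    simp [h1]
  · exact hom_ext (AddMonoidHom.ext fun y => h2 y) (AddMonoidHom.ext fun x => h1 x)

/-- The standard free abelian group on a finite type. -/
def std (ι : Type) [Finite ι] : SAb := ⟨ι → ℤ⟩

variable {ι : Type} [Finite ι]

open Classical in
/-- The morphism of `S(ab)` given by a set of coordinates. -/
noncomputable def stdIncl (S : Set ι) : std S ⟶ std ι :=
  (⟨{ toFun := fun v k => v k, map_zero' := rfl, map_add' := fun _ _ => rfl },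
    { toFun := fun v k => if h : k ∈ S then v ⟨k, h⟩ else 0
      map_zero' := funext fun k => by split <;> rfl
      map_add' := fun v w => funext fun k => by
        simp only [Pi.add_apply]
        split
        · rfl
        · rfl },
    AddMonoidHom.ext fun v => funext fun k => by simp⟩ : Hom ⟨S → ℤ⟩ ⟨ι → ℤ⟩)

lemma stdIncl_sec_of_mem {S : Set ι} (v : S → ℤ) {k : ι} (h : k ∈ S) :
    Hom.sec (stdIncl S) v k = v ⟨k, h⟩ := dif_pos h

lemma stdIncl_sec_of_notMem {S : Set ι} (v : S → ℤ) {k : ι} (h : k ∉ S) :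
    Hom.sec (stdIncl S) v k = 0 := dif_neg h

/-- A basis identifies a free abelian group with a standard one. -/
noncomputable def isoStd {V : SAb} (b : Module.Basis ι ℤ V.carrier) : V ≅ std ι :=
  isoOfAddEquiv (W := ⟨ι → ℤ⟩) b.equivFun.toAddEquiv

lemma exists_iso_std (V : SAb) : ∃ (κ : Type) (_ : Finite κ), Nonempty (V ≅ std κ) :=
  ⟨_, inferInstance, ⟨isoStd (Module.Free.chooseBasis ℤ V.carrier)⟩⟩

/-- Every morphism of `S(ab)` is isomorphic to the inclusion of some coordinates. -/
lemma exists_iso_stdIncl {V W : SAb} (f : V ⟶ W) : ∃ (κ : Type) (_ : Finite κ) (S : Set κ)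
    (α : std S ≅ V) (β : std κ ≅ W), α.hom ≫ f = stdIncl S ≫ β.hom := by
  let Q : Submodule ℤ W.carrier := (Hom.ret f).toIntLinearMap.ker
  let A := Module.Free.ChooseBasisIndex ℤ V.carrier
  let a : Module.Basis A ℤ V.carrier := Module.Free.chooseBasis ℤ V.carrier
  let B := Module.Free.ChooseBasisIndex ℤ Q
  let b : Module.Basis B ℤ Q := Module.Free.chooseBasis ℤ Q
  let S : Set (A ⊕ B) := Set.range Sum.inl
  let e : A ≃ S := Equiv.ofInjective Sum.inl Sum.inl_injective
  -- the decomposition of `W`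
  let d : (V.carrier × Q) ≃+ W.carrier :=
    { toFun := fun p => Hom.sec f p.1 + p.2
      invFun := fun w => (Hom.ret f w, ⟨w - Hom.sec f (Hom.ret f w), by
        change Hom.ret f _ = 0
        simp⟩)
      left_inv := fun p => by
        have hq : Hom.ret f (p.2 : W.carrier) = 0 := p.2.2
        refine Prod.ext ?_ (Subtype.ext ?_)
        · simp [hq]
        · simp [hq]
      right_inv := fun w => by simp
      map_add' := fun p q => by simp; abel }
  let α : std S ≅ V := isoOfAddEquiv (V := ⟨S → ℤ⟩)
    ((LinearEquiv.funCongrLeft ℤ ℤ e).toAddEquiv.trans a.equivFun.symm.toAddEquiv)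
  let β : std (A ⊕ B) ≅ W := isoOfAddEquiv (V := ⟨A ⊕ B → ℤ⟩)
    (((LinearEquiv.sumArrowLequivProdArrow A B ℤ ℤ).toAddEquiv.trans
      (AddEquiv.prodCongr a.equivFun.symm.toAddEquiv b.equivFun.symm.toAddEquiv)).trans d)
  refine ⟨A ⊕ B, inferInstance, S, α, β, hom_ext (AddMonoidHom.ext fun w => funext fun k => ?_)
    (AddMonoidHom.ext fun (v : S → ℤ) => ?_)⟩
  · obtain ⟨x, rfl⟩ := e.surjective k
    change a.equivFun (Hom.ret f w) (e.symm (e x)) = a.equivFun (Hom.ret f w) x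
    rw [e.symm_apply_apply]
  · have h1 : (fun x => Hom.sec (stdIncl S) v (Sum.inl x)) = fun x => v (e x) :=
      funext fun x => stdIncl_sec_of_mem v (e x).2
    have h2 : (fun x => Hom.sec (stdIncl S) v (Sum.inr x)) = (0 : B → ℤ) :=
      funext fun x => stdIncl_sec_of_notMem v (by rintro ⟨y, hy⟩; cases hy)
    change Hom.sec f (a.equivFun.symm fun x => v (e x)) =
      Hom.sec f (a.equivFun.symm fun x => Hom.sec (stdIncl S) v (Sum.inl x)) +
        ((b.equivFun.symm fun x => Hom.sec (stdIncl S) v (Sum.inr x) : Q) : W.carrier)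
    rw [h1, h2, map_zero, Submodule.coe_zero, add_zero]

end SAb

/-! # Lifting isomorphisms of abelianizations -/

namespace FGrp

/-- An isomorphism of groups, as an isomorphism of `𝒢`. -/
def homOfMulEquiv {G H : FGrp} (e : G.carrier ≃* H.carrier) : G ⟶ H :=
  (⟨e.toMonoidHom, ⊥, by
    constructor
    · have h : ((Coprod.inr (M := (⊥ : Subgroup H.carrier))).comp e.symm.toMonoidHom).comp
          (Coprod.lift (⊥ : Subgroup H.carrier).subtype e.toMonoidHom) = MonoidHom.id _ := by
        refine Coprod.hom_ext (MonoidHom.ext fun k => ?_) (MonoidHom.ext fun x => ?_)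
        · obtain rfl : k = 1 := Subsingleton.elim _ _
          simp
        · simp
      exact Function.LeftInverse.injective
        (g := (Coprod.inr (M := (⊥ : Subgroup H.carrier))).comp e.symm.toMonoidHom)
        fun x => DFunLike.congr_fun h x
    · exact fun y => ⟨Coprod.inr (e.symm y), by simp⟩⟩ : Hom G H)

/-- An isomorphism of groups, as an isomorphism of `𝒢`. -/
def isoOfMulEquiv {G H : FGrp} (e : G.carrier ≃* H.carrier) : G ≅ H where
  hom := homOfMulEquiv e
  inv := homOfMulEquiv e.symm
  hom_inv_id := Hom.ext (MonoidHom.ext fun x => e.symm_apply_apply x) (by simp [homOfMulEquiv])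
  inv_hom_id := Hom.ext (MonoidHom.ext fun x => e.apply_symm_apply x) (by simp [homOfMulEquiv])

end FGrp

section Lift

/-- The identification of the abelianization of a free group with the standard free abelian
group. -/
noncomputable def evEquiv (ι : Type) [Finite ι] [DecidableEq ι] :
    Additive (Abelianization (FreeGroup ι)) ≃+ (ι → ℤ) :=
  AddEquiv.ofBijective (MonoidHom.toAdditiveLeft (Abelianization.lift (evHom (ι := ι)))) (by
    have := Fintype.ofFinite ι
    constructor
    · intro x y h
      obtain ⟨x, rfl⟩ := QuotientGroup.mk'_surjective _ x.toMul
      obtain ⟨y, rfl⟩ := QuotientGroup.mk'_surjective _ y.toMul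
      exact ev_eq_iff.mp h
    · intro v
      obtain ⟨w, rfl⟩ := ev_surjective v
      exact ⟨Additive.ofMul (Abelianization.of w), rfl⟩)

lemma evEquiv_of {ι : Type} [Finite ι] [DecidableEq ι] (w : FreeGroup ι) :
    evEquiv ι (Additive.ofMul (Abelianization.of w)) = ev w := rfl

lemma finite_generators (G : FGrp) : Finite (IsFreeGroup.Generators G.carrier) := by
  let e : FreeAbelianGroup (IsFreeGroup.Generators G.carrier) ≃+
      Additive (Abelianization G.carrier) :=
    MulEquiv.toAdditive (IsFreeGroup.toFreeGroup G.carrier).symm.abelianizationCongr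
  exact Module.Finite.finite_basis ((FreeAbelianGroup.basis _).map e.toIntLinearEquiv)

/-- An isomorphism of abelianizations of finitely generated free groups lifts to an isomorphism of
groups. -/
lemma exists_mulEquiv_lift {G H : FGrp}
    (θ : Additive (Abelianization G.carrier) ≃+ Additive (Abelianization H.carrier)) :
    ∃ Θ : G.carrier ≃* H.carrier, ∀ x, Additive.ofMul (Abelianization.of (Θ x)) =
      θ (Additive.ofMul (Abelianization.of x)) := by
  classical
  have := finite_generators G
  have := Fintype.ofFinite (IsFreeGroup.Generators G.carrier)
  set A := IsFreeGroup.Generators G.carrier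
  set B := IsFreeGroup.Generators H.carrier
  let α : FreeGroup A ≃* G.carrier := (IsFreeGroup.toFreeGroup G.carrier).symm
  let β : FreeGroup B ≃* H.carrier := (IsFreeGroup.toFreeGroup H.carrier).symm
  let αab : Additive (Abelianization (FreeGroup A)) ≃+ Additive (Abelianization G.carrier) :=
    MulEquiv.toAdditive α.abelianizationCongr
  let βab : Additive (Abelianization (FreeGroup B)) ≃+ Additive (Abelianization H.carrier) :=
    MulEquiv.toAdditive β.abelianizationCongr
  let e : A ≃ B := Equiv.ofFreeAbelianGroupEquiv ((αab.trans θ).trans βab.symm)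
  let Θ₀ : FreeGroup A ≃* H.carrier := (FreeGroup.freeGroupCongr e).trans β
  let τ : Additive (Abelianization (FreeGroup A)) ≃+ Additive (Abelianization H.carrier) :=
    MulEquiv.toAdditive Θ₀.abelianizationCongr
  -- The ranks agree, so some isomorphism `Θ₀` exists; `f` is its discrepancy from `θ`, and a lift
  -- of `f` to an automorphism corrects it.
  let f : (A → ℤ) ≃+ (A → ℤ) :=
    (((evEquiv A).symm.trans αab).trans (θ.trans τ.symm)).trans (evEquiv A)
  obtain ⟨φ, hφ⟩ := exists_rho_eq f.toIntLinearEquiv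
  refine ⟨(α.symm.trans φ).trans Θ₀, fun x => ?_⟩
  obtain ⟨x, rfl⟩ := α.surjective x
  have h1 : evEquiv A (Additive.ofMul (Abelianization.of (φ x))) =
      evEquiv A (τ.symm (θ (Additive.ofMul (Abelianization.of (α x))))) := by
    rw [evEquiv_of, ← rho_ev, hφ, ← evEquiv_of]
    change evEquiv A (τ.symm (θ (αab ((evEquiv A).symm (evEquiv A _))))) = _
    rw [AddEquiv.symm_apply_apply]
    rfl
  have h2 := (AddEquiv.symm_apply_eq _).mp ((evEquiv A).injective h1).symm
  rw [h2]
  change Additive.ofMul (Abelianization.of (Θ₀ (φ (α.symm (α x))))) = _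
  rw [MulEquiv.symm_apply_apply]
  rfl

lemma exists_iso_lift {G H : FGrp} (θ : FGrp.ab.obj G ≅ FGrp.ab.obj H) :
    ∃ a : G ≅ H, FGrp.ab.map a.hom = θ.hom := by
  obtain ⟨Θ, hΘ⟩ := exists_mulEquiv_lift (SAb.addEquivOfIso θ)
  refine ⟨FGrp.isoOfMulEquiv Θ, ?_⟩
  have hs : SAb.Hom.sec (FGrp.ab.map (FGrp.isoOfMulEquiv Θ).hom) = SAb.Hom.sec θ.hom := by
    refine AddMonoidHom.ext fun x => ?_
    obtain ⟨x, rfl⟩ := QuotientGroup.mk'_surjective _ x.toMul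
    exact hΘ x
  exact SAb.hom_ext_of_surjective (hs ▸ (SAb.addEquivOfIso θ).surjective) hs

/-- The abelianization of a standard free group. -/
noncomputable def abStd (ι : Type) [Finite ι] [DecidableEq ι] :
    FGrp.ab.obj (freeFGrp ι) ≅ SAb.std ι :=
  SAb.isoOfAddEquiv (V := FGrp.ab.obj (freeFGrp ι)) (W := ⟨ι → ℤ⟩) (evEquiv ι)

lemma ab_inclHom {ι : Type} [Finite ι] [DecidableEq ι] (S : Set ι) :
    FGrp.ab.map (inclHom S : freeFGrp S ⟶ freeFGrp ι) ≫ (abStd ι).hom =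
      (abStd S).hom ≫ SAb.stdIncl S := by
  let R : FreeGroup ι →* FreeGroup S := (inclHom S).retract
  have hsurj : ∀ (κ : Type) (x : Additive (Abelianization (FreeGroup κ))),
      ∃ w, x = Additive.ofMul (Abelianization.of w) := fun κ x => by
    obtain ⟨w, h⟩ := QuotientGroup.mk'_surjective _ x.toMul
    exact ⟨w, h.symm⟩
  have hr : ∀ w : FreeGroup ι, ∀ k : S, ev (R w) k = ev w k := by
    intro w k
    induction w using FreeGroup.induction_on with
    | C1 => rw [map_one]; simp
    | of i =>
      by_cases hi : i ∈ S
      · have h1 : R (FreeGroup.of i) = FreeGroup.of (⟨i, hi⟩ : S) :=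
          (congrArg R (inclFree_of S ⟨i, hi⟩).symm).trans ((inclHom S).retract_u _)
        rw [h1]
        simp [Pi.single_apply, Subtype.ext_iff]
      · have h1 : R (FreeGroup.of i) = 1 :=
          (inclHom S).retract_of_mem (Subgroup.subset_closure ⟨i, hi, rfl⟩)
        rw [h1, ev_one, ev_of, Pi.single_eq_of_ne fun h : (k : ι) = i => hi (h ▸ k.2)]
        rfl
    | inv_of i h => rw [map_inv, ev_inv, ev_inv, Pi.neg_apply, h, Pi.neg_apply]
    | mul x y hx hy => rw [map_mul, ev_mul, ev_mul, Pi.add_apply, hx, hy, Pi.add_apply]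
  refine SAb.hom_ext (AddMonoidHom.ext fun v => ?_) (AddMonoidHom.ext fun x => ?_)
  · obtain ⟨x, rfl⟩ := (evEquiv ι).surjective v
    obtain ⟨w, rfl⟩ := hsurj ι x
    refine (evEquiv S).injective ?_
    refine Eq.trans ?_ ((evEquiv S).apply_symm_apply _).symm
    have h1 := (evEquiv ι).symm_apply_apply (Additive.ofMul (Abelianization.of w))
    refine Eq.trans (congrArg (fun x => evEquiv S (SAb.Hom.ret (FGrp.ab.map
      (inclHom S : freeFGrp S ⟶ freeFGrp ι)) x)) h1) ?_
    exact funext fun k => hr w k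
  · obtain ⟨w, rfl⟩ := hsurj S x
    change ev (inclFree S w) = SAb.Hom.sec (SAb.stdIncl S) (ev w)
    funext k
    by_cases hk : k ∈ S
    · rw [SAb.stdIncl_sec_of_mem _ hk]
      exact ev_inclFree_apply w ⟨k, hk⟩
    · rw [SAb.stdIncl_sec_of_notMem _ hk, ev_inclFree_of_notMem w hk]

instance : FGrp.ab.EssSurj where
  mem_essImage V := by
    classical
    obtain ⟨κ, _, ⟨α⟩⟩ := SAb.exists_iso_std V
    exact ⟨freeFGrp κ, ⟨abStd κ ≪≫ α.symm⟩⟩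

/-- Up to isomorphisms, which lift, a morphism of `S(ab)` is a coordinate inclusion, and that one is
the abelianization of `inclHom S`. -/
instance : FGrp.ab.Full where
  map_surjective {G H} f := by
    classical
    obtain ⟨κ, _, S, α, β, h⟩ := SAb.exists_iso_stdIncl f
    obtain ⟨a, ha⟩ := exists_iso_lift (abStd S ≪≫ α)
    obtain ⟨b, hb⟩ := exists_iso_lift (abStd κ ≪≫ β)
    refine ⟨a.inv ≫ (inclHom S : freeFGrp S ⟶ freeFGrp κ) ≫ b.hom, ?_⟩
    rw [Iso.trans_hom] at ha
    rw [Functor.map_comp, Functor.map_comp, hb, Iso.trans_hom, reassoc_of% ab_inclHom S, ← h,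
      ← Category.assoc (abStd S).hom, ← ha, ← Functor.map_comp_assoc, Iso.inv_hom_id,
      CategoryTheory.Functor.map_id,
      Category.id_comp]

end Lift

/-! # Morphisms with the same abelianization -/

namespace FGrp

variable {G H : FGrp}

/-- The retraction `H = K ∗ u(G) →* K` that kills `u(G)`. -/
noncomputable def Hom.retractK (f : Hom G H) : H.carrier →* f.K :=
  Coprod.fst.comp f.equiv.symm.toMonoidHom

lemma Hom.retractK_coe (f : Hom G H) (k : f.K) : f.retractK k = k := by
  simp [Hom.retractK]

lemma Hom.retractK_u (f : Hom G H) (g : G.carrier) : f.retractK (f.u g) = 1 := by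
  simp [Hom.retractK]

/-- The complement of a morphism of `𝒢`, as an object of `𝒢`. -/
def Hom.compl (f : Hom G H) : FGrp :=
  -- Finite generation comes from the retraction onto `K`; freeness is the Nielsen–Schreier theorem,
  -- found by instance search.
  haveI : Group.FG f.K := Group.fg_of_surjective (f := f.retractK) fun k => ⟨k, f.retractK_coe k⟩
  ⟨f.K⟩

/-- The map `K_ab →+ H_ab`. -/
def Hom.complAb (f : Hom G H) :
    Additive (Abelianization f.K) →+ Additive (Abelianization H.carrier) :=
  (Abelianization.map f.K.subtype).toAdditive

lemma Hom.complAb_of (f : Hom G H) (k : f.K) :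
    f.complAb (Additive.ofMul (Abelianization.of k)) =
      Additive.ofMul (Abelianization.of (k : H.carrier)) := rfl

lemma exists_of (G : Type*) [Group G] (x : Additive (Abelianization G)) :
    ∃ w : G, x = Additive.ofMul (Abelianization.of w) := by
  obtain ⟨w, h⟩ := QuotientGroup.mk'_surjective _ x.toMul
  exact ⟨w, h.symm⟩

lemma Hom.complAb_injective (f : Hom G H) : Function.Injective f.complAb := by
  have h : (Abelianization.map f.retractK).comp (Abelianization.map f.K.subtype) =
      MonoidHom.id _ := by
    ext x
    simp [f.retractK_coe]
  exact Function.LeftInverse.injective (g := (Abelianization.map f.retractK).toAdditive)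
    fun x => DFunLike.congr_fun h x.toMul

/-- Hence the image of `K_ab` in `H_ab` is determined by the retraction alone, so it is the same for
two morphisms with equal abelianization. -/
lemma Hom.range_complAb (f : G ⟶ H) :
    (Hom.complAb f).range = (Abelianization.map (Hom.retract f)).toAdditive.ker := by
  ext z
  obtain ⟨z, rfl⟩ := exists_of _ z
  rw [AddMonoidHom.mem_ker]
  constructor
  · rintro ⟨k, hk⟩
    obtain ⟨k, rfl⟩ := exists_of _ k
    rw [← hk, Hom.complAb_of]
    exact congrArg (fun x => Additive.ofMul (Abelianization.of x)) (Hom.retract_of_mem f k.2)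
  · intro hz
    have h1 : (Abelianization.of : H.carrier →* _) =
        (Abelianization.of.comp ((Hom.K f).subtype.comp (Hom.retractK f))) *
          (Abelianization.of.comp ((Hom.u f).comp (Hom.retract f))) := by
      refine Hom.monoidHom_ext f (fun k hk => ?_) fun x => ?_
      · rw [MonoidHom.mul_apply, MonoidHom.comp_apply, MonoidHom.comp_apply, MonoidHom.comp_apply,
          MonoidHom.comp_apply, Hom.retract_of_mem f hk, Hom.retractK_coe f ⟨k, hk⟩]
        simp
      · rw [MonoidHom.mul_apply, MonoidHom.comp_apply, MonoidHom.comp_apply, MonoidHom.comp_apply,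
          MonoidHom.comp_apply, Hom.retract_u, Hom.retractK_u]
        simp
    have h2 : Abelianization.of (Hom.retract f z) = 1 := hz
    have h3 := DFunLike.congr_fun h1 z
    rw [MonoidHom.mul_apply, MonoidHom.comp_apply, MonoidHom.comp_apply, MonoidHom.comp_apply,
      MonoidHom.comp_apply, ← Abelianization.map_of (Hom.u f), h2, map_one, mul_one] at h3
    exact ⟨Additive.ofMul (Abelianization.of (Hom.retractK f z)), congrArg Additive.ofMul h3.symm⟩

/-- Morphisms with the same abelianization differ by an element of `IA`. -/
lemma exists_IA_of_ab_eq {f g : G ⟶ H} (h : ab.map f = ab.map g) :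
    ∃ y ∈ IA H.carrier, f ≫ homOfMulEquiv y = g := by
  have hr : (Abelianization.map (Hom.retract f)).toAdditive =
      (Abelianization.map (Hom.retract g)).toAdditive := congrArg SAb.Hom.ret h
  let θ : Additive (Abelianization (Hom.compl f).carrier) ≃+
      Additive (Abelianization (Hom.compl g).carrier) :=
    ((AddMonoidHom.ofInjective (Hom.complAb_injective f)).trans
      (AddEquiv.addSubgroupCongr (by rw [Hom.range_complAb, Hom.range_complAb, hr]))).trans
      (AddMonoidHom.ofInjective (Hom.complAb_injective g)).symm
  have hθ : ∀ x, Hom.complAb g (θ x) = Hom.complAb f x := fun x =>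
    AddMonoidHom.apply_ofInjective_symm (Hom.complAb_injective g) _
  obtain ⟨Θ, hΘ⟩ := exists_mulEquiv_lift θ
  let Θ' : Hom.K f ≃* Hom.K g := Θ
  have hΘ' : ∀ k : Hom.K f, Abelianization.of ((Θ' k : Hom.K g) : H.carrier) =
      Abelianization.of (k : H.carrier) := fun k =>
    (congrArg (Hom.complAb g) (hΘ k)).trans (hθ _)
  -- `y` carries `K * u(G)` for `f` to that for `g`, by the lifted isomorphism of the complements
  -- and the identity of `G`.
  let y : H.carrier ≃* H.carrier := (Hom.equiv f).symm.trans
    ((MulEquiv.coprodCongr Θ' (MulEquiv.refl G.carrier)).trans (Hom.equiv g))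
  have hyK : ∀ k : Hom.K f, y k = Θ' k := fun k => by simp [y]
  have hyu : ∀ x, y (Hom.u f x) = Hom.u g x := fun x => by simp [y]
  refine ⟨y, mem_IA_iff.mpr ?_, Hom.ext (MonoidHom.ext hyu) ?_⟩
  · refine DFunLike.congr_fun (f := Abelianization.of.comp (MulEquiv.toMonoidHom y))
      (g := Abelianization.of) (Hom.monoidHom_ext f (fun k hk => ?_) fun x => ?_)
    · exact (congrArg Abelianization.of (hyK ⟨k, hk⟩)).trans (hΘ' _)
    · refine (congrArg Abelianization.of (hyu x)).trans ?_
      exact (DFunLike.congr_fun (congrArg SAb.Hom.sec h)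
        (Additive.ofMul (Abelianization.of x))).symm
  · change ⊥ ⊔ (Hom.K f).map y.toMonoidHom = Hom.K g
    rw [bot_sup_eq]
    ext x
    constructor
    · rintro ⟨k, hk, rfl⟩
      exact (hyK ⟨k, hk⟩).symm ▸ (Θ' ⟨k, hk⟩).2
    · intro hx
      obtain ⟨k, hk⟩ := Θ'.surjective ⟨x, hx⟩
      exact ⟨k, k.2, (hyK k).trans (congrArg Subtype.val hk)⟩

lemma autMap_homOfMulEquiv (y ψ : MulAut H.carrier) :
    Hom.autMap (homOfMulEquiv y : H ⟶ H) ψ = y * ψ * y⁻¹ := by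
  refine MulEquiv.ext fun x => ?_
  obtain ⟨x, rfl⟩ := y.surjective x
  refine (Hom.autMap_u (homOfMulEquiv y : H ⟶ H) ψ x).trans ?_
  simp [homOfMulEquiv]

end FGrp

/-- Elements of `IA` act trivially on the quotients of the lower central series. -/
lemma gammaIA_map_homOfMulEquiv (n : ℕ) {H : FGrp} {y : MulAut H.carrier}
    (hy : y ∈ FGrp.IA H.carrier) :
    (gammaIA n).map (FGrp.homOfMulEquiv y : H ⟶ H) = 𝟙 _ := by
  refine AddCommGrpCat.hom_ext (AddMonoidHom.ext fun x => ?_)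
  obtain ⟨ψ, rfl⟩ : ∃ ψ : gamma n (FGrp.IA H.carrier),
      Additive.ofMul (ψ : GammaQuot n (FGrp.IA H.carrier)) = x :=
    QuotientGroup.mk_surjective (Additive.toMul x)
  refine congrArg Additive.ofMul (QuotientGroup.eq.mpr ?_)
  have e : ∀ a : FGrp.IA H.carrier, (a : MulAut H.carrier) = y * ψ.1.1 * y⁻¹ →
      a⁻¹ * ψ.1 ∈ gamma (n + 1) (FGrp.IA H.carrier) := by
    intro a ha
    have h := inv_mem (commutator_mem_gamma n (⟨y, hy⟩ : FGrp.IA H.carrier) (inv_mem ψ.2))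
    convert h using 1
    refine Subtype.ext ?_
    simp only [Subgroup.coe_mul, Subgroup.coe_inv, ha]
    group
  exact Subgroup.mem_subgroupOf.mpr 
    (e ⟨_, FGrp.Hom.autMap_mem_IA (FGrp.homOfMulEquiv y : H ⟶ H) ψ.1.2⟩
      (FGrp.autMap_homOfMulEquiv y ψ.1.1))

lemma gammaIA_map_eq (n : ℕ) {G H : FGrp} {f g : G ⟶ H} (h : FGrp.ab.map f = FGrp.ab.map g) :
    (gammaIA n).map f = (gammaIA n).map g := by
  obtain ⟨y, hy, rfl⟩ := FGrp.exists_IA_of_ab_eq h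
  rw [Functor.map_comp, gammaIA_map_homOfMulEquiv n hy, Category.comp_id]

/-! # Descent along full and essentially surjective functors -/

section Descent

variable {C D E : Type*} [Category* C] [Category* D] [Category* E] (L : C ⥤ D) [L.EssSurj]

instance faithful_whiskeringLeft_of_essSurj : ((Functor.whiskeringLeft C D E).obj L).Faithful where
  map_injective {F F'} α β h := by
    ext Y
    have h1 := congrArg (fun γ => γ.app (L.objPreimage Y)) h
    have h2 : α.app (L.obj (L.objPreimage Y)) = β.app (L.obj (L.objPreimage Y)) := h1
    rw [← cancel_epi (F.map (L.objObjPreimageIso Y).hom), α.naturality, β.naturality, h2]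

variable [L.Full]

/-- The component at an object is transported from a chosen preimage. Naturality holds because every
morphism between images lifts, and the same argument shows independence of the choice. -/
instance full_whiskeringLeft_of_full : ((Functor.whiskeringLeft C D E).obj L).Full where
  map_surjective {F F'} β := by
    let β' : ∀ X, F.obj (L.obj X) ⟶ F'.obj (L.obj X) := β.app
    have hβ : ∀ {X X' : C} (f : X ⟶ X'), F.map (L.map f) ≫ β' X' = β' X ≫ F'.map (L.map f) :=
      fun f => β.naturality f
    refine ⟨{ app := fun Y => F.map (L.objObjPreimageIso Y).inv ≫ β' (L.objPreimage Y) ≫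
                F'.map (L.objObjPreimageIso Y).hom
              naturality := fun Y Y' f => ?_ }, ?_⟩
    · obtain ⟨φ, hφ⟩ := L.map_surjective
        ((L.objObjPreimageIso Y).hom ≫ f ≫ (L.objObjPreimageIso Y').inv)
      have h1 := hβ φ
      rw [hφ] at h1
      simp only [Functor.map_comp, Category.assoc] at h1 ⊢
      rw [← cancel_epi (F.map (L.objObjPreimageIso Y).hom),
        ← cancel_mono (F'.map (L.objObjPreimageIso Y').inv)]
      simp only [Category.assoc, ← Functor.map_comp, Iso.hom_inv_id,
        ← Functor.map_comp_assoc] at h1 ⊢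
      simpa using h1
    · ext X
      obtain ⟨ψ, hψ⟩ := L.map_surjective (L.objObjPreimageIso (L.obj X)).hom
      change F.map (L.objObjPreimageIso (L.obj X)).inv ≫ β' (L.objPreimage (L.obj X)) ≫
        F'.map (L.objObjPreimageIso (L.obj X)).hom = β' X
      rw [← hψ, ← hβ, hψ, ← Functor.map_comp_assoc]
      simp

/-- A functor that identifies the morphisms identified by a full and essentially surjective functor
factors through it. -/
lemma exists_factorization (Γ : C ⥤ E)
    (h : ∀ {X Y : C} (f g : X ⟶ Y), L.map f = L.map g → Γ.map f = Γ.map g) :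
    ∃ F : D ⥤ E, Nonempty (L ⋙ F ≅ Γ) := by
  -- Dividing `C` by the relation of having the same image makes `L` an equivalence, whose inverse
  -- provides the factorization.
  let Q := CategoryTheory.Quotient.functor L.homRel
  let L' : CategoryTheory.Quotient L.homRel ⥤ D := CategoryTheory.Quotient.lift L.homRel L (by simp)
  let Γ' : CategoryTheory.Quotient L.homRel ⥤ E :=
    CategoryTheory.Quotient.lift L.homRel Γ fun X Y f g hfg => h f g hfg
  have : L'.IsEquivalence := 
    inferInstanceAs (CategoryTheory.Quotient.lift L.homRel L (by simp)).IsEquivalence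
  refine ⟨L'.inv ⋙ Γ', ⟨?_⟩⟩
  exact Functor.isoWhiskerLeft Q (Functor.isoWhiskerRight L'.asEquivalence.unitIso.symm Γ')

/-- Uniqueness of factorizations through a full and essentially surjective functor. -/
lemma existsUnique_iso_of_factorization {Γ : C ⥤ E} {F F' : D ⥤ E} (e : L ⋙ F ≅ Γ)
    (e' : L ⋙ F' ≅ Γ) : ∃! α : F' ≅ F, Functor.isoWhiskerLeft L α ≪≫ e = e' := by
  let W := (Functor.whiskeringLeft C D E).obj L
  let β : W.obj F' ≅ W.obj F := e' ≪≫ e.symm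
  refine ⟨W.preimageIso β, ?_, fun α hα => ?_⟩
  · have : Functor.isoWhiskerLeft L (W.preimageIso β) = β := by
      ext1
      exact W.map_preimage β.hom
    change Functor.isoWhiskerLeft L (W.preimageIso β) ≪≫ e = e'
    rw [this]
    simp [β]
  · ext1
    refine W.map_injective ?_
    have h1 : W.map (W.preimageIso β).hom = β.hom := W.map_preimage β.hom
    rw [h1]
    have : W.map α.hom ≫ e.hom = e'.hom := congrArg Iso.hom hα
    change _ = e'.hom ≫ e.inv
    rw [← this, Category.assoc, Iso.hom_inv_id, Category.comp_id]

end Descent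

/-! # A criterion for strong polynomiality -/

section Criterion

/-- A functor on `S(ab)` whose values are generated by the images of the values on the standard
objects of rank less than `k`. -/
def GeneratedBelow (k : ℕ) (F : SAb ⥤ Ab.{0}) : Prop :=
  ∀ (ι : Type) [Finite ι] (z : F.obj (SAb.std ι)),
    z ∈ ⨆ (S : Set ι) (_ : S.ncard < k), (F.map (SAb.stdIncl S)).hom.range

lemma isZero_of_generatedBelow {F : SAb ⥤ Ab.{0}} (h : GeneratedBelow 0 F) : IsZero F := by
  refine (Functor.isZero_iff F).mpr fun V => ?_
  obtain ⟨κ, _, ⟨α⟩⟩ := SAb.exists_iso_std V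
  refine IsZero.of_iso ?_ (F.mapIso α)
  rw [AddCommGrpCat.isZero_iff_subsingleton]
  refine ⟨fun x y => ?_⟩
  have h0 : ∀ z : F.obj (SAb.std κ), z = 0 := fun z => by
    have := h κ z
    simpa using this
  rw [h0 x, h0 y]

/-- The standard object on a disjoint union. -/
noncomputable def stdSum (x : SAb) {κ ι : Type} [Finite κ] [Finite ι] (c : x ≅ SAb.std κ) :
    SAb.std (κ ⊕ ι) ≅ x ⊗ SAb.std ι :=
  SAb.isoOfAddEquiv (V := ⟨κ ⊕ ι → ℤ⟩) (W := ⟨x.carrier × (ι → ℤ)⟩)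
    ((LinearEquiv.sumArrowLequivProdArrow κ ι ℤ ℤ).toAddEquiv.trans
      (AddEquiv.prodCongr (SAb.addEquivOfIso c).symm (AddEquiv.refl (ι → ℤ))))

/-- Coordinates that avoid `x` factor through the map induced by `0 ⟶ x`, hence die in the cokernel
`δ_x`. -/
lemma exists_factor_unit {x : SAb} {κ ι : Type} [Finite κ] [Finite ι] (c : x ≅ SAb.std κ)
    {T : Set (κ ⊕ ι)} (hT : ∀ k, Sum.inl k ∉ T) :
    ∃ h : SAb.std T ⟶ SAb.std ι,
      h ≫ (λ_ (SAb.std ι)).inv ≫ SAb.isInitialUnit.to x ▷ SAb.std ι =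
        SAb.stdIncl T ≫ (stdSum x c).hom := by
  refine SAb.exists_factor _ _ (fun v => ?_) (fun y => funext fun k => ?_)
  · have h0 : (fun j => SAb.Hom.sec (SAb.stdIncl T) v (Sum.inl j)) = (0 : κ → ℤ) :=
      funext fun j => SAb.stdIncl_sec_of_notMem v (hT j)
    refine Prod.ext ?_ rfl
    change 0 = (SAb.addEquivOfIso c).symm fun j => SAb.Hom.sec (SAb.stdIncl T) v (Sum.inl j)
    rw [h0]
    exact (map_zero (SAb.addEquivOfIso c).symm).symm
  · obtain ⟨k | k, hk⟩ := k
    · exact absurd hk (hT k)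
    · rfl

/-- Any coordinate inclusion factors through all of `x` and its coordinates in `ι`; this will be
used when `T` meets `κ`, so that fewer coordinates remain in `ι`. -/
lemma exists_factor_whisker {x : SAb} {κ ι : Type} [Finite κ] [Finite ι] (c : x ≅ SAb.std κ)
    (T : Set (κ ⊕ ι)) :
    ∃ h : SAb.std T ⟶ x ⊗ SAb.std (Sum.inr ⁻¹' T : Set ι),
      h ≫ (x ◁ SAb.stdIncl (Sum.inr ⁻¹' T : Set ι)) = SAb.stdIncl T ≫ (stdSum x c).hom := by
  refine SAb.exists_factor _ _ (fun v => ?_) (fun y => funext fun k => ?_)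
  · refine Prod.ext rfl (funext fun j => ?_)
    change SAb.Hom.sec (SAb.stdIncl _) (SAb.Hom.ret (SAb.stdIncl (Sum.inr ⁻¹' T : Set ι))
      fun j => SAb.Hom.sec (SAb.stdIncl T) v (Sum.inr j)) j =
        SAb.Hom.sec (SAb.stdIncl T) v (Sum.inr j)
    by_cases hj : Sum.inr j ∈ T
    · exact SAb.stdIncl_sec_of_mem (S := (Sum.inr ⁻¹' T : Set ι)) _ hj
    · exact (SAb.stdIncl_sec_of_notMem (S := (Sum.inr ⁻¹' T : Set ι)) _ hj).trans
        (SAb.stdIncl_sec_of_notMem v hj).symm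
  · obtain ⟨k | k, hk⟩ := k
    · rfl
    · change SAb.Hom.sec (SAb.stdIncl (Sum.inr ⁻¹' T : Set ι)) (SAb.Hom.ret (SAb.stdIncl _) y.2) k =
        y.2 k
      exact SAb.stdIncl_sec_of_mem (S := (Sum.inr ⁻¹' T : Set ι)) _ hk

lemma ncard_preimage_inr_lt {κ ι : Type} [Finite κ] [Finite ι] {T : Set (κ ⊕ ι)} {k : κ}
    (hk : Sum.inl k ∈ T) : (Sum.inr ⁻¹' T : Set ι).ncard < T.ncard := by
  rw [← Set.ncard_image_of_injective _ (Sum.inr_injective (α := κ))]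
  refine Set.ncard_lt_ncard ⟨Set.image_preimage_subset _ _, fun h => ?_⟩
  obtain ⟨y, -, hy⟩ := h hk
  cases hy

/-- Taking a difference functor lowers the ranks of the objects needed to generate. -/
lemma GeneratedBelow.diff {k : ℕ} {F : SAb ⥤ Ab.{0}} (h : GeneratedBelow (k + 1) F) (x : SAb) :
    GeneratedBelow k (diff SAb.isInitialUnit x F) := by
  intro ι _ z
  obtain ⟨κ, _, ⟨c⟩⟩ := SAb.exists_iso_std x
  let π : translate x F ⟶ StrongPol.diff SAb.isInitialUnit x F :=
    cokernel.π (toTranslate SAb.isInitialUnit x F)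
  have hπ' : Epi π := inferInstanceAs (Epi (cokernel.π _))
  have hπ : Epi (π.app (SAb.std ι)) := (NatTrans.epi_iff_epi_app π).mp hπ' _
  obtain ⟨z, rfl⟩ := (AddCommGrpCat.epi_iff_surjective _).mp hπ z
  obtain ⟨w, rfl⟩ := (AddCommGrpCat.epi_iff_surjective (F.map (stdSum (ι := ι) x c).hom)).mp
    inferInstance z
  let p : F.obj (x ⊗ SAb.std ι) ⟶ (StrongPol.diff SAb.isInitialUnit x F).obj (SAb.std ι) :=
    π.app (SAb.std ι)
  let q : F.obj (SAb.std (κ ⊕ ι)) ⟶ (StrongPol.diff SAb.isInitialUnit x F).obj (SAb.std ι) :=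
    F.map (stdSum x c).hom ≫ p
  suffices hle : (⨆ (T : Set (κ ⊕ ι)) (_ : T.ncard < k + 1), (F.map (SAb.stdIncl T)).hom.range) ≤
      (⨆ (S : Set ι) (_ : S.ncard < k), ((StrongPol.diff SAb.isInitialUnit x F).map
        (SAb.stdIncl S)).hom.range).comap q.hom from hle (h (κ ⊕ ι) w)
  refine iSup₂_le fun T hT => ?_
  rintro _ ⟨a, rfl⟩
  have hq : F.map (SAb.stdIncl T) ≫ q =
      F.map (SAb.stdIncl T ≫ (stdSum x c).hom) ≫ p := by
    rw [Functor.map_comp, Category.assoc]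
  refine AddSubgroup.mem_comap.mpr ?_
  rw [show q.hom ((F.map (SAb.stdIncl T)).hom a) = (F.map (SAb.stdIncl T) ≫ q).hom a from rfl]
  by_cases hk : ∃ k, Sum.inl k ∈ T
  · obtain ⟨j, hj⟩ := hk
    obtain ⟨g, hg⟩ := exists_factor_whisker (ι := ι) c T
    let p' : F.obj (x ⊗ SAb.std (Sum.inr ⁻¹' T : Set ι)) ⟶
        (StrongPol.diff SAb.isInitialUnit x F).obj (SAb.std (Sum.inr ⁻¹' T : Set ι)) := π.app _
    have hnat : F.map (x ◁ SAb.stdIncl (Sum.inr ⁻¹' T : Set ι)) ≫ p =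
      p' ≫ (StrongPol.diff SAb.isInitialUnit x F).map (SAb.stdIncl (Sum.inr ⁻¹' T)) :=
      π.naturality (SAb.stdIncl (Sum.inr ⁻¹' T : Set ι))
    rw [hq, ← hg, Functor.map_comp, Category.assoc, hnat]
    refine AddSubgroup.mem_iSup_of_mem (Sum.inr ⁻¹' T) (AddSubgroup.mem_iSup_of_mem ?_
      ⟨(F.map g ≫ p').hom a, rfl⟩)
    -- One coordinate of `T` is spent on `x`, so the bound goes from `k + 1` to `k`.
    exact lt_of_lt_of_le (ncard_preimage_inr_lt hj) (Nat.lt_succ_iff.mp hT)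
  · obtain ⟨g, hg⟩ := exists_factor_unit (ι := ι) c (T := T) fun k hk' => hk ⟨k, hk'⟩
    have h0 : F.map ((λ_ (SAb.std ι)).inv ≫ SAb.isInitialUnit.to x ▷ SAb.std ι) ≫ p = 0 :=
      congrArg (fun τ => τ.app (SAb.std ι)) (cokernel.condition (toTranslate SAb.isInitialUnit x F))
    rw [hq, ← hg, Functor.map_comp, Category.assoc, h0, comp_zero]
    exact zero_mem _

lemma GeneratedBelow.isPolLT {k : ℕ} {F : SAb ⥤ Ab.{0}} (h : GeneratedBelow k F) :
    IsPolLT SAb.isInitialUnit k F := by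
  induction k generalizing F with
  | zero => exact isZero_of_generatedBelow h
  | succ k ih => exact fun x => ih (h.diff x)

/-- The shift by one is that of `IsPol`, which is `IsPolLT` at `n + 1`. -/
lemma GeneratedBelow.strongDegree_le {n : ℕ} {F : SAb ⥤ Ab.{0}} (h : GeneratedBelow (n + 1) F) :
    strongDegree SAb.isInitialUnit F ≤ n :=
  iInf₂_le n h.isPolLT

end Criterion

/-! ### Generation of the graded quotients by automorphisms of small support -/

section Gamma

/-- The automorphisms whose class in the graded quotient belongs to a given subgroup. -/
def gradedComap {G : FGrp} (n : ℕ) (R : AddSubgroup (Additive (GammaQuot n (FGrp.IA G.carrier)))) :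
    Subgroup (MulAut G.carrier) where
  carrier := {φ | ∃ ψ : gamma n (FGrp.IA G.carrier), ψ.1.1 = φ ∧
    Additive.ofMul (ψ : GammaQuot n (FGrp.IA G.carrier)) ∈ R}
  one_mem' := ⟨1, rfl, R.zero_mem⟩
  mul_mem' := by
    rintro _ _ ⟨ψ, rfl, h⟩ ⟨ψ', rfl, h'⟩
    exact ⟨ψ * ψ', rfl, R.add_mem h h'⟩
  inv_mem' := by
    rintro _ ⟨ψ, rfl, h⟩
    exact ⟨ψ⁻¹, rfl, R.neg_mem h⟩

/-- The graded quotients of the lower central series of `IA` are generated by elements supported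
by few generators. -/
lemma gammaIA_generated (n : ℕ) {ι : Type} [Finite ι] (z : (gammaIA n).obj (freeFGrp ι)) :
    z ∈ ⨆ (S : Set ι) (_ : S.ncard < 3 * n + 1),
      ((gammaIA n).map (inclHom S : freeFGrp S ⟶ freeFGrp ι)).hom.range := by
  let N := FGrp.IA (freeFGrp ι).carrier
  obtain ⟨ψ, rfl⟩ : ∃ ψ : gamma n N, Additive.ofMul (ψ : GammaQuot n N) = z :=
    QuotientGroup.mk_surjective (Additive.toMul z)
  cases n with
  | zero =>
    -- With the convention `γ_0 = γ_1` the quotient is zero, so degree `0` needs no generators.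
    have : (ψ : GammaQuot 0 N) = 1 :=
      (QuotientGroup.eq_one_iff ψ).mpr (Subgroup.mem_subgroupOf.mpr (Subgroup.mem_top ψ.1))
    rw [this]
    exact zero_mem _
  | succ m =>
    set R := ⨆ (S : Set ι) (_ : S.ncard < 3 * (m + 1) + 1),
      ((gammaIA (m + 1)).map (inclHom S : freeFGrp S ⟶ freeFGrp ι)).hom.range
    have hle : lcsSmall ι m ⊔ (FGrp.IA (FreeGroup ι)).lowerCentralSeries (m + 1) ≤
        gradedComap (G := freeFGrp ι) (m + 1) R := by
      refine sup_le (iSup₂_le fun S hS => ?_) ?_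
      -- The series of the image of `IA` of the smaller free group is the image of its series, so
      -- its elements come from `gammaIA` of the smaller group.
      · rw [iaOn, ← Subgroup.map_lowerCentralSeries, ← Subgroup.top_subtype_lowerCentralSeries]
        rintro _ ⟨_, ⟨χ, hχ, rfl⟩, rfl⟩
        let f : FGrp.IA (freeFGrp S).carrier →* N :=
          (FGrp.iaFunctor.map (inclHom S : freeFGrp S ⟶ freeFGrp ι)).hom
        refine ⟨⟨f χ, map_mem_gamma f (m + 1) hχ⟩, rfl, ?_⟩
        refine AddSubgroup.mem_iSup_of_mem S (AddSubgroup.mem_iSup_of_mem (Nat.lt_succ_of_le hS) ?_)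
        exact ⟨Additive.ofMul ((⟨χ, hχ⟩ : gamma (m + 1) (FGrp.IA (freeFGrp S).carrier)) :
          GammaQuot (m + 1) (FGrp.IA (freeFGrp S).carrier)), rfl⟩
      · rw [← Subgroup.top_subtype_lowerCentralSeries]
        rintro _ ⟨χ, hχ, rfl⟩
        refine ⟨⟨χ, Subgroup.lowerCentralSeries_antitone _ (Nat.le_succ m) hχ⟩, rfl, ?_⟩
        rw [(QuotientGroup.eq_one_iff _).mpr (Subgroup.mem_subgroupOf.mpr hχ)]
        exact R.zero_mem
    have hψ : ψ.1.1 ∈ (FGrp.IA (FreeGroup ι)).lowerCentralSeries m := by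
      rw [← Subgroup.top_subtype_lowerCentralSeries]
      exact ⟨ψ.1, ψ.2, rfl⟩
    obtain ⟨ψ', h1, h2⟩ := hle (lcs_IA_le_lcsSmall_sup m hψ)
    rwa [show ψ' = ψ from Subtype.ext (Subtype.ext h1)] at h2

/-- On standard free groups, abelianization turns `inclHom S` into `SAb.stdIncl S`, so generation by
small supports becomes generation by small coordinate sets. -/
lemma generatedBelow_of_iso {n : ℕ} {F : SAb ⥤ Ab.{0}} (e : FGrp.ab ⋙ F ≅ gammaIA n) :
    GeneratedBelow (3 * n + 1) F := by
  classical
  intro ι _ z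
  let q : (gammaIA n).obj (freeFGrp ι) ⟶ F.obj (SAb.std ι) :=
    e.inv.app (freeFGrp ι) ≫ F.map (abStd ι).hom
  obtain ⟨w, rfl⟩ := (AddCommGrpCat.epi_iff_surjective q).mp inferInstance z
  suffices hle : (⨆ (S : Set ι) (_ : S.ncard < 3 * n + 1),
      ((gammaIA n).map (inclHom S : freeFGrp S ⟶ freeFGrp ι)).hom.range) ≤
      (⨆ (S : Set ι) (_ : S.ncard < 3 * n + 1), (F.map (SAb.stdIncl S)).hom.range).comap q.hom
    from hle (gammaIA_generated n w)
  refine iSup₂_le fun S hS => ?_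
  rintro _ ⟨a, rfl⟩
  have hq : (gammaIA n).map (inclHom S : freeFGrp S ⟶ freeFGrp ι) ≫ q =
      (e.inv.app (freeFGrp S) ≫ F.map (abStd S).hom) ≫ F.map (SAb.stdIncl S) := by
    have := e.inv.naturality (inclHom S : freeFGrp S ⟶ freeFGrp ι)
    simp only [q]
    rw [reassoc_of% this, Category.assoc]
    change _ ≫ F.map _ ≫ _ = _
    rw [← F.map_comp, ← F.map_comp, ab_inclHom]
  refine AddSubgroup.mem_comap.mpr ?_
  rw [show q.hom (((gammaIA n).map (inclHom S : freeFGrp S ⟶ freeFGrp ι)).hom a) =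
    ((gammaIA n).map (inclHom S : freeFGrp S ⟶ freeFGrp ι) ≫ q).hom a from rfl, hq]
  exact AddSubgroup.mem_iSup_of_mem S (AddSubgroup.mem_iSup_of_mem hS ⟨_, rfl⟩)

end Gamma

end StrongPol

theorem mainTheorem9 (n : ℕ) :
    ∃ (F : StrongPol.SAb ⥤ Ab.{0}) (e : StrongPol.FGrp.ab ⋙ F ≅ StrongPol.gammaIA n),
      (∀ (F' : StrongPol.SAb ⥤ Ab.{0}) (e' : StrongPol.FGrp.ab ⋙ F' ≅ StrongPol.gammaIA n),
        ∃! α : F' ≅ F, Functor.isoWhiskerLeft StrongPol.FGrp.ab α ≪≫ e = e') ∧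
      StrongPol.IsStronglyPolynomial StrongPol.SAb.isInitialUnit F ∧
      StrongPol.strongDegree StrongPol.SAb.isInitialUnit F ≤ ((3 * n : ℕ) : ℕ∞) := by
  obtain ⟨F, ⟨e⟩⟩ := StrongPol.exists_factorization StrongPol.FGrp.ab (StrongPol.gammaIA n)
    fun _ _ h => StrongPol.gammaIA_map_eq n h
  have hF := StrongPol.generatedBelow_of_iso e
  exact ⟨F, e, fun F' e' => StrongPol.existsUnique_iso_of_factorization _ e e',
    ⟨3 * n, hF.isPolLT⟩, hF.strongDegree_le⟩
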